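/- Let $A$ be a finite non-empty alphabet and write a past as $x=(\dots,x_{-2},x_{-1})$, with $x^{-1}_{-k}=x_{-k}\cdots x_{-1}$ (the empty word for $k=0$). For words, $w\preceq w'$ means that $w$ is a suffix of $w'$. Put $$t_*=\ln\frac{|A|\,(14+2\log_2 n)\,(1+\frac{n(n-1)}2)}{\delta},\qquad t=|A|\,t_*,\qquad d_{\rm TV}(p,q)=\tfrac12\sum_{a\in A}|p(a)-q(a)| .$$ **The estimator.** Let $n\ge1$, $\delta\in(0,1)$ and let $X_1,\dots,X_n\in A$ be a sample. For a word $w$ let $N_j(w)$ be the number of $i$ with $|w|\le i\le j$ such that $X_1\cdots X_i$ ends with $w$. If $N_{n-1}(w)>0$, put $\hat p(a|w)=N_n(wa)/N_{n-1}(w)$ and $$\mathrm{conf}(w,a)=\min\Big\{(2\sqrt2+2)\sqrt{\tfrac{\hat p(a|w)t_*}{N_{n-1}(w)}}+(3+2\sqrt2)\tfrac{t_*}{N_{n-1}(w)},\,1\Big\};$$ otherwise put $\hat p(a|w)=1/|A|$ and $\mathrm{conf}(w,a)=1$. Put $\hat p_-(a|w)=\min_{w'\succeq w}(\hat p(a|w')+\mathrm{conf}(w',a))$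 and $\hat h(x)=\min\{h\ge0:\sum_a\hat p_-(a|x^{-1}_{-h})\ge1\}$. Write $m_k(a)=\hat p_-(a|x^{-1}_{-k})$ for $k\ge0$ and $m_{-1}(a)=0$. For $0\le k<\hat h=\hat h(x)$ put $\hat\lambda_k=\sum_a(m_k(a)-m_{k-1}(a))$ and $\hat p_k(a)=(m_k(a)-m_{k-1}(a))/\hat\lambda_k$ (terms with $\hat\lambda_k=0$ contribute nothing below). For $k=\hat h$ put $\hat\lambda_{\hat h}=1-\sum_a m_{\hat h-1}(a)$ and $\hat p_{\hat h}(a)=(m_{\hat h}(a)-m_{\hat h-1}(a))/\sum_b(m_{\hat h}(b)-m_{\hat h-1}(b))$. Finally $$\hat P_n(a|x)=\sum_{k=0}^{\hat h(x)}\hat\lambda_k\,\hat p_k(a).$$ **Claims.** 1. $\hat P_n$ is efficiently computable: there are one program for a unit-cost real random access machine (natural-number indices with addition, truncated subtraction and comparison; real numbers with $+,-,\times,/,\sqrt{\ },\ln$ and comparison) and one constant $C$ such that, for all $A$, $n\ge 1$, samples, $\delta$ and $x$, the program, given $|A|$, $n$, $\delta$, $X_1,\dots,X_n$ and $x_{-1},\dots,x_{-n}$,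 computes $(\hat P_n(a|x))_{a\in A}$ in at most $C|A|^2n^2$ steps, writing to at most $C|A|n$ memory cells. 2. $\hat P_n$ is a transition probability: it is non-negative, $\sum_a\hat P_n(a|x)=1$ for every $x$, and it is measurable in $x$. 3. Let $(X_i)_{i\in\mathbb Z}$ be a stationary $A$-valued process with almost surely continuous transition probabilities, that is, for some version $p$ of $\Pr(X_0=a\mid X^{-1}_{-\infty}=x)$, almost surely $$\lim_{k\to\infty}\ \sup\{d_{\rm TV}(p(\cdot|y),p(\cdot|z)):\ y,z\text{ end with }X^{-1}_{-k}\}=0 .$$ Let $p_-(a|w)$ be the essential infimum of $\Pr(X_0=a\mid X^{-1}_{-\infty})$ over the pasts ending with $w$ if these have positive probability, and otherwise $p_-(a|w)=p_-(a|w')$ with $w'$ the longest suffix of $w$ of positive probability. For a version $p$ let $D_p$ be the set of pasts $x$ with $p(a|x)\ge p_-(a|x^{-1}_{-k})$ for all $a\in A$, $k\ge0$. Then: (a) $\tilde p(a|x)=\lim_k p_-(a|x^{-1}_{-k})+\frac1{|A|}\big(1-\lim_k\sum_b p_-(b|x^{-1}_{-k})\big)$ is a version of the transition probabilities, and $D_{\tilde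 p}$ contains every past; for every version $p$, $X^{-1}_{-\infty}\in D_p$ almost surely. (b) For every version $p$, every $n\ge1$ and every $\delta\in(0,1)$, with probability at least $1-\delta$, simultaneously for all pasts $x\in D_p$ (so for all pasts if $p=\tilde p$) and all $L\ge 0$, $$d_{\rm TV}(p(\cdot|x),\hat P_n(\cdot|x))\le 1-\sum_{a\in A}p_-(a|x^{-1}_{-L})+(4+4\sqrt2)\sqrt{\frac{t}{N_{n-1}(x^{-1}_{-L})}}+(6+4\sqrt2)\frac{t}{N_{n-1}(x^{-1}_{-L})},$$ the right-hand side being $+\infty$ if $N_{n-1}(x^{-1}_{-L})=0$. -/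

import Mathlib

open Filter MeasureTheory
open scoped Topology

universe u v

namespace RandomContext

/-! ### Words, pasts, total variation -/

/-- A past `x = (…, x₋₃, x₋₂, x₋₁)` over `A`; the letter `x₋₁₋ⱼ` is `x j`. -/
abbrev Past (A : Type*) := ℕ → A

/-- The word `x₋ₖ … x₋₂ x₋₁`, in chronological order (empty for `k = 0`). -/
def lastWord {A : Type*} (x : Past A) (k : ℕ) : List A :=
  ((List.range k).map x).reverse

/-- The past `x` ends with the word `w`. -/
def EndsWith {A : Type*} (x : Past A) (w : List A) : Prop :=
  lastWord x w.length = w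

/-- Total variation distance between two weight functions on a finite alphabet. -/
noncomputable def dTV {A : Type*} [Fintype A] (p q : A → ℝ) : ℝ :=
  (1 / 2) * ∑ a, |p a - q a|

/-! ### Stationary processes and their transition probabilities -/

section Stochastic

variable {A : Type*} {Ω : Type*} [MeasurableSpace A] [MeasurableSpace Ω]

/-- The past `(…, X₋₂, X₋₁)` of a two-sided process. -/
def past (X : ℤ → Ω → A) (ω : Ω) : Past A := fun j => X (-1 - (j : ℤ)) ω

/-- The law of the process on `A^ℤ` is invariant under the shift. -/
def HasShiftInvariantLaw (P : Measure Ω) (X : ℤ → Ω → A) : Prop :=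
  P.map (fun ω (i : ℤ) => X (i + 1) ω) = P.map (fun ω (i : ℤ) => X i ω)

/-- The conditional probability of `X₀ = a` given the past, as a random variable. -/
noncomputable def condProb (P : Measure Ω) (X : ℤ → Ω → A) (a : A) : Ω → ℝ :=
  P[(X 0 ⁻¹' {a}).indicator (fun _ => (1 : ℝ)) | MeasurableSpace.comap (past X) inferInstance]

/-- Transition probabilities `q(a | x)`, written `q a x`, from infinite pasts to the alphabet. -/
structure IsTransitionProbability [Fintype A] (q : A → Past A → ℝ) : Prop where
  measurable : ∀ a, Measurable (q a)
  nonneg : ∀ a x, 0 ≤ q a x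
  sum_eq_one : ∀ x, ∑ a, q a x = 1

/-- `p` is a version of the transition probabilities of the process. -/
structure IsVersion [Fintype A] (P : Measure Ω) (X : ℤ → Ω → A) (p : A → Past A → ℝ) : Prop where
  isTransitionProbability : IsTransitionProbability p
  ae_eq : ∀ a, (fun ω => p a (past X ω)) =ᵐ[P] condProb P X a

/-- The oscillation of `p` over the pasts that end with `w`. -/
noncomputable def oscillation [Fintype A] (p : A → Past A → ℝ) (w : List A) : ℝ :=
  sSup {d | ∃ y z : Past A, EndsWith y w ∧ EndsWith z w ∧
    d = dTV (fun a => p a y) (fun a => p a z)}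

/-- Almost sure continuity of the transition probabilities (for some version). -/
def IsASContinuous [Fintype A] (P : Measure Ω) (X : ℤ → Ω → A) : Prop :=
  ∃ p : A → Past A → ℝ, IsVersion P X p ∧
    ∀ᵐ ω ∂P, Tendsto (fun k => oscillation p (lastWord (past X ω) k)) atTop (𝓝 0)

/-- The event that the past of the process ends with `w`. -/
def pastCylinder (X : ℤ → Ω → A) (w : List A) : Set Ω := {ω | EndsWith (past X ω) w}

/-- The longest suffix of `w` with which the past ends with positive probability. -/
noncomputable def positiveSuffix (P : Measure Ω) (X : ℤ → Ω → A) (w : List A) : List A :=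
  w.drop (sInf {k | 0 < P (pastCylinder X (w.drop k))})

/-- The minorant `p₋(a | w)`: the essential infimum of the conditional probability of `X₀ = a`
given the past, over the pasts that end with `w`; for a word `w` of probability zero it is the
minorant at the longest suffix of `w` that has positive probability. -/
noncomputable def minorant (P : Measure Ω) (X : ℤ → Ω → A) (a : A) (w : List A) : ℝ :=
  essInf (condProb P X a) (P.restrict (pastCylinder X (positiveSuffix P X w)))

/-- The version of the transition probabilities built from the minorants, defined at every past:
`lim_k p₋(a | x₋ₖ…x₋₁)`, with the missing mass spread uniformly.  The limits of the minorants are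
suprema because these increase with `k`. -/
noncomputable def canonicalVersion [Fintype A] (P : Measure Ω) (X : ℤ → Ω → A)
    (a : A) (x : Past A) : ℝ :=
  (⨆ k, minorant P X a (lastWord x k)) +
    (1 - ∑ b, ⨆ k, minorant P X b (lastWord x k)) * (1 / Fintype.card A)

/-- The past `x` is one at which the transition probabilities `p(· | x)` dominate all minorants
along `x`. -/
def Dominates (P : Measure Ω) (X : ℤ → Ω → A) (p : A → Past A → ℝ) (x : Past A) : Prop :=
  ∀ (k : ℕ) (a : A), minorant P X a (lastWord x k) ≤ p a x

/-- The sample `X₁, …, Xₙ`. -/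
def sample (X : ℤ → Ω → A) (n : ℕ) (ω : Ω) : List A :=
  List.ofFn (fun i : Fin n => X ((i : ℤ) + 1) ω)

end Stochastic

/-! ### The estimator

Below `s` is the list `[X₁, …, Xₙ]` and `n = s.length`. -/

section Estimator

variable {A : Type*}

open Classical in
/-- `N_j(w)`: the number of `i` with `|w| ≤ i ≤ j` such that `X₁ … Xᵢ` ends with `w`. -/
noncomputable def occ (s : List A) (j : ℕ) (w : List A) : ℕ :=
  ((Finset.Icc w.length j).filter (fun i => w <:+ s.take i)).card

/-- `N_{n-1}(w)`. -/
noncomputable def occPred (s : List A) (w : List A) : ℕ := occ s (s.length - 1) w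

variable [Fintype A]

/-- Empirical transition probabilities. -/
noncomputable def empP (s : List A) (a : A) (w : List A) : ℝ :=
  if occPred s w = 0 then 1 / Fintype.card A
  else (occ s s.length (w ++ [a]) : ℝ) / occPred s w

/-- `t_*(n, δ, d) = ln (d (14 + 2 log₂ n) (1 + n (n - 1) / 2) / δ)`. -/
noncomputable def tStar (n : ℕ) (δ : ℝ) (d : ℕ) : ℝ :=
  Real.log ((d : ℝ) * (14 + 2 * Real.logb 2 n) * (1 + (n : ℝ) * ((n : ℝ) - 1) / 2) / δ)

/-- `t(n, δ, d) = d t_*(n, δ, d)`. -/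
noncomputable def tParam (n : ℕ) (δ : ℝ) (d : ℕ) : ℝ := d * tStar n δ d

/-- Confidence radii. -/
noncomputable def conf (s : List A) (δ : ℝ) (a : A) (w : List A) : ℝ :=
  if occPred s w = 0 then 1
  else min
    ((2 * √2 + 2) * √(empP s a w * tStar s.length δ (Fintype.card A) / occPred s w)
      + (3 + 2 * √2) * (tStar s.length δ (Fintype.card A) / occPred s w)) 1

/-- The empirical minorant: the infimum of `empP + conf` over all words that end with `w`. -/
noncomputable def empMinorant (s : List A) (δ : ℝ) (a : A) (w : List A) : ℝ :=
  ⨅ v : {v : List A // w <:+ v}, (empP s a v.1 + conf s δ a v.1)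

/-- The empirical minorant at `x₋ₖ₊₁…x₋₁`, which is set to `0` for `k = 0`. -/
noncomputable def prevMinorant (s : List A) (δ : ℝ) (a : A) (x : Past A) : ℕ → ℝ
  | 0 => 0
  | k + 1 => empMinorant s δ a (lastWord x k)

/-- The empirical truncation point. -/
noncomputable def truncPoint (s : List A) (δ : ℝ) (x : Past A) : ℕ :=
  sInf {h : ℕ | 1 ≤ ∑ a, empMinorant s δ a (lastWord x h)}

/-- The weights of the empirical random context representation. -/
noncomputable def weight (s : List A) (δ : ℝ) (x : Past A) (k : ℕ) : ℝ :=
  if k < truncPoint s δ x then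
    ∑ a, (empMinorant s δ a (lastWord x k) - prevMinorant s δ a x k)
  else if k = truncPoint s δ x then 1 - ∑ a, prevMinorant s δ a x k
  else 0

/-- The transition probabilities of order `k` of the empirical random context representation. -/
noncomputable def kernelP (s : List A) (δ : ℝ) (a : A) (x : Past A) (k : ℕ) : ℝ :=
  if k < truncPoint s δ x then
    (empMinorant s δ a (lastWord x k) - prevMinorant s δ a x k) / weight s δ x k
  else if k = truncPoint s δ x then
    (empMinorant s δ a (lastWord x k) - prevMinorant s δ a x k) /
      ∑ b, (empMinorant s δ b (lastWord x k) - prevMinorant s δ b x k)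
  else 1 / Fintype.card A

/-- The estimated transition probabilities. -/
noncomputable def estimator (s : List A) (δ : ℝ) (a : A) (x : Past A) : ℝ :=
  ∑ k ∈ Finset.range (truncPoint s δ x + 1), weight s δ x k * kernelP s δ a x k

end Estimator

/-! ### A real random access machine with step count

Structured programs over two memories, one of natural numbers and one of real numbers, each
organised in arrays with two indices.  Natural numbers (indices) admit addition, truncated
subtraction and comparison; real numbers admit the field operations, square root, logarithm and
comparison; the only constants are natural numbers.  Every operation has unit cost. -/

namespace Machine

/-- A memory state: `nat b i j` is the entry `(i, j)` of the array `b` of natural numbers. -/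
structure State where
  nat : ℕ → ℕ → ℕ → ℕ
  real : ℕ → ℕ → ℕ → ℝ

/-- Memory cells: left for natural numbers, right for real numbers. -/
abbrev Cell := (ℕ × ℕ × ℕ) ⊕ (ℕ × ℕ × ℕ)

/-- Index expressions. -/
inductive NExpr where
  | const (k : ℕ)
  | get (b : ℕ) (i j : NExpr)
  | add (e f : NExpr)
  | sub (e f : NExpr)

/-- Value of an index expression. -/
def NExpr.eval (σ : State) : NExpr → ℕ
  | .const k => k
  | .get b i j => σ.nat b (i.eval σ) (j.eval σ)
  | .add e f => e.eval σ + f.eval σ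
  | .sub e f => e.eval σ - f.eval σ

/-- Number of operations in an index expression. -/
def NExpr.cost : NExpr → ℕ
  | .const _ => 1
  | .get _ i j => i.cost + j.cost + 1
  | .add e f => e.cost + f.cost + 1
  | .sub e f => e.cost + f.cost + 1

/-- Real expressions. -/
inductive RExpr where
  | ofNat (e : NExpr)
  | get (b : ℕ) (i j : NExpr)
  | add (e f : RExpr)
  | sub (e f : RExpr)
  | mul (e f : RExpr)
  | div (e f : RExpr)
  | sqrt (e : RExpr)
  | log (e : RExpr)

/-- Value of a real expression. -/
noncomputable def RExpr.eval (σ : State) : RExpr → ℝ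
  | .ofNat e => (e.eval σ : ℝ)
  | .get b i j => σ.real b (i.eval σ) (j.eval σ)
  | .add e f => e.eval σ + f.eval σ
  | .sub e f => e.eval σ - f.eval σ
  | .mul e f => e.eval σ * f.eval σ
  | .div e f => e.eval σ / f.eval σ
  | .sqrt e => √(e.eval σ)
  | .log e => Real.log (e.eval σ)

/-- Number of operations in a real expression. -/
def RExpr.cost : RExpr → ℕ
  | .ofNat e => e.cost + 1
  | .get _ i j => i.cost + j.cost + 1
  | .add e f => e.cost + f.cost + 1
  | .sub e f => e.cost + f.cost + 1
  | .mul e f => e.cost + f.cost + 1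
  | .div e f => e.cost + f.cost + 1
  | .sqrt e => e.cost + 1
  | .log e => e.cost + 1

/-- Tests. -/
inductive Test where
  | nle (e f : NExpr)
  | rle (e f : RExpr)
  | neg (b : Test)
  | conj (b c : Test)

/-- Truth of a test. -/
def Test.holds (σ : State) : Test → Prop
  | .nle e f => e.eval σ ≤ f.eval σ
  | .rle e f => e.eval σ ≤ f.eval σ
  | .neg b => ¬ b.holds σ
  | .conj b c => b.holds σ ∧ c.holds σ

/-- Number of operations in a test. -/
def Test.cost : Test → ℕ
  | .nle e f => e.cost + f.cost + 1
  | .rle e f => e.cost + f.cost + 1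
  | .neg b => b.cost + 1
  | .conj b c => b.cost + c.cost + 1

/-- Programs. -/
inductive Program where
  | skip
  | nset (b : ℕ) (i j e : NExpr)
  | rset (b : ℕ) (i j : NExpr) (e : RExpr)
  | seq (c d : Program)
  | ite (b : Test) (c d : Program)
  | loop (b : Test) (c : Program)

/-- Overwrite one cell of natural numbers. -/
def State.setNat (σ : State) (b i j v : ℕ) : State where
  nat b' i' j' := if b' = b ∧ i' = i ∧ j' = j then v else σ.nat b' i' j'
  real := σ.real

/-- Overwrite one cell of real numbers. -/
noncomputable def State.setReal (σ : State) (b i j : ℕ) (v : ℝ) : State where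
  nat := σ.nat
  real b' i' j' := if b' = b ∧ i' = i ∧ j' = j then v else σ.real b' i' j'

/-- `Exec W c σ T τ`: started in the state `σ`, the program `c` halts after exactly `T` steps in
the state `τ`, and it writes only to cells that belong to `W`. -/
inductive Exec (W : Finset Cell) : Program → State → ℕ → State → Prop
  | skip (σ : State) : Exec W .skip σ 1 σ
  | nset (b : ℕ) (i j e : NExpr) (σ : State)
      (h : Sum.inl (b, i.eval σ, j.eval σ) ∈ W) :
      Exec W (.nset b i j e) σ (i.cost + j.cost + e.cost + 1)
        (σ.setNat b (i.eval σ) (j.eval σ) (e.eval σ))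
  | rset (b : ℕ) (i j : NExpr) (e : RExpr) (σ : State)
      (h : Sum.inr (b, i.eval σ, j.eval σ) ∈ W) :
      Exec W (.rset b i j e) σ (i.cost + j.cost + e.cost + 1)
        (σ.setReal b (i.eval σ) (j.eval σ) (e.eval σ))
  | seq (c d : Program) (σ τ υ : State) (T U : ℕ)
      (hc : Exec W c σ T τ) (hd : Exec W d τ U υ) : Exec W (.seq c d) σ (T + U) υ
  | ite_true (b : Test) (c d : Program) (σ τ : State) (T : ℕ)
      (hb : b.holds σ) (hc : Exec W c σ T τ) : Exec W (.ite b c d) σ (b.cost + T) τ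
  | ite_false (b : Test) (c d : Program) (σ τ : State) (T : ℕ)
      (hb : ¬ b.holds σ) (hd : Exec W d σ T τ) : Exec W (.ite b c d) σ (b.cost + T) τ
  | loop_true (b : Test) (c : Program) (σ τ υ : State) (T U : ℕ)
      (hb : b.holds σ) (hc : Exec W c σ T τ) (hl : Exec W (.loop b c) τ U υ) :
      Exec W (.loop b c) σ (b.cost + T + U) υ
  | loop_false (b : Test) (c : Program) (σ : State)
      (hb : ¬ b.holds σ) : Exec W (.loop b c) σ b.cost σ

end Machine

/-- The input of the estimation problem.  The letters are numbered by `e`.  Array 0 of natural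
numbers holds the alphabet size, array 1 the sample size `n`, array 2 the sample (`X₁, …, Xₙ` at
the indices `0, …, n - 1`), array 3 the last `n` letters of the past (`x₋₁, …, x₋ₙ` at the indices
`0, …, n - 1`); array 0 of real numbers holds `δ`.  All other cells are `0`. -/
noncomputable def inputState {A : Type*} [Fintype A] (e : A ≃ Fin (Fintype.card A))
    (s : List A) (δ : ℝ) (x : Past A) : Machine.State where
  nat b i j :=
    if j ≠ 0 then 0
    else match b with
      | 0 => if i = 0 then Fintype.card A else 0
      | 1 => if i = 0 then s.length else 0
      | 2 => if h : i < s.length then (e s[i] : ℕ) else 0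
      | 3 => if i < s.length then (e (x i) : ℕ) else 0
      | _ => 0
  real b i j := if b = 0 ∧ i = 0 ∧ j = 0 then δ else 0

/-- The program `c` computes the estimated transition probabilities `a ↦ estimator s δ a x` (left
in array 1 of real numbers) in at most `C |A|² n²` steps and with at most `C |A| n` cells of
memory besides the input, for all finite alphabets, samples, confidence parameters and pasts. -/
def ComputesEstimator (c : Machine.Program) (C : ℕ) : Prop :=
  ∀ (A : Type u) [Fintype A] [Nonempty A] (e : A ≃ Fin (Fintype.card A)) (s : List A) (δ : ℝ)
    (x : Past A), s ≠ [] → 0 < δ → δ < 1 →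
    ∃ (W : Finset Machine.Cell) (T : ℕ) (τ : Machine.State),
      Machine.Exec W c (inputState e s δ x) T τ ∧
      T ≤ C * Fintype.card A ^ 2 * s.length ^ 2 ∧
      W.card ≤ C * Fintype.card A * s.length ∧
      ∀ a : A, τ.real 1 (e a : ℕ) 0 = estimator s δ a x

end RandomContext

open RandomContext

/-! On one event of probability at least `1 - δ` the empirical minorants lie above the true
minorants at every word; given this event, the oracle inequality is deterministic. Let `h` be the
truncation point. The weights telescope (`estimator_eq`), so the estimate is a probability vector
squeezed between the empirical minorants of orders `h - 1` and `h`. If `L < h`, the estimate and `p`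
both dominate the minorants `q` of order `L`, and two probability vectors with a common minorant `q`
are at distance at most `1 - ∑ q`. If `h ≤ L`, the estimate lies below the upper confidence bounds
at the word of length `L` while `p` lies above `q`; this adds the sum of the confidence radii, which
Cauchy–Schwarz bounds in terms of `t` (`sum_conf_le`). Both cases form `dTV_estimator_le`.

For the event (`extSum_confidenceFails_le`), stationarity and monotonicity of the minorants show
that `a` follows any sample ending with `w` with conditional probability at least `q = p₋(a|w)`.
Hence `exp (q (1 - exp (-l)) N - l Nₐ)`, with `N` counting the occurrences of `w` and `Nₐ` those
followed by `a`, is a supermartingale. If a confidence bound fails, this weight is at least `exp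
t_*` for an `l` tuned to the dyadic block of `N` (`le_exponent_of_lt`), and Markov's inequality with
a union bound applies. The union does not run over the exponentially many words but over the end
time `i` and the length `k` of a first occurrence: once the first `i` letters are known the word is
fixed, and the supermartingale starts there. This is the origin of the factor `1 + n (n - 1) / 2`.

Minorants are essential infima over countably many cylinders, so every version dominates them at
almost every past. Where the oscillation tends to zero and all cylinders have positive probability,
the minorants converge to `p`, so the canonical version has no mass left to spread.

For the computation, all unseen words share the upper bound `1 / |A| + 1`, and the seen ones are
given by pairs `(i, k)`. For fixed `i`, the lengths of the common suffixes of `X₁ … Xᵢ` with all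
other prefixes yield the counts for all `k` in one pass over decreasing `k`. A running minimum of
upper bounds enters the minorant of order `k` when the last `k` letters of the past match. -/

namespace RandomContext

set_option linter.unusedSectionVars false

/-! ### Words, suffixes and pasts. -/

section Words

variable {A : Type*}

theorem lastWord_succ (x : Past A) (k : ℕ) : lastWord x (k + 1) = x k :: lastWord x k := by
  simp [lastWord, List.range_succ]

@[simp] theorem lastWord_zero (x : Past A) : lastWord x 0 = [] := rfl

@[simp] theorem length_lastWord (x : Past A) (k : ℕ) : (lastWord x k).length = k := by
  simp [lastWord]

theorem lastWord_suffix (x : Past A) {k l : ℕ} (h : k ≤ l) : lastWord x k <:+ lastWord x l := by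
  induction l, h using Nat.le_induction with
  | base => exact List.suffix_rfl
  | succ l _ ih =>
    rw [lastWord_succ]
    exact ih.trans (List.suffix_cons _ _)

theorem lastWord_congr {x y : Past A} {k : ℕ} (h : ∀ j < k, x j = y j) :
    lastWord x k = lastWord y k := by
  unfold lastWord
  congr 1
  apply List.map_congr_left
  intro j hj
  exact h j (List.mem_range.1 hj)

/-- Both `v` and `lastWord x v.length` are suffixes of `w`, and a suffix of a given word is
determined by its length. -/
theorem EndsWith.of_suffix {x : Past A} {v w : List A} (h : EndsWith x w) (hv : v <:+ w) :
    EndsWith x v := by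
  unfold EndsWith at *
  have h1 : lastWord x v.length <:+ w := by
    rw [← h]
    exact lastWord_suffix x hv.length_le
  have h2 := List.suffix_of_suffix_length_le h1 hv (by simp)
  exact h2.eq_of_length (by simp)

theorem endsWith_lastWord (x : Past A) (k : ℕ) : EndsWith x (lastWord x k) := by
  simp [EndsWith]

theorem snoc_suffix_snoc {u v : List A} {a b : A} :
    u ++ [a] <:+ v ++ [b] ↔ u <:+ v ∧ a = b := by
  rw [← List.reverse_prefix]
  simp [List.cons_prefix_cons, and_comm]

theorem take_succ_eq_snoc (s : List A) {j : ℕ} (h : j < s.length) :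
    s.take (j + 1) = s.take j ++ [s[j]] := by
  simp

/-- This fixes the time convention of all counts: at time `j` the letters before index `j` have been
read and `s[j]` comes next. -/
theorem snoc_suffix_take {s : List A} {w : List A} {a : A} {j : ℕ} (h : j < s.length) :
    w ++ [a] <:+ s.take (j + 1) ↔ w <:+ s.take j ∧ s[j]? = some a := by
  rw [take_succ_eq_snoc s h, snoc_suffix_snoc, List.getElem?_eq_getElem h]
  simp [eq_comm]

end Words

/-! ### Occurrence numbers. -/

section Counting

variable {A : Type*}

-- The lower end of the range in `occ` follows from the suffix relation. Without it the times are
-- exactly those that have a next letter.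
open Classical in
theorem occPred_eq_card {s : List A} (hs : s ≠ []) (w : List A) :
    occPred s w = ((Finset.range s.length).filter (fun j => w <:+ s.take j)).card := by
  unfold occPred occ
  have h0 : 0 < s.length := List.length_pos_iff.2 hs
  congr 1
  ext j
  simp only [Finset.mem_filter, Finset.mem_Icc, Finset.mem_range]
  constructor
  · rintro ⟨⟨_, h⟩, h'⟩
    exact ⟨by omega, h'⟩
  · rintro ⟨h, h'⟩
    have := h'.length_le
    rw [List.length_take] at this
    exact ⟨⟨by omega, by omega⟩, h'⟩

open Classical in
theorem occ_snoc_eq_card (s : List A) (w : List A) (a : A) :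
    occ s s.length (w ++ [a]) =
      ((Finset.range s.length).filter (fun j => w <:+ s.take j ∧ s[j]? = some a)).card := by
  unfold occ
  symm
  apply Finset.card_bij (fun j _ => j + 1)
  · intro j hj
    simp only [Finset.mem_filter, Finset.mem_Icc, Finset.mem_range] at hj ⊢
    have h1 := hj.2.1.length_le
    rw [List.length_take] at h1
    refine ⟨⟨?_, by omega⟩, (snoc_suffix_take hj.1).2 hj.2⟩
    simp
    omega
  · intro i _ j _ h
    omega
  · intro i hi
    simp only [Finset.mem_filter, Finset.mem_Icc, List.length_append, List.length_singleton] at hi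
    obtain ⟨j, rfl⟩ : ∃ j, i = j + 1 := ⟨i - 1, by omega⟩
    refine ⟨j, ?_, rfl⟩
    simp only [Finset.mem_filter, Finset.mem_range]
    exact ⟨by omega, (snoc_suffix_take (by omega)).1 hi.2⟩

theorem sum_occ_snoc [Fintype A] {s : List A} (hs : s ≠ []) (w : List A) :
    ∑ a, occ s s.length (w ++ [a]) = occPred s w := by
  classical
  rw [occPred_eq_card hs]
  simp_rw [occ_snoc_eq_card]
  rw [← Finset.card_biUnion]
  · congr 1
    ext j
    simp only [Finset.mem_biUnion, Finset.mem_univ, true_and, Finset.mem_filter, Finset.mem_range]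
    constructor
    · rintro ⟨a, h1, h2, _⟩
      exact ⟨h1, h2⟩
    · rintro ⟨h1, h2⟩
      exact ⟨s[j], h1, h2, List.getElem?_eq_getElem h1⟩
  · intro a _ b _ hab
    rw [Function.onFun, Finset.disjoint_left]
    intro j hj hj'
    simp only [Finset.mem_filter] at hj hj'
    exact hab (Option.some.inj (hj.2.2.symm.trans hj'.2.2))

theorem occPred_eq_zero_of_length_le {s : List A} (hs : s ≠ []) {w : List A}
    (h : s.length ≤ w.length) : occPred s w = 0 := by
  classical
  rw [occPred_eq_card hs, Finset.card_eq_zero, Finset.filter_eq_empty_iff]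
  intro j hj h'
  have := h'.length_le
  rw [List.length_take] at this
  have := Finset.mem_range.1 hj
  omega

end Counting

/-! ### Empirical minorants, truncation point and the interpolation formula. -/

section EmpiricalMinorant

variable {A : Type*} [Fintype A]

theorem empP_nonneg (s : List A) (a : A) (w : List A) : 0 ≤ empP s a w := by
  unfold empP
  split_ifs <;> positivity

theorem sum_empP [Nonempty A] {s : List A} (hs : s ≠ []) (w : List A) :
    ∑ a, empP s a w = 1 := by
  unfold empP
  split_ifs with h
  · simp
  · rw [← Finset.sum_div, ← Nat.cast_sum, sum_occ_snoc hs, div_self (by exact_mod_cast h)]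

/-- Keeps `t_*` positive: the factor with the logarithm is at least `14`, and all others are at
least one. -/
theorem fourteen_le_tStar_argument {n d : ℕ} {δ : ℝ} (hn : 1 ≤ n) (hd : 1 ≤ d) (h0 : 0 < δ) (h1 : δ < 1) :
    14 ≤ (d : ℝ) * (14 + 2 * Real.logb 2 n) * (1 + (n : ℝ) * ((n : ℝ) - 1) / 2) / δ := by
  have hn' : (1 : ℝ) ≤ n := by exact_mod_cast hn
  have hd' : (1 : ℝ) ≤ d := by exact_mod_cast hd
  have hl : 0 ≤ Real.logb 2 n := Real.logb_nonneg (by norm_num) hn'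
  have h2 : 0 ≤ (n : ℝ) * ((n : ℝ) - 1) / 2 := by
    have : 0 ≤ (n : ℝ) - 1 := by linarith
    positivity
  rw [le_div_iff₀ h0]
  calc 14 * δ ≤ 1 * 14 * 1 := by linarith
    _ ≤ _ := by gcongr <;> linarith

theorem tStar_nonneg {n d : ℕ} {δ : ℝ} (hn : 1 ≤ n) (hd : 1 ≤ d) (h0 : 0 < δ) (h1 : δ < 1) :
    0 ≤ tStar n δ d :=
  Real.log_nonneg (by linarith [fourteen_le_tStar_argument hn hd h0 h1])

theorem conf_nonneg [Nonempty A] {s : List A} {δ : ℝ} (hs : s ≠ []) (h0 : 0 < δ) (h1 : δ < 1)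
    (a : A) (w : List A) : 0 ≤ conf s δ a w := by
  have := tStar_nonneg (n := s.length) (d := Fintype.card A) (List.length_pos_iff.2 hs)
    Fintype.card_pos h0 h1
  unfold conf
  split_ifs
  · exact zero_le_one
  · refine le_min ?_ zero_le_one
    positivity

variable [Nonempty A] {s : List A} {δ : ℝ}

theorem bddBelow_empMinorant (hs : s ≠ []) (h0 : 0 < δ) (h1 : δ < 1) (a : A) (w : List A) :
    BddBelow (Set.range
      (fun v : {v : List A // w <:+ v} => empP s a v.1 + conf s δ a v.1)) :=
  ⟨0, by
    rintro _ ⟨v, rfl⟩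
    exact add_nonneg (empP_nonneg _ _ _) (conf_nonneg hs h0 h1 _ _)⟩

/-- Access to the infimum is through its lower bounds. Zero bounds the family from below and `w`
itself makes it nonempty, so no default value of the real infimum occurs. -/
theorem le_empMinorant_iff (hs : s ≠ []) (h0 : 0 < δ) (h1 : δ < 1) {a : A} {w : List A} {y : ℝ} :
    y ≤ empMinorant s δ a w ↔ ∀ v, w <:+ v → y ≤ empP s a v + conf s δ a v := by
  have : Nonempty {v : List A // w <:+ v} := ⟨⟨w, List.suffix_rfl⟩⟩
  unfold empMinorant
  rw [le_ciInf_iff (bddBelow_empMinorant hs h0 h1 a w)]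
  simp

theorem empMinorant_nonneg (hs : s ≠ []) (h0 : 0 < δ) (h1 : δ < 1) (a : A) (w : List A) :
    0 ≤ empMinorant s δ a w :=
  (le_empMinorant_iff hs h0 h1).2 fun _ _ =>
    add_nonneg (empP_nonneg _ _ _) (conf_nonneg hs h0 h1 _ _)

theorem empMinorant_le (hs : s ≠ []) (h0 : 0 < δ) (h1 : δ < 1) (a : A) (w : List A) :
    empMinorant s δ a w ≤ empP s a w + conf s δ a w :=
  (le_empMinorant_iff hs h0 h1).1 le_rfl w List.suffix_rfl

theorem empMinorant_mono (hs : s ≠ []) (h0 : 0 < δ) (h1 : δ < 1) (a : A) {w w' : List A}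
    (h : w <:+ w') : empMinorant s δ a w ≤ empMinorant s δ a w' :=
  (le_empMinorant_iff hs h0 h1).2 fun v hv =>
    (le_empMinorant_iff hs h0 h1).1 le_rfl v (h.trans hv)

theorem prevMinorant_nonneg (hs : s ≠ []) (h0 : 0 < δ) (h1 : δ < 1) (a : A) (x : Past A) (k : ℕ) :
    0 ≤ prevMinorant s δ a x k := by
  cases k with
  | zero => exact le_rfl
  | succ k => exact empMinorant_nonneg hs h0 h1 _ _

theorem prevMinorant_le (hs : s ≠ []) (h0 : 0 < δ) (h1 : δ < 1) (a : A) (x : Past A) (k : ℕ) :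
    prevMinorant s δ a x k ≤ empMinorant s δ a (lastWord x k) := by
  cases k with
  | zero => exact empMinorant_nonneg hs h0 h1 _ _
  | succ k => exact empMinorant_mono hs h0 h1 _ (lastWord_suffix x (Nat.le_succ k))

/-- Words this long and all their extensions are unseen, and unseen words share one upper bound. -/
theorem empMinorant_of_length_le (hs : s ≠ []) (h0 : 0 < δ) (h1 : δ < 1) (a : A) {w : List A}
    (h : s.length ≤ w.length) : empMinorant s δ a w = 1 / Fintype.card A + 1 := by
  have key : ∀ v, w <:+ v → empP s a v + conf s δ a v = 1 / Fintype.card A + 1 := by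
    intro v hv
    have : occPred s v = 0 := occPred_eq_zero_of_length_le hs (h.trans hv.length_le)
    simp [empP, conf, this]
  apply le_antisymm
  · rw [← key w List.suffix_rfl]
    exact empMinorant_le hs h0 h1 a w
  · exact (le_empMinorant_iff hs h0 h1).2 fun v hv => (key v hv).ge

theorem one_le_sum_of_length_le (hs : s ≠ []) (h0 : 0 < δ) (h1 : δ < 1) (x : Past A) {k : ℕ}
    (h : s.length ≤ k) : 1 ≤ ∑ a, empMinorant s δ a (lastWord x k) := by
  have : ∀ a ∈ (Finset.univ : Finset A),
      empMinorant s δ a (lastWord x k) = 1 / (Fintype.card A : ℝ) + 1 := fun a _ =>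
    empMinorant_of_length_le hs h0 h1 a (by simpa using h)
  rw [Finset.sum_congr rfl this, Finset.sum_add_distrib]
  have h2 : (0 : ℝ) ≤ ∑ _a : A, (1 : ℝ) := by positivity
  simp at h2 ⊢

/-- Monotonicity makes the admissible orders an upper set, and the order `n` belongs to it, so the
infimum in `truncPoint` is attained. -/
theorem one_le_sum_iff (hs : s ≠ []) (h0 : 0 < δ) (h1 : δ < 1) (x : Past A) (k : ℕ) :
    1 ≤ ∑ a, empMinorant s δ a (lastWord x k) ↔ truncPoint s δ x ≤ k := by
  constructor
  · intro h
    exact Nat.sInf_le h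
  · intro h
    have h2 : 1 ≤ ∑ a, empMinorant s δ a (lastWord x (truncPoint s δ x)) :=
      Nat.sInf_mem (s := {h : ℕ | 1 ≤ ∑ a, empMinorant s δ a (lastWord x h)})
        ⟨s.length, one_le_sum_of_length_le hs h0 h1 x le_rfl⟩
    exact h2.trans (Finset.sum_le_sum fun a _ =>
      empMinorant_mono hs h0 h1 a (lastWord_suffix x h))

theorem truncPoint_le (hs : s ≠ []) (h0 : 0 < δ) (h1 : δ < 1) (x : Past A) :
    truncPoint s δ x ≤ s.length :=
  (one_le_sum_iff hs h0 h1 x _).1 (one_le_sum_of_length_le hs h0 h1 x le_rfl)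

theorem sum_prevMinorant_lt (hs : s ≠ []) (h0 : 0 < δ) (h1 : δ < 1) (x : Past A) {k : ℕ}
    (hk : k ≤ truncPoint s δ x) : ∑ a, prevMinorant s δ a x k < 1 := by
  cases k with
  | zero => simp [prevMinorant]
  | succ k =>
    have := mt (one_le_sum_iff hs h0 h1 x k).1 (by omega)
    exact not_le.1 this

/-- The estimator interpolates between the two last empirical minorants. -/
theorem estimator_eq (hs : s ≠ []) (h0 : 0 < δ) (h1 : δ < 1) (a : A) (x : Past A) :
    estimator s δ a x = prevMinorant s δ a x (truncPoint s δ x) +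
      (1 - ∑ b, prevMinorant s δ b x (truncPoint s δ x)) *
        ((empMinorant s δ a (lastWord x (truncPoint s δ x)) -
          prevMinorant s δ a x (truncPoint s δ x)) /
          ∑ b, (empMinorant s δ b (lastWord x (truncPoint s δ x)) -
            prevMinorant s δ b x (truncPoint s δ x))) := by
  unfold estimator
  rw [Finset.sum_range_succ]
  congr 1
  · have : ∀ k ∈ Finset.range (truncPoint s δ x), weight s δ x k * kernelP s δ a x k =
        prevMinorant s δ a x (k + 1) - prevMinorant s δ a x k := by
      intro k hk
      have hk' := Finset.mem_range.1 hk
      have hw : weight s δ x k =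
          ∑ a, (empMinorant s δ a (lastWord x k) - prevMinorant s δ a x k) := by
        simp [weight, hk']
      rw [kernelP, if_pos hk']
      -- A zero weight is a vanishing sum of nonnegative increments, so each increment is zero and
      -- the division by zero in `kernelP` does no harm.
      by_cases h : weight s δ x k = 0
      · rw [h, zero_mul]
        rw [hw, Finset.sum_eq_zero_iff_of_nonneg
          (fun b _ => sub_nonneg.2 (prevMinorant_le hs h0 h1 b x k))] at h
        exact (h a (Finset.mem_univ a)).symm
      · rw [mul_div_cancel₀ _ h]
        rfl
    rw [Finset.sum_congr rfl this, Finset.sum_range_sub]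
    simp [prevMinorant]
  · simp [weight, kernelP]

/-- The minorants at the truncation point sum to at least one. Hence the ratio of these two
quantities, the share of the last increment that the estimate uses, lies in `[0, 1]`. -/
theorem sum_sub_prevMinorant_ge (hs : s ≠ []) (h0 : 0 < δ) (h1 : δ < 1) (x : Past A) :
    1 - ∑ b, prevMinorant s δ b x (truncPoint s δ x) ≤
      ∑ b, (empMinorant s δ b (lastWord x (truncPoint s δ x)) -
            prevMinorant s δ b x (truncPoint s δ x)) := by
  rw [Finset.sum_sub_distrib]
  have := (one_le_sum_iff hs h0 h1 x _).2 le_rfl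
  linarith

theorem prevMinorant_le_estimator (hs : s ≠ []) (h0 : 0 < δ) (h1 : δ < 1) (a : A) (x : Past A) :
    prevMinorant s δ a x (truncPoint s δ x) ≤ estimator s δ a x := by
  rw [estimator_eq hs h0 h1]
  have h2 := sum_prevMinorant_lt hs h0 h1 x le_rfl
  have h3 := sum_sub_prevMinorant_ge hs h0 h1 x
  have h4 := prevMinorant_le hs h0 h1 a x (truncPoint s δ x)
  refine le_add_of_nonneg_right (mul_nonneg (by linarith) (div_nonneg (by linarith) (by linarith)))

theorem estimator_le_empMinorant (hs : s ≠ []) (h0 : 0 < δ) (h1 : δ < 1) (a : A) (x : Past A) :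
    estimator s δ a x ≤ empMinorant s δ a (lastWord x (truncPoint s δ x)) := by
  rw [estimator_eq hs h0 h1]
  have h2 := sum_prevMinorant_lt hs h0 h1 x le_rfl
  have h3 := sum_sub_prevMinorant_ge hs h0 h1 x
  have h4 := prevMinorant_le hs h0 h1 a x (truncPoint s δ x)
  rw [mul_div_assoc', mul_comm, ← mul_div_assoc']
  have := mul_le_of_le_one_right (sub_nonneg.2 h4) ((div_le_one (by linarith)).2 h3)
  linarith

theorem sum_estimator (hs : s ≠ []) (h0 : 0 < δ) (h1 : δ < 1) (x : Past A) :
    ∑ a, estimator s δ a x = 1 := by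
  simp_rw [estimator_eq hs h0 h1]
  have h2 := sum_prevMinorant_lt hs h0 h1 x le_rfl
  have h3 := sum_sub_prevMinorant_ge hs h0 h1 x
  rw [Finset.sum_add_distrib, ← Finset.mul_sum, ← Finset.sum_div, div_self (by linarith)]
  ring

/-- The truncation point is at most `n`, so no older letters are consulted; measurability follows
from this. -/
theorem estimator_congr (hs : s ≠ []) (h0 : 0 < δ) (h1 : δ < 1) (a : A) {x y : Past A}
    (h : ∀ j < s.length, x j = y j) : estimator s δ a x = estimator s δ a y := by
  have hw : ∀ k ≤ s.length, lastWord x k = lastWord y k := fun k hk =>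
    lastWord_congr fun j hj => h j (by omega)
  have ht : truncPoint s δ x = truncPoint s δ y := by
    have key : ∀ k ≤ s.length, truncPoint s δ x ≤ k ↔ truncPoint s δ y ≤ k := by
      intro k hk
      rw [← one_le_sum_iff hs h0 h1, ← one_le_sum_iff hs h0 h1, hw k hk]
    exact le_antisymm ((key _ (truncPoint_le hs h0 h1 y)).2 le_rfl)
      ((key _ (truncPoint_le hs h0 h1 x)).1 le_rfl)
  have hp : ∀ b, prevMinorant s δ b x (truncPoint s δ y) =
      prevMinorant s δ b y (truncPoint s δ y) := by
    intro b
    have := truncPoint_le hs h0 h1 y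
    revert this
    cases truncPoint s δ y with
    | zero => exact fun _ => rfl
    | succ k => exact fun hk => by simp [prevMinorant, hw k (by omega)]
  rw [estimator_eq hs h0 h1, estimator_eq hs h0 h1, ht, hw _ (truncPoint_le hs h0 h1 y)]
  simp_rw [hp]

end EmpiricalMinorant

/-! ### Measurability of the estimator. -/

section Measurability

variable {A : Type*} [Fintype A] [MeasurableSpace A] [MeasurableSingletonClass A]

/-- A function of finitely many letters of the past is measurable. -/
theorem measurable_of_forall_lt [Nonempty A] {β : Type*} [MeasurableSpace β] {f : Past A → β}
    (n : ℕ)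
    (h : ∀ x y : Past A, (∀ j < n, x j = y j) → f x = f y) : Measurable f := by
  classical
  let g : (Fin n → A) → β := fun z => f fun j =>
    if hj : j < n then z ⟨j, hj⟩ else Classical.arbitrary A
  have hg : f = g ∘ fun x (i : Fin n) => x i := by
    funext x
    refine h _ _ fun j hj => ?_
    simp [hj]
  rw [hg]
  refine (measurable_of_finite g).comp (measurable_pi_iff.2 fun i => measurable_pi_apply _)

theorem isTransitionProbability_estimator [Nonempty A] {s : List A} {δ : ℝ} (hs : s ≠ [])
    (h0 : 0 < δ) (h1 : δ < 1) : IsTransitionProbability (estimator s δ) where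
  measurable a := measurable_of_forall_lt s.length fun _ _ h => estimator_congr hs h0 h1 a h
  nonneg a x := (prevMinorant_nonneg hs h0 h1 a x _).trans (prevMinorant_le_estimator hs h0 h1 a x)
  sum_eq_one x := sum_estimator hs h0 h1 x

end Measurability

/-! ### The deterministic oracle inequality. -/

section Oracle

variable {A : Type*} [Fintype A]

/-- Equal total masses make the positive and the negative part of `r - p` equally large. -/
theorem dTV_eq_sum_max {p r : A → ℝ} (h : ∑ a, p a = ∑ a, r a) :
    dTV p r = ∑ a, max (r a - p a) 0 := by
  have : ∀ a, |p a - r a| = 2 * max (r a - p a) 0 + (p a - r a) := by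
    intro a
    rcases le_total (p a) (r a) with h | h
    · rw [abs_of_nonpos (by linarith), max_eq_left (by linarith)]
      ring
    · rw [abs_of_nonneg (by linarith), max_eq_right (by linarith)]
      ring
  unfold dTV
  simp_rw [this]
  rw [Finset.sum_add_distrib, ← Finset.mul_sum, Finset.sum_sub_distrib, h]
  ring

variable [Nonempty A] {s : List A} {δ : ℝ}

/-- Cauchy–Schwarz bounds the sum of the roots of the empirical probabilities by `√|A|`, which turns
`t_*` into `t = |A| t_*`. -/
theorem sum_conf_le (hs : s ≠ []) (h0 : 0 < δ) (h1 : δ < 1) {w : List A} (hw : 0 < occPred s w) :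
    ∑ a, conf s δ a w ≤
      (2 * √2 + 2) * √(tParam s.length δ (Fintype.card A) / occPred s w) +
        (3 + 2 * √2) * (tParam s.length δ (Fintype.card A) / occPred s w) := by
  have ht := tStar_nonneg (n := s.length) (d := Fintype.card A) (List.length_pos_iff.2 hs)
    Fintype.card_pos h0 h1
  set t := tStar s.length δ (Fintype.card A) with ht'
  have hN : (0 : ℝ) < occPred s w := by exact_mod_cast hw
  have h2 : ∀ a ∈ (Finset.univ : Finset A), conf s δ a w ≤
      (2 * √2 + 2) * (√(empP s a w) * √(t / occPred s w)) +
        (3 + 2 * √2) * (t / occPred s w) := by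
    intro a _
    rw [conf, if_neg hw.ne', ← Real.sqrt_mul (empP_nonneg s a w), ← mul_div_assoc (empP s a w)]
    exact min_le_left _ _
  have h3 : ∑ a, √(empP s a w) ≤ √(Fintype.card A) := by
    apply Real.le_sqrt_of_sq_le
    calc (∑ a, √(empP s a w)) ^ 2 ≤ Fintype.card A * ∑ a, √(empP s a w) ^ 2 := by
          simpa using sq_sum_le_card_mul_sum_sq (s := Finset.univ) (f := fun a => √(empP s a w))
      _ = Fintype.card A := by
        simp_rw [Real.sq_sqrt (empP_nonneg s _ w)]
        rw [sum_empP hs, mul_one]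
  calc ∑ a, conf s δ a w ≤ ∑ a, ((2 * √2 + 2) * (√(empP s a w) * √(t / occPred s w)) +
        (3 + 2 * √2) * (t / occPred s w)) := Finset.sum_le_sum h2
    _ = (2 * √2 + 2) * ((∑ a, √(empP s a w)) * √(t / occPred s w)) +
        (3 + 2 * √2) * (Fintype.card A * t / occPred s w) := by
      rw [Finset.sum_add_distrib, ← Finset.mul_sum, ← Finset.sum_mul]
      simp
      ring
    _ ≤ (2 * √2 + 2) * (√(Fintype.card A) * √(t / occPred s w)) +
        (3 + 2 * √2) * (Fintype.card A * t / occPred s w) := by gcongr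
    _ = _ := by
      rw [← Real.sqrt_mul (by positivity), mul_div_assoc']
      rfl

/-- If the empirical minorants dominate a monotone family `q`, then the estimator satisfies the
oracle inequality for every probability vector that dominates `q`. -/
theorem dTV_estimator_le (hs : s ≠ []) (h0 : 0 < δ) (h1 : δ < 1) {q : A → List A → ℝ}
    (hq1 : ∀ a w, q a w ≤ 1) (hqm : ∀ a w w', w <:+ w' → q a w ≤ q a w')
    (hgood : ∀ a w, 0 < occPred s w → q a w ≤ empP s a w + conf s δ a w)
    {p : A → ℝ} {x : Past A} (hp : ∑ a, p a = 1) (hpq : ∀ k a, q a (lastWord x k) ≤ p a)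
    {L : ℕ} (hL : 0 < occPred s (lastWord x L)) :
    dTV p (fun a => estimator s δ a x) ≤ 1 - ∑ a, q a (lastWord x L) +
      (4 + 4 * √2) * √(tParam s.length δ (Fintype.card A) / occPred s (lastWord x L)) +
      (6 + 4 * √2) * (tParam s.length δ (Fintype.card A) / occPred s (lastWord x L)) := by
  have hqe : ∀ a w, q a w ≤ empMinorant s δ a w := by
    intro a w
    refine (le_empMinorant_iff hs h0 h1).2 fun v hv => (hqm a w v hv).trans ?_
    -- At an unseen word the radius is one, which already dominates `q`.
    rcases Nat.eq_zero_or_pos (occPred s v) with h | h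
    · have h2 := empP_nonneg s a v
      have h3 : conf s δ a v = 1 := by simp [conf, h]
      linarith [hq1 a v]
    · exact hgood a v h
  have hT : 0 ≤ tParam s.length δ (Fintype.card A) / occPred s (lastWord x L) := by
    have := tStar_nonneg (n := s.length) (d := Fintype.card A) (List.length_pos_iff.2 hs)
      Fintype.card_pos h0 h1
    unfold tParam
    positivity
  have hc := sum_conf_le hs h0 h1 hL
  set T := tParam s.length δ (Fintype.card A) / occPred s (lastWord x L)
  have hr2 : 0 ≤ √2 := Real.sqrt_nonneg _
  have hrT : 0 ≤ √T := Real.sqrt_nonneg _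
  have e1 : 0 ≤ √2 * √T := by positivity
  have e2 : 0 ≤ √2 * T := by positivity
  rw [dTV_eq_sum_max (hp.trans (sum_estimator hs h0 h1 x).symm)]
  rcases le_or_gt (truncPoint s δ x) L with h | h
  -- Truncation at or before `L`: the estimate is below the upper confidence bound of order `L`, and
  -- `p` is above `q`.
  · have h2 : ∀ a ∈ (Finset.univ : Finset A), max (estimator s δ a x - p a) 0 ≤
        empP s a (lastWord x L) + conf s δ a (lastWord x L) - q a (lastWord x L) := by
      intro a _
      have e3 := estimator_le_empMinorant hs h0 h1 a x
      have e4 := empMinorant_mono hs h0 h1 a (lastWord_suffix x h)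
      have e5 := empMinorant_le hs h0 h1 a (lastWord x L)
      have e6 := hpq L a
      have e7 := hqe a (lastWord x L)
      exact max_le (by linarith) (by linarith)
    have h3 := Finset.sum_le_sum h2
    rw [Finset.sum_sub_distrib, Finset.sum_add_distrib, sum_empP hs] at h3
    -- The constants in the goal are twice those of `sum_conf_le`.
    nlinarith
  -- Truncation after `L`: the estimate dominates `q`, as `p` does, and no radius enters.
  · have h2 : ∀ a ∈ (Finset.univ : Finset A), max (estimator s δ a x - p a) 0 ≤
        estimator s δ a x - q a (lastWord x L) := by
      intro a _
      have e3 := prevMinorant_le_estimator hs h0 h1 a x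
      have e4 : empMinorant s δ a (lastWord x L) ≤ prevMinorant s δ a x (truncPoint s δ x) := by
        obtain ⟨m, hm⟩ : ∃ m, truncPoint s δ x = m + 1 := ⟨truncPoint s δ x - 1, by omega⟩
        rw [hm]
        exact empMinorant_mono hs h0 h1 a (lastWord_suffix x (by omega))
      have e6 := hpq L a
      have e7 := hqe a (lastWord x L)
      exact max_le (by linarith) (by linarith)
    have h3 := Finset.sum_le_sum h2
    rw [Finset.sum_sub_distrib, sum_estimator hs h0 h1] at h3
    nlinarith

end Oracle

/-! ### Sums over extensions of a word, in place of expectations over the sample. -/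

section Extensions

variable {A : Type*} [Fintype A]

/-- The sum of `F` over all extensions of a word by `n` letters. -/
def extSum : ℕ → (List A → ℝ) → List A → ℝ
  | 0, F, u => F u
  | n + 1, F, u => ∑ a, extSum n F (u ++ [a])

theorem extSum_le_extSum {F G : List A → ℝ} (n : ℕ) {u : List A}
    (h : ∀ v, u <+: v → v.length = u.length + n → F v ≤ G v) : extSum n F u ≤ extSum n G u := by
  induction n generalizing u with
  | zero => exact h u List.prefix_rfl rfl
  | succ n ih =>
    refine Finset.sum_le_sum fun a _ => ih fun v hv hl => h v ((List.prefix_append _ _).trans hv) ?_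
    simp at hl
    omega

theorem extSum_congr {F G : List A → ℝ} (n : ℕ) {u : List A}
    (h : ∀ v, u <+: v → v.length = u.length + n → F v = G v) : extSum n F u = extSum n G u :=
  le_antisymm (extSum_le_extSum n fun v h1 h2 => (h v h1 h2).le)
    (extSum_le_extSum n fun v h1 h2 => (h v h1 h2).ge)

theorem extSum_add (F : List A → ℝ) (m n : ℕ) (u : List A) :
    extSum (m + n) F u = extSum m (extSum n F) u := by
  induction m generalizing u with
  | zero => rw [Nat.zero_add]; rfl
  | succ m ih =>
    rw [Nat.succ_add]
    exact Finset.sum_congr rfl fun a _ => ih _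

theorem extSum_sum {ι : Type*} (I : Finset ι) (F : ι → List A → ℝ) (n : ℕ) (u : List A) :
    extSum n (fun v => ∑ i ∈ I, F i v) u = ∑ i ∈ I, extSum n (F i) u := by
  induction n generalizing u with
  | zero => rfl
  | succ n ih =>
    simp only [extSum, ih]
    exact Finset.sum_comm

theorem extSum_const_mul (c : ℝ) (F : List A → ℝ) (n : ℕ) (u : List A) :
    extSum n (fun v => c * F v) u = c * extSum n F u := by
  induction n generalizing u with
  | zero => rfl
  | succ n ih => simp only [extSum, ih, Finset.mul_sum]

/-- The supermartingale inequality, iterated. The threshold `i` admits processes that start only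
when `i` letters are known. -/
theorem extSum_le_self {F : List A → ℝ} {i : ℕ}
    (h : ∀ u : List A, i ≤ u.length → ∑ a, F (u ++ [a]) ≤ F u) (n : ℕ) {u : List A}
    (hu : i ≤ u.length) : extSum n F u ≤ F u := by
  induction n generalizing u with
  | zero => exact le_rfl
  | succ n ih =>
    refine (Finset.sum_le_sum fun a _ => ih (u := u ++ [a]) ?_).trans (h u hu)
    simp
    omega

end Extensions

/-! ### The exponential supermartingale. -/

section ExponentialWeight

variable {A : Type*}

/-- The number of occurrences of `w` in `u` that end at a time in `[i, |u|)`. -/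
noncomputable def cntFrom (i : ℕ) (w u : List A) : ℕ := by
  classical exact ((Finset.range u.length).filter (fun j => i ≤ j ∧ w <:+ u.take j)).card

/-- The number of occurrences of `w` in `u` that end at a time in `[i, |u|)` and that are followed
by the letter `a`. -/
noncomputable def cntFromLetter (i : ℕ) (w : List A) (a : A) (u : List A) : ℕ := by
  classical exact ((Finset.range u.length).filter
    (fun j => i ≤ j ∧ w <:+ u.take j ∧ u[j]? = some a)).card

open Classical in
theorem cntFrom_snoc {i : ℕ} (w : List A) {u : List A} (hu : i ≤ u.length) (b : A) :
    cntFrom i w (u ++ [b]) = cntFrom i w u + if w <:+ u then 1 else 0 := by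
  unfold cntFrom
  rw [List.length_append, List.length_singleton, Finset.range_add_one, Finset.filter_insert]
  have h1 : (Finset.range u.length).filter (fun j => i ≤ j ∧ w <:+ (u ++ [b]).take j) =
      (Finset.range u.length).filter (fun j => i ≤ j ∧ w <:+ u.take j) := by
    refine Finset.filter_congr fun j hj => ?_
    rw [List.take_append_of_le_length (Finset.mem_range.1 hj).le]
  rw [h1]
  simp only [hu, true_and, List.take_left]
  split_ifs
  · rw [Finset.card_insert_of_notMem (by simp)]
  · rfl

open Classical in
theorem cntFromLetter_snoc {i : ℕ} (w : List A) (a : A) {u : List A} (hu : i ≤ u.length) (b : A) :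
    cntFromLetter i w a (u ++ [b]) =
      cntFromLetter i w a u + if w <:+ u ∧ b = a then 1 else 0 := by
  unfold cntFromLetter
  rw [List.length_append, List.length_singleton, Finset.range_add_one, Finset.filter_insert]
  have h1 : (Finset.range u.length).filter
        (fun j => i ≤ j ∧ w <:+ (u ++ [b]).take j ∧ (u ++ [b])[j]? = some a) =
      (Finset.range u.length).filter (fun j => i ≤ j ∧ w <:+ u.take j ∧ u[j]? = some a) := by
    refine Finset.filter_congr fun j hj => ?_
    rw [List.take_append_of_le_length (Finset.mem_range.1 hj).le,
      List.getElem?_append_left (Finset.mem_range.1 hj)]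
  rw [h1]
  simp only [hu, true_and, List.take_left, List.getElem?_concat_length, Option.some.injEq]
  split_ifs
  · rw [Finset.card_insert_of_notMem (by simp)]
  · rfl

theorem cntFrom_of_length_le {i : ℕ} (w : List A) {u : List A} (hu : u.length ≤ i) :
    cntFrom i w u = 0 := by
  classical
  unfold cntFrom
  rw [Finset.card_eq_zero, Finset.filter_eq_empty_iff]
  intro j hj
  have := Finset.mem_range.1 hj
  omega

theorem cntFromLetter_of_length_le {i : ℕ} (w : List A) (a : A) {u : List A} (hu : u.length ≤ i) :
    cntFromLetter i w a u = 0 := by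
  classical
  unfold cntFromLetter
  rw [Finset.card_eq_zero, Finset.filter_eq_empty_iff]
  intro j hj
  have := Finset.mem_range.1 hj
  omega

/-- The exponential weight that turns the occurrences of `wa` into a supermartingale when `a`
follows `w` with probability at least `q`. -/
noncomputable def expWeight (q l : ℝ) (i : ℕ) (w : List A) (a : A) (u : List A) : ℝ :=
  Real.exp (q * (1 - Real.exp (-l)) * cntFrom i w u - l * cntFromLetter i w a u)

theorem expWeight_snoc_of_not_suffix (q l : ℝ) {i : ℕ} {w : List A} (a : A) {u : List A}
    (hu : i ≤ u.length) (hw : ¬ w <:+ u) (b : A) :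
    expWeight q l i w a (u ++ [b]) = expWeight q l i w a u := by
  simp [expWeight, cntFrom_snoc w hu b, cntFromLetter_snoc w a hu b, hw]

open Classical in
theorem expWeight_snoc_of_suffix (q l : ℝ) {i : ℕ} {w : List A} (a : A) {u : List A}
    (hu : i ≤ u.length) (hw : w <:+ u) (b : A) :
    expWeight q l i w a (u ++ [b]) = expWeight q l i w a u * Real.exp (q * (1 - Real.exp (-l))) *
      (1 - (1 - Real.exp (-l)) * if b = a then 1 else 0) := by
  simp only [expWeight, cntFrom_snoc w hu b, cntFromLetter_snoc w a hu b, hw, true_and, if_true]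
  split_ifs
  · rw [mul_one, sub_sub_cancel, ← Real.exp_add, ← Real.exp_add]
    push_cast
    ring_nf
  · rw [mul_zero, sub_zero, mul_one, ← Real.exp_add]
    push_cast
    ring_nf

theorem expWeight_of_length_le (q l : ℝ) {i : ℕ} (w : List A) (a : A) {u : List A}
    (hu : u.length ≤ i) : expWeight q l i w a u = 1 := by
  simp [expWeight, cntFrom_of_length_le w hu, cntFromLetter_of_length_le w a hu]

variable [Fintype A]

/-- Let `c = 1 - exp (-l)`. If `w` has just ended, `a` follows with conditional probability at least
`q`, so the mean of the new factor is at most `exp (q c) * (1 - q c) ≤ 1`. Otherwise the weight does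
not change. -/
theorem sum_mul_expWeight_snoc_le {μ : List A → ℝ} (hμ : ∀ u, 0 ≤ μ u)
    (hμs : ∀ u, ∑ a, μ (u ++ [a]) = μ u) {q l : ℝ} (hl : 0 ≤ l) {w : List A} {a : A}
    (hq : ∀ u, w <:+ u → q * μ u ≤ μ (u ++ [a])) {i : ℕ} {u : List A} (hu : i ≤ u.length) :
    ∑ b, μ (u ++ [b]) * expWeight q l i w a (u ++ [b]) ≤ μ u * expWeight q l i w a u := by
  classical
  by_cases hw : w <:+ u
  · simp_rw [expWeight_snoc_of_suffix q l a hu hw]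
    have h1 : ∑ b, μ (u ++ [b]) * (expWeight q l i w a u * Real.exp (q * (1 - Real.exp (-l))) *
        (1 - (1 - Real.exp (-l)) * if b = a then 1 else 0)) =
        expWeight q l i w a u * Real.exp (q * (1 - Real.exp (-l))) *
          (μ u - (1 - Real.exp (-l)) * μ (u ++ [a])) := by
      have h2 : ∑ b, μ (u ++ [b]) * (if b = a then (1 : ℝ) else 0) = μ (u ++ [a]) := by
        simp
      rw [← hμs u, ← h2, Finset.mul_sum, ← Finset.sum_sub_distrib, Finset.mul_sum]
      refine Finset.sum_congr rfl fun b _ => ?_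
      ring
    rw [h1]
    have hc : 0 ≤ 1 - Real.exp (-l) := by
      rw [sub_nonneg, Real.exp_le_one_iff]
      linarith
    have h3 : μ u - (1 - Real.exp (-l)) * μ (u ++ [a]) ≤
        μ u * Real.exp (-(q * (1 - Real.exp (-l)))) := by
      have h4 := mul_le_mul_of_nonneg_left (hq u hw) hc
      have h5 := mul_le_mul_of_nonneg_left
        (Real.add_one_le_exp (-(q * (1 - Real.exp (-l))))) (hμ u)
      linarith
    have hE : 0 < expWeight q l i w a u := Real.exp_pos _
    calc _ ≤ expWeight q l i w a u * Real.exp (q * (1 - Real.exp (-l))) *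
          (μ u * Real.exp (-(q * (1 - Real.exp (-l))))) := by gcongr
      _ = μ u * expWeight q l i w a u *
          (Real.exp (q * (1 - Real.exp (-l))) * Real.exp (-(q * (1 - Real.exp (-l))))) := by ring
      _ = _ := by rw [← Real.exp_add, add_neg_cancel, Real.exp_zero, mul_one]
  · simp_rw [expWeight_snoc_of_not_suffix q l a hu hw]
    rw [← Finset.sum_mul, hμs]

/-- The exponential weight of the word of length `k` that ends at time `i` has mean at most one. -/
theorem extSum_mul_expWeight_le {μ : List A → ℝ} (hμ : ∀ u, 0 ≤ μ u) (hμ1 : μ [] = 1)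
    (hμs : ∀ u, ∑ a, μ (u ++ [a]) = μ u) {q : A → List A → ℝ}
    (hqm : ∀ a w w', w <:+ w' → q a w ≤ q a w') (hq : ∀ a u, q a u * μ u ≤ μ (u ++ [a]))
    {l : List A → ℝ} (hl : ∀ w, 0 ≤ l w) (a : A) {i n : ℕ} (hi : i ≤ n) (k : ℕ) :
    extSum n (fun u => μ u * expWeight (q a ((u.take i).drop (i - k)))
      (l ((u.take i).drop (i - k))) i ((u.take i).drop (i - k)) a u) [] ≤ 1 := by
  obtain ⟨m, rfl⟩ := Nat.exists_eq_add_of_le hi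
  rw [extSum_add]
  calc _ ≤ extSum i μ [] := by
        -- Fix the first `i` letters `v`. The word of length `k` that ends there, and with it `q`
        -- and `l`, is now constant, and the weight starts from the value one at `v`.
        refine extSum_le_extSum i fun v _ hv => ?_
        rw [List.length_nil, Nat.zero_add] at hv
        rw [extSum_congr (G := fun u => μ u * expWeight (q a (v.drop (i - k)))
          (l (v.drop (i - k))) i (v.drop (i - k)) a u)]
        · refine (extSum_le_self (i := i) (fun u hu => ?_) m hv.ge).trans ?_
          · refine sum_mul_expWeight_snoc_le hμ hμs (hl _) (fun u hw => ?_) hu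
            exact (mul_le_mul_of_nonneg_right (hqm a _ _ hw) (hμ u)).trans (hq a u)
          · rw [expWeight_of_length_le _ _ _ _ hv.le, mul_one]
        · intro u hu _
          rw [← hv, ← List.prefix_iff_eq_take.1 hu]
    _ ≤ μ [] := extSum_le_self (i := 0) (fun u _ => (hμs u).le) i le_rfl
    _ = 1 := hμ1

end ExponentialWeight

/-! ### The numerical inequality behind the radii. -/

section Deviation

/-- Invert the quadratic lower bound for `exp l`: the product `(1 + l + l² / 2) (1 - l + l² / 2)`
equals `1 + l⁴ / 4`. -/
theorem exp_neg_le_quadratic {l : ℝ} (hl : 0 ≤ l) : Real.exp (-l) ≤ 1 - l + l ^ 2 / 2 := by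
  rw [Real.exp_neg]
  have h1 := Real.quadratic_le_exp_of_nonneg hl
  have h2 : 0 < 1 + l + l ^ 2 / 2 := by positivity
  calc (Real.exp l)⁻¹ ≤ (1 + l + l ^ 2 / 2)⁻¹ := by gcongr
    _ ≤ 1 - l + l ^ 2 / 2 := by
      rw [inv_le_iff_one_le_mul₀ h2]
      nlinarith [sq_nonneg (l ^ 2)]

/-- The deviation inequality behind the confidence radii, for sample sizes `N` in the dyadic block
`[M, 2M]`. -/
theorem le_exponent_of_lt {q ph t N M : ℝ} (ht : 0 < t) (hM : 0 < M) (hMN : M ≤ N)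
    (hNM : N ≤ 2 * M) (hph : 0 ≤ ph)
    (h : ph + ((2 * √2 + 2) * √(ph * t / N) + (3 + 2 * √2) * (t / N)) < q) :
    t ≤ q * (1 - Real.exp (-√(t / M / q))) * N - √(t / M / q) * (ph * N) := by
  have hN : 0 < N := by linarith
  have hr : √2 * √2 = 2 := Real.mul_self_sqrt (by norm_num)
  have hr0 : 0 < √2 := by positivity
  set a := √(t / N) with ha'
  set b := √(t / M) with hb'
  have ha : 0 < a := by positivity
  have hb : 0 < b := by positivity
  have haa : a * a = t / N := Real.mul_self_sqrt (by positivity)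
  have hbb : b * b = t / M := Real.mul_self_sqrt (by positivity)
  have hab : a ≤ b := Real.sqrt_le_sqrt (by gcongr)
  -- Here `N ≤ 2 * M` enters: tuning to the block instead of to `N` itself costs a factor `√2`.
  have hba : b ≤ √2 * a := by
    rw [ha', ← Real.sqrt_mul (by norm_num)]
    apply Real.sqrt_le_sqrt
    rw [div_le_iff₀ hM, mul_div_assoc', div_mul_eq_mul_div, le_div_iff₀ hN]
    nlinarith
  rw [mul_div_assoc, Real.sqrt_mul hph, ← ha', ← haa] at h
  set u := √ph with hu'
  have hu : 0 ≤ u := Real.sqrt_nonneg _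
  have huu : u * u = ph := Real.mul_self_sqrt hph
  have hq : 0 < q := by
    have : 0 ≤ ph + ((2 * √2 + 2) * (u * a) + (3 + 2 * √2) * (a * a)) := by positivity
    linarith
  set v := √q with hv'
  have hv : 0 < v := Real.sqrt_pos.2 hq
  have hvv : v * v = q := Real.mul_self_sqrt hq.le
  -- Since `(1 + √2)² = 3 + 2√2`, the upper bound in the hypothesis is the perfect square `(√ph + (1
  -- + √2) √(t/N))²`; this explains the constants of the radius.
  have hgap : u + (1 + √2) * a < v := by
    have h0 : 0 ≤ u + (1 + √2) * a := by positivity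
    refine lt_of_mul_self_lt_mul_self₀ hv.le ?_
    rw [hvv]
    calc (u + (1 + √2) * a) * (u + (1 + √2) * a) =
        u * u + ((2 * √2 + 2) * (u * a) + (1 + 2 * √2 + √2 * √2) * (a * a)) := by ring
      _ = ph + ((2 * √2 + 2) * (u * a) + (3 + 2 * √2) * (a * a)) := by rw [huu, hr]; ring
      _ < q := h
  have hl : √(t / M / q) = b / v := Real.sqrt_div (by positivity) _
  rw [hl]
  -- The linear gain is at least `(1 + √2) a b`, the quadratic loss is `b² / 2 ≤ a b / √2`, and `a b
  -- ≥ a²`.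
  have hq2 : b / v * (q - ph) - q * (b / v) ^ 2 / 2 ≥ a * a := by
    have h1 : q * (b / v) ^ 2 = b * b := by
      rw [← hvv]
      field_simp
    have h2 : q - ph ≥ (1 + √2) * a * v := by
      rw [← hvv, ← huu]
      nlinarith [mul_nonneg hu (sub_nonneg.2 hgap.le), mul_nonneg hv.le (sub_nonneg.2 hgap.le)]
    have h3 : b / v * (q - ph) ≥ (1 + √2) * a * b := by
      calc b / v * (q - ph) ≥ b / v * ((1 + √2) * a * v) := by gcongr
        _ = (1 + √2) * a * b := by field_simp
    rw [h1]
    nlinarith [mul_le_mul_of_nonneg_right hab ha.le, mul_le_mul_of_nonneg_right hba hb.le,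
      mul_pos hb hb]
  have h5 := exp_neg_le_quadratic (l := b / v) (by positivity)
  have h6 : a * a ≤ q * (1 - Real.exp (-(b / v))) - b / v * ph := by
    have := mul_le_mul_of_nonneg_left h5 hq.le
    nlinarith
  calc t = a * a * N := by rw [haa]; field_simp
    _ ≤ (q * (1 - Real.exp (-(b / v))) - b / v * ph) * N := by gcongr
    _ = _ := by ring

end Deviation

/-! ### Union bound over the words seen in the sample. -/

section Concentration

variable {A : Type*}

/-- Counting from the first occurrence misses nothing, so a seen word can be replaced by the end
time and the length of that occurrence. The empty word first occurs at time `0` and needs only one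
index. -/
theorem exists_first_occurrence {s : List A} (hs : s ≠ []) {w : List A} (hw : 0 < occPred s w) :
    ∃ i < s.length, w.length ≤ i ∧ (w = [] → i = 0) ∧ (s.take i).drop (i - w.length) = w ∧
      cntFrom i w s = occPred s w ∧
      ∀ a, cntFromLetter i w a s = occ s s.length (w ++ [a]) := by
  classical
  rw [occPred_eq_card hs, Finset.card_pos] at hw
  have hex : ∃ j, j < s.length ∧ w <:+ s.take j := by
    obtain ⟨j, hj⟩ := hw
    exact ⟨j, by simpa using hj⟩
  obtain ⟨h1, h2⟩ := Nat.find_spec hex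
  have h3 : ∀ j, j < s.length → w <:+ s.take j → Nat.find hex ≤ j := fun j hj hj' =>
    Nat.find_min' hex ⟨hj, hj'⟩
  have hl := h2.length_le
  rw [List.length_take] at hl
  refine ⟨Nat.find hex, h1, by omega, ?_, ?_, ?_, ?_⟩
  · rintro rfl
    have := h3 0 (List.length_pos_iff.2 hs) (List.nil_suffix)
    omega
  · have h4 := List.suffix_iff_eq_drop.1 h2
    rw [List.length_take, min_eq_left h1.le] at h4
    exact h4.symm
  · rw [occPred_eq_card hs, cntFrom]
    congr 1
    refine Finset.filter_congr fun j hj => ?_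
    exact ⟨fun h => h.2, fun h => ⟨h3 j (Finset.mem_range.1 hj) h, h⟩⟩
  · intro a
    rw [occ_snoc_eq_card, cntFromLetter]
    congr 1
    refine Finset.filter_congr fun j hj => ?_
    exact ⟨fun h => h.2, fun h => ⟨h3 j (Finset.mem_range.1 hj) h.1, h⟩⟩

/-- The pairs of an end time and a length that describe the words seen in a sample of size `n`. -/
def wordIndex (n : ℕ) : Finset (Σ _ : ℕ, ℕ) :=
  insert ⟨0, 0⟩ ((Finset.range n).sigma fun i => Finset.Icc 1 i)

theorem card_wordIndex_le (n : ℕ) :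
    ((wordIndex n).card : ℝ) ≤ 1 + (n : ℝ) * ((n : ℝ) - 1) / 2 := by
  have h1 : (wordIndex n).card ≤ (∑ i ∈ Finset.range n, i) + 1 := by
    refine (Finset.card_insert_le _ _).trans ?_
    rw [Finset.card_sigma]
    simp
  have h2 : ((∑ i ∈ Finset.range n, i : ℕ) : ℝ) * 2 = n * (n - 1) := by
    rw [← Nat.cast_ofNat (n := 2), ← Nat.cast_mul, Finset.sum_range_id_mul_two]
    cases n <;> simp
  have h3 : ((wordIndex n).card : ℝ) ≤ ((∑ i ∈ Finset.range n, i : ℕ) : ℝ) + 1 := by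
    exact_mod_cast h1
  linarith

variable [Fintype A]

/-- Some minorant at a word seen in the sample exceeds the upper confidence bound. -/
def ConfidenceFails (q : A → List A → ℝ) (δ : ℝ) (s : List A) : Prop :=
  ∃ a w, 0 < occPred s w ∧ empP s a w + conf s δ a w < q a w

/-- The weight of the word of length `k` that ends at time `i`, tuned to the dyadic block `m` of
occurrence numbers. -/
noncomputable def blockWeight (q : A → List A → ℝ) (t : ℝ) (a : A) (ik : Σ _ : ℕ, ℕ) (m : ℕ)
    (s : List A) : ℝ :=
  expWeight (q a ((s.take ik.1).drop (ik.1 - ik.2)))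
    √(t / 2 ^ m / q a ((s.take ik.1).drop (ik.1 - ik.2))) ik.1
    ((s.take ik.1).drop (ik.1 - ik.2)) a s

variable [Nonempty A] {δ : ℝ}

theorem ConfidenceFails.exists_le_blockWeight {q : A → List A → ℝ} (hq1 : ∀ a w, q a w ≤ 1)
    {s : List A} (hs : s ≠ []) (h0 : 0 < δ) (h1 : δ < 1) (h : ConfidenceFails q δ s) :
    ∃ a, ∃ ik ∈ wordIndex s.length, ∃ m ∈ Finset.range (Nat.log 2 s.length + 1),
      Real.exp (tStar s.length δ (Fintype.card A)) ≤
        blockWeight q (tStar s.length δ (Fintype.card A)) a ik m s := by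
  obtain ⟨a, w, hw, hf⟩ := h
  obtain ⟨i, hi, hwi, hi0, hword, hc1, hc2⟩ := exists_first_occurrence hs hw
  have hNn : occPred s w ≤ s.length := by
    classical
    rw [occPred_eq_card hs]
    exact (Finset.card_filter_le _ _).trans (by simp)
  -- This block `m` satisfies `2 ^ m ≤ N ≤ 2 * 2 ^ m`, as `le_exponent_of_lt` requires.
  refine ⟨a, ⟨i, w.length⟩, ?_, Nat.log 2 (occPred s w), ?_, ?_⟩
  · unfold wordIndex
    rcases Nat.eq_zero_or_pos w.length with hz | hz
    · have := hi0 (List.length_eq_zero_iff.1 hz)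
      rw [this, hz]
      exact Finset.mem_insert_self _ _
    · refine Finset.mem_insert_of_mem (Finset.mem_sigma.2 ⟨Finset.mem_range.2 hi, ?_⟩)
      exact Finset.mem_Icc.2 ⟨hz, hwi⟩
  · exact Finset.mem_range.2 (Nat.lt_succ_of_le (Nat.log_mono_right hNn))
  · have ht : 0 < tStar s.length δ (Fintype.card A) := by
      apply Real.log_pos
      linarith [fourteen_le_tStar_argument (d := Fintype.card A) (List.length_pos_iff.2 hs)
        Fintype.card_pos h0 h1]
    have hemp := empP_nonneg s a w
    have hN : (0 : ℝ) < occPred s w := by exact_mod_cast hw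
    rw [conf, if_neg hw.ne'] at hf
    unfold blockWeight expWeight
    dsimp only
    rw [hword, hc1, hc2]
    apply Real.exp_le_exp.2
    have hocc : ((occ s s.length (w ++ [a]) : ℕ) : ℝ) = empP s a w * occPred s w := by
      rw [empP, if_neg hw.ne', div_mul_cancel₀ _ hN.ne']
    rw [hocc]
    refine le_exponent_of_lt ht (by positivity) ?_ ?_ hemp ?_
    · exact_mod_cast Nat.pow_log_le_self 2 hw.ne'
    · have := (Nat.lt_pow_succ_log_self (b := 2) (by norm_num) (occPred s w)).le
      rw [pow_succ, mul_comm] at this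
      exact_mod_cast this
    -- A radius truncated at one cannot fail, because `q ≤ 1`.
    · rcases min_cases ((2 * √2 + 2) *
          √(empP s a w * tStar s.length δ (Fintype.card A) / occPred s w) +
          (3 + 2 * √2) * (tStar s.length δ (Fintype.card A) / occPred s w)) 1 with h | h
      · rw [h.1] at hf
        exact hf
      · rw [h.1] at hf
        linarith [hq1 a w]

open Classical in
/-- The confidence bounds hold simultaneously with probability at least `1 - δ`. -/
theorem extSum_confidenceFails_le {μ : List A → ℝ} (hμ : ∀ u, 0 ≤ μ u) (hμ1 : μ [] = 1)
    (hμs : ∀ u, ∑ a, μ (u ++ [a]) = μ u) {q : A → List A → ℝ}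
    (hqm : ∀ a w w', w <:+ w' → q a w ≤ q a w') (hq : ∀ a u, q a u * μ u ≤ μ (u ++ [a]))
    (hq1 : ∀ a w, q a w ≤ 1) {n : ℕ} (hn : 1 ≤ n) (h0 : 0 < δ) (h1 : δ < 1) :
    extSum n (fun u => μ u * if ConfidenceFails q δ u then 1 else 0) [] ≤ δ := by
  set d := Fintype.card A with hd
  set t := tStar n δ d with ht
  have hd1 : 1 ≤ d := Fintype.card_pos
  have harg := fourteen_le_tStar_argument hn hd1 h0 h1
  set R := (d : ℝ) * (14 + 2 * Real.logb 2 n) * (1 + (n : ℝ) * ((n : ℝ) - 1) / 2) / δ with hR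
  have hexp : Real.exp t = R := Real.exp_log (by linarith)
  -- Markov's inequality in pointwise form: on failure some weight is at least `R = exp t_*`, so the
  -- sum of all weights over `R` dominates the indicator.
  have hmain : ∀ u : List A, u.length = n →
      μ u * (if ConfidenceFails q δ u then (1 : ℝ) else 0) ≤
        ∑ a : A, ∑ ik ∈ wordIndex n, ∑ m ∈ Finset.range (Nat.log 2 n + 1),
          R⁻¹ * (μ u * blockWeight q t a ik m u) := by
    intro u hu
    have hnn : ∀ a ik m, 0 ≤ R⁻¹ * (μ u * blockWeight q t a ik m u) := fun a ik m =>
      mul_nonneg (inv_nonneg.2 (by linarith)) (mul_nonneg (hμ u) (Real.exp_pos _).le)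
    split_ifs with hf
    · have hu0 : u ≠ [] := by
        rintro rfl
        simp at hu
        omega
      obtain ⟨a, ik, hik, m, hm, hle⟩ := hf.exists_le_blockWeight hq1 hu0 h0 h1
      rw [hu] at hik hm hle
      rw [← hd, ← ht, hexp] at hle
      calc μ u * 1 ≤ R⁻¹ * (μ u * blockWeight q t a ik m u) := by
            rw [mul_left_comm]
            refine mul_le_mul_of_nonneg_left ?_ (hμ u)
            rw [inv_mul_eq_div, one_le_div (by linarith)]
            exact hle
        _ ≤ ∑ m ∈ Finset.range (Nat.log 2 n + 1), R⁻¹ * (μ u * blockWeight q t a ik m u) :=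
            Finset.single_le_sum (f := fun m => R⁻¹ * (μ u * blockWeight q t a ik m u))
              (fun m _ => hnn a ik m) hm
        _ ≤ ∑ ik ∈ wordIndex n, ∑ m ∈ Finset.range (Nat.log 2 n + 1),
              R⁻¹ * (μ u * blockWeight q t a ik m u) :=
            Finset.single_le_sum (f := fun ik => ∑ m ∈ Finset.range (Nat.log 2 n + 1),
              R⁻¹ * (μ u * blockWeight q t a ik m u))
              (fun ik _ => Finset.sum_nonneg fun m _ => hnn a ik m) hik
        _ ≤ _ := Finset.single_le_sum (f := fun a => ∑ ik ∈ wordIndex n,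
              ∑ m ∈ Finset.range (Nat.log 2 n + 1), R⁻¹ * (μ u * blockWeight q t a ik m u))
              (fun a _ => Finset.sum_nonneg fun ik _ => Finset.sum_nonneg fun m _ => hnn a ik m)
              (Finset.mem_univ a)
    · rw [mul_zero]
      exact Finset.sum_nonneg fun a _ => Finset.sum_nonneg fun ik _ =>
        Finset.sum_nonneg fun m _ => hnn a ik m
  have hRpos : 0 < R := by linarith
  have hone : ∀ a : A, ∀ ik ∈ wordIndex n, ∀ m,
      extSum n (fun u => μ u * blockWeight q t a ik m u) [] ≤ 1 := by
    intro a ik hik m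
    refine extSum_mul_expWeight_le (l := fun w => √(t / 2 ^ m / q a w)) hμ hμ1 hμs hqm hq
      (fun w => Real.sqrt_nonneg _) a ?_ ik.2
    rcases Finset.mem_insert.1 hik with h | h
    · rw [h]
      exact Nat.zero_le _
    · exact (Finset.mem_range.1 (Finset.mem_sigma.1 h).1).le
  calc _ ≤ extSum n (fun u => ∑ a : A, ∑ ik ∈ wordIndex n, ∑ m ∈ Finset.range (Nat.log 2 n + 1),
          R⁻¹ * (μ u * blockWeight q t a ik m u)) [] :=
        extSum_le_extSum n fun v _ hv => hmain v (by simpa using hv)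
    _ = ∑ a : A, ∑ ik ∈ wordIndex n, ∑ m ∈ Finset.range (Nat.log 2 n + 1),
          R⁻¹ * extSum n (fun u => μ u * blockWeight q t a ik m u) [] := by
        simp_rw [extSum_sum, extSum_const_mul]
    _ ≤ ∑ _a : A, ∑ _ik ∈ wordIndex n, ∑ _m ∈ Finset.range (Nat.log 2 n + 1), R⁻¹ * 1 := by
        refine Finset.sum_le_sum fun a _ => Finset.sum_le_sum fun ik hik =>
          Finset.sum_le_sum fun m _ => ?_
        exact mul_le_mul_of_nonneg_left (hone a ik hik m) (inv_nonneg.2 hRpos.le)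
    _ = d * (wordIndex n).card * (Nat.log 2 n + 1) / R := by
        simp [← hd]
        ring
    -- The definition of `t_*` makes `R * δ` at least the number of weights. There are at most `1 +
    -- log₂ n` blocks, so the factor `14 + 2 log₂ n` leaves room.
    _ ≤ δ := by
        have hn' : (1 : ℝ) ≤ n := by exact_mod_cast hn
        have hl0 : 0 ≤ Real.logb 2 n := Real.logb_nonneg (by norm_num) hn'
        have hl : (Nat.log 2 n : ℝ) ≤ Real.logb 2 n := by
          exact_mod_cast Real.natLog_le_logb n 2
        have hp : (0 : ℝ) ≤ 1 + (n : ℝ) * ((n : ℝ) - 1) / 2 :=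
          (Nat.cast_nonneg _).trans (card_wordIndex_le n)
        rw [div_le_iff₀ hRpos, hR, mul_div_cancel₀ _ h0.ne']
        calc (d : ℝ) * (wordIndex n).card * (Nat.log 2 n + 1) ≤
              d * (1 + (n : ℝ) * ((n : ℝ) - 1) / 2) * (14 + 2 * Real.logb 2 n) := by
              have hb : (Nat.log 2 n : ℝ) + 1 ≤ 14 + 2 * Real.logb 2 n := by linarith
              exact mul_le_mul (mul_le_mul_of_nonneg_left (card_wordIndex_le n)
                (Nat.cast_nonneg d)) hb (by positivity) (by positivity)
          _ = _ := by ring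

end Concentration

/-! ### Minorants as essential infima. -/

section Minorant

variable {A : Type*} [Fintype A] [Nonempty A] [MeasurableSpace A] [MeasurableSingletonClass A]
  {Ω : Type*} [MeasurableSpace Ω] {P : Measure Ω} [IsProbabilityMeasure P] {X : ℤ → Ω → A}

theorem measurable_past (hX : ∀ i, Measurable (X i)) : Measurable (past X) :=
  measurable_pi_iff.2 fun _ => hX _

theorem pastCylinder_antitone {v w : List A} (h : v <:+ w) :
    pastCylinder X w ⊆ pastCylinder X v := fun _ hω => EndsWith.of_suffix hω h

theorem measurableSet_endsWith (w : List A) : MeasurableSet {x : Past A | EndsWith x w} := by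
  have : Measurable fun x : Past A => EndsWith x w :=
    measurable_of_forall_lt w.length fun x y h => by
      unfold EndsWith
      rw [lastWord_congr h]
  exact measurableSet_setOfPred.2 this

theorem measurableSet_pastCylinder (hX : ∀ i, Measurable (X i)) (w : List A) :
    MeasurableSet (pastCylinder X w) :=
  measurable_past hX (measurableSet_endsWith w)

theorem positiveSuffix_suffix (w : List A) : positiveSuffix P X w <:+ w := List.drop_suffix _ _

/-- Every past ends with the empty word, so some suffix qualifies and the infimum is attained. -/
theorem positiveSuffix_pos (w : List A) : 0 < P (pastCylinder X (positiveSuffix P X w)) := by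
  refine Nat.sInf_mem (s := {k | 0 < P (pastCylinder X (w.drop k))}) ⟨w.length, ?_⟩
  have : pastCylinder X (w.drop w.length) = Set.univ := by
    ext ω
    simp [pastCylinder, EndsWith]
  rw [Set.mem_ofPred_eq, this]
  simp

theorem positiveSuffix_of_pos {w : List A} (h : 0 < P (pastCylinder X w)) :
    positiveSuffix P X w = w := by
  have : sInf {k | 0 < P (pastCylinder X (w.drop k))} = 0 :=
    Nat.sInf_eq_zero.2 (Or.inl (by simpa using h))
  simp [positiveSuffix, this]

/-- The suffix chosen for `w` is also a candidate for `w'`, so the longest candidate for `w'`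
extends it. -/
theorem positiveSuffix_mono {w w' : List A} (h : w <:+ w') :
    positiveSuffix P X w <:+ positiveSuffix P X w' := by
  obtain ⟨v, rfl⟩ := h
  have h1 : sInf {k | 0 < P (pastCylinder X ((v ++ w).drop k))} ≤
      v.length + sInf {k | 0 < P (pastCylinder X (w.drop k))} := by
    apply Nat.sInf_le
    rw [Set.mem_ofPred_eq, ← List.drop_drop, List.drop_left]
    exact positiveSuffix_pos w
  have h2 : positiveSuffix P X w =
      (v ++ w).drop (v.length + sInf {k | 0 < P (pastCylinder X (w.drop k))}) := by
    rw [← List.drop_drop, List.drop_left]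
    rfl
  rw [h2]
  unfold positiveSuffix
  obtain ⟨m, hm⟩ := Nat.exists_eq_add_of_le h1
  rw [hm, ← List.drop_drop]
  exact List.drop_suffix _ _

variable {p : A → Past A → ℝ}

theorem IsVersion.ae_forall_eq (hp : IsVersion P X p) :
    ∀ᵐ ω ∂P, ∀ a, condProb P X a ω = p a (past X ω) :=
  ae_all_iff.2 fun a => (hp.ae_eq a).symm

theorem IsTransitionProbability.le_one {p : A → Past A → ℝ} (hp : IsTransitionProbability p)
    (a : A) (x : Past A) : p a x ≤ 1 := by
  rw [← hp.sum_eq_one x]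
  exact Finset.single_le_sum (f := fun a => p a x) (fun b _ => hp.nonneg b x) (Finset.mem_univ a)

theorem IsVersion.ae_condProb_mem (hp : IsVersion P X p) (a : A) :
    ∀ᵐ ω ∂P, 0 ≤ condProb P X a ω ∧ condProb P X a ω ≤ 1 := by
  filter_upwards [hp.ae_forall_eq] with ω hω
  rw [hω]
  exact ⟨hp.isTransitionProbability.nonneg a _, hp.isTransitionProbability.le_one a _⟩

theorem IsVersion.ae_minorant_le (hX : ∀ i, Measurable (X i)) (hp : IsVersion P X p) (a : A)
    (w : List A) :
    ∀ᵐ ω ∂P, ω ∈ pastCylinder X (positiveSuffix P X w) → minorant P X a w ≤ condProb P X a ω := by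
  rw [← ae_restrict_iff' (measurableSet_pastCylinder hX _)]
  refine ae_essInf_le (isBoundedUnder_of_eventually_ge (a := 0) ?_)
  exact ae_restrict_of_ae ((hp.ae_condProb_mem a).mono fun ω h => h.1)

/-- The positive suffix keeps the restricted measure nonzero, and the bound by one keeps the real
essential infimum away from its default value. -/
theorem IsVersion.le_minorant (hX : ∀ i, Measurable (X i)) (hp : IsVersion P X p) {a : A}
    {w : List A} {c : ℝ}
    (h : ∀ᵐ ω ∂P, ω ∈ pastCylinder X (positiveSuffix P X w) → c ≤ condProb P X a ω) :
    c ≤ minorant P X a w := by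
  have hne : (ae (P.restrict (pastCylinder X (positiveSuffix P X w)))).NeBot := by
    rw [ae_neBot]
    exact fun h0 => (positiveSuffix_pos (P := P) (X := X) w).ne' (Measure.restrict_eq_zero.1 h0)
  refine le_liminf_of_le (IsBoundedUnder.isCoboundedUnder_ge
    (isBoundedUnder_of_eventually_le (a := 1) ?_)) ?_
  · exact ae_restrict_of_ae ((hp.ae_condProb_mem a).mono fun ω h => h.2)
  · exact (ae_restrict_iff' (measurableSet_pastCylinder hX _)).2 h

theorem IsVersion.minorant_nonneg (hX : ∀ i, Measurable (X i)) (hp : IsVersion P X p) (a : A)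
    (w : List A) : 0 ≤ minorant P X a w :=
  hp.le_minorant hX ((hp.ae_condProb_mem a).mono fun _ h _ => h.1)

theorem IsVersion.minorant_mono (hX : ∀ i, Measurable (X i)) (hp : IsVersion P X p) (a : A)
    {w w' : List A} (h : w <:+ w') : minorant P X a w ≤ minorant P X a w' :=
  hp.le_minorant hX ((hp.ae_minorant_le hX a w).mono fun _ h1 h2 =>
    h1 (pastCylinder_antitone (positiveSuffix_mono h) h2))

/-- On an event of positive probability, hence at some point, the minorants lie below conditional
probabilities that sum to one. -/
theorem IsVersion.sum_minorant_le (hX : ∀ i, Measurable (X i)) (hp : IsVersion P X p)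
    (w : List A) : ∑ a, minorant P X a w ≤ 1 := by
  have h1 : ∀ᵐ ω ∂P, ω ∈ pastCylinder X (positiveSuffix P X w) → ∑ a, minorant P X a w ≤ 1 := by
    filter_upwards [ae_all_iff.2 fun a => hp.ae_minorant_le hX a w, hp.ae_forall_eq]
      with ω h1 h2 hω
    rw [← hp.isTransitionProbability.sum_eq_one (past X ω)]
    refine Finset.sum_le_sum fun a _ => ?_
    rw [← h2]
    exact h1 a hω
  by_contra hc
  have h2 : P (pastCylinder X (positiveSuffix P X w)) = 0 :=
    measure_eq_zero_iff_ae_notMem.2 (h1.mono fun ω h hω => hc (h hω))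
  exact (positiveSuffix_pos w).ne' h2

theorem IsVersion.minorant_le_one (hX : ∀ i, Measurable (X i)) (hp : IsVersion P X p) (a : A)
    (w : List A) : minorant P X a w ≤ 1 :=
  (Finset.single_le_sum (f := fun a => minorant P X a w) (fun b _ => hp.minorant_nonneg hX b w)
    (Finset.mem_univ a)).trans (hp.sum_minorant_le hX w)

/-- Almost every past dominates the minorants. -/
theorem IsVersion.ae_dominates (hX : ∀ i, Measurable (X i)) (hp : IsVersion P X p) :
    ∀ᵐ ω ∂P, Dominates P X p (past X ω) := by
  -- There are countably many words, so a single null set serves for all.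
  have h : ∀ᵐ ω ∂P, ∀ (w : List A) (a : A),
      ω ∈ pastCylinder X (positiveSuffix P X w) → minorant P X a w ≤ condProb P X a ω :=
    ae_all_iff.2 fun w => ae_all_iff.2 fun a => hp.ae_minorant_le hX a w
  filter_upwards [h, hp.ae_forall_eq] with ω h1 h2 k a
  rw [← h2]
  exact h1 _ a ((endsWith_lastWord _ _).of_suffix (positiveSuffix_suffix _))

end Minorant

/-! ### The canonical version. -/

section CanonicalVersion

variable {A : Type*} [Fintype A] [Nonempty A] [MeasurableSpace A] [MeasurableSingletonClass A]
  {Ω : Type*} [MeasurableSpace Ω] {P : Measure Ω} [IsProbabilityMeasure P] {X : ℤ → Ω → A}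
  {p : A → Past A → ℝ}

theorem IsVersion.bddAbove_minorant (hX : ∀ i, Measurable (X i)) (hp : IsVersion P X p) (a : A)
    (x : Past A) : BddAbove (Set.range fun k => minorant P X a (lastWord x k)) :=
  ⟨1, by
    rintro _ ⟨k, rfl⟩
    exact hp.minorant_le_one hX a _⟩

/-- Along a past the minorants increase, so their suprema are limits and the bound on the sums
survives. -/
theorem IsVersion.sum_iSup_minorant_le (hX : ∀ i, Measurable (X i)) (hp : IsVersion P X p)
    (x : Past A) : ∑ a, ⨆ k, minorant P X a (lastWord x k) ≤ 1 := by
  have h : Tendsto (fun k => ∑ a, minorant P X a (lastWord x k)) atTop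
      (𝓝 (∑ a, ⨆ k, minorant P X a (lastWord x k))) :=
    tendsto_finsetSum _ fun a _ => tendsto_atTop_ciSup
      (fun k l hkl => hp.minorant_mono hX a (lastWord_suffix x hkl)) (hp.bddAbove_minorant hX a x)
  exact le_of_tendsto' h fun k => hp.sum_minorant_le hX _

theorem IsVersion.dominates_canonicalVersion (hX : ∀ i, Measurable (X i)) (hp : IsVersion P X p)
    (x : Past A) : Dominates P X (canonicalVersion P X) x := by
  intro k a
  refine (le_ciSup (hp.bddAbove_minorant hX a x) k).trans (le_add_of_nonneg_right ?_)
  exact mul_nonneg (sub_nonneg.2 (hp.sum_iSup_minorant_le hX x)) (by positivity)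

theorem IsVersion.isTransitionProbability_canonicalVersion (hX : ∀ i, Measurable (X i))
    (hp : IsVersion P X p) : IsTransitionProbability (canonicalVersion P X) where
  measurable a := by
    have h : ∀ b, Measurable fun x : Past A => ⨆ k, minorant P X b (lastWord x k) := fun b =>
      Measurable.iSup fun k => measurable_of_forall_lt k fun x y hxy => by rw [lastWord_congr hxy]
    unfold canonicalVersion
    exact (h a).add ((measurable_const.sub
      (Finset.measurable_fun_sum _ fun b _ => h b)).mul measurable_const)
  nonneg a x := (hp.minorant_nonneg hX a _).trans (hp.dominates_canonicalVersion hX x 0 a)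
  sum_eq_one x := by
    unfold canonicalVersion
    rw [Finset.sum_add_distrib, Finset.sum_const, Finset.card_univ, nsmul_eq_mul,
      mul_left_comm, mul_one_div_cancel (by simp), mul_one]
    ring

theorem IsTransitionProbability.dTV_le_one (hp : IsTransitionProbability p) (y z : Past A) :
    dTV (fun a => p a y) (fun a => p a z) ≤ 1 := by
  have h : ∑ a, |p a y - p a z| ≤ ∑ a, (p a y + p a z) := by
    refine Finset.sum_le_sum fun a _ => abs_le.2 ⟨?_, ?_⟩ <;>
      linarith [hp.nonneg a y, hp.nonneg a z]
  rw [Finset.sum_add_distrib, hp.sum_eq_one, hp.sum_eq_one] at h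
  unfold dTV
  linarith

/-- The factor two undoes the one half in `dTV`. Boundedness of `dTV` makes the real supremum in
`oscillation` a genuine upper bound. -/
theorem IsTransitionProbability.abs_sub_le_oscillation (hp : IsTransitionProbability p)
    {y z : Past A} {w : List A} (hy : EndsWith y w) (hz : EndsWith z w) (a : A) :
    |p a y - p a z| ≤ 2 * oscillation p w := by
  have h1 : |p a y - p a z| ≤ ∑ a, |p a y - p a z| :=
    Finset.single_le_sum (f := fun a => |p a y - p a z|) (fun b _ => abs_nonneg _)
      (Finset.mem_univ a)
  have h2 : dTV (fun a => p a y) (fun a => p a z) ≤ oscillation p w := by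
    refine le_csSup ⟨1, ?_⟩ ⟨y, z, hy, hz, rfl⟩
    rintro _ ⟨y, z, _, _, rfl⟩
    exact hp.dTV_le_one y z
  unfold dTV at h2
  linarith

theorem ae_pastCylinder_pos :
    ∀ᵐ ω ∂P, ∀ w : List A, ω ∈ pastCylinder X w → 0 < P (pastCylinder X w) := by
  refine ae_all_iff.2 fun w => ?_
  by_cases h : P (pastCylinder X w) = 0
  · exact (measure_eq_zero_iff_ae_notMem.1 h).mono fun ω h1 h2 => absurd h2 h1
  · exact Eventually.of_forall fun _ _ => pos_iff_ne_zero.2 h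

/-- Where the transition probabilities are continuous, they are the limits of the minorants. -/
theorem IsVersion.ae_iSup_minorant_eq (hX : ∀ i, Measurable (X i)) (hp : IsVersion P X p)
    (hc : ∀ᵐ ω ∂P, Tendsto (fun k => oscillation p (lastWord (past X ω) k)) atTop (𝓝 0)) :
    ∀ᵐ ω ∂P, ∀ a, ⨆ k, minorant P X a (lastWord (past X ω) k) = p a (past X ω) := by
  filter_upwards [hp.ae_dominates hX, hc, ae_pastCylinder_pos (P := P) (X := X)]
    with ω hd hosc hpos a
  refine le_antisymm (ciSup_le fun k => hd k a) ?_
  have hk : ∀ k, p a (past X ω) - 2 * oscillation p (lastWord (past X ω) k) ≤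
      ⨆ k, minorant P X a (lastWord (past X ω) k) := by
    intro k
    refine le_trans ?_ (le_ciSup (hp.bddAbove_minorant hX a _) k)
    refine hp.le_minorant hX ?_
    -- Almost surely the cylinders along the past all have positive probability. The infimum then
    -- runs over the cylinder of the last `k` letters, on which the oscillation controls `p`.
    rw [positiveSuffix_of_pos (hpos _ (endsWith_lastWord _ _))]
    filter_upwards [hp.ae_forall_eq] with ω' h1 h2
    rw [h1]
    have := abs_le.1 (hp.isTransitionProbability.abs_sub_le_oscillation h2
      (endsWith_lastWord (past X ω) k) a)
    linarith [this.1]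
  have hlim : Tendsto (fun k => p a (past X ω) - 2 * oscillation p (lastWord (past X ω) k)) atTop
      (𝓝 (p a (past X ω) - 2 * 0)) := tendsto_const_nhds.sub (hosc.const_mul 2)
  rw [mul_zero, sub_zero] at hlim
  exact le_of_tendsto' hlim hk

theorem IsVersion.isVersion_canonicalVersion (hX : ∀ i, Measurable (X i)) (hp : IsVersion P X p)
    (hc : ∀ᵐ ω ∂P, Tendsto (fun k => oscillation p (lastWord (past X ω) k)) atTop (𝓝 0)) :
    IsVersion P X (canonicalVersion P X) where
  isTransitionProbability := hp.isTransitionProbability_canonicalVersion hX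
  ae_eq a := by
    filter_upwards [hp.ae_iSup_minorant_eq hX hc, hp.ae_forall_eq] with ω h1 h2
    unfold canonicalVersion
    simp_rw [h1]
    rw [hp.isTransitionProbability.sum_eq_one, h2]
    ring

end CanonicalVersion

/-! ### The law of the sample, and the oracle inequality in probability. -/

section SampleLaw

variable {A : Type*} [MeasurableSpace A] {Ω : Type*} [MeasurableSpace Ω] {P : Measure Ω}
  {X : ℤ → Ω → A}

theorem HasShiftInvariantLaw.map_add (hX : ∀ i, Measurable (X i)) (h : HasShiftInvariantLaw P X)
    (m : ℕ) : P.map (fun ω (i : ℤ) => X (i + m) ω) = P.map (fun ω (i : ℤ) => X i ω) := by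
  induction m with
  | zero => simp
  | succ m ih =>
    have hs : Measurable fun (z : ℤ → A) (i : ℤ) => z (i + 1) :=
      measurable_pi_iff.2 fun i => measurable_pi_apply _
    have h1 : (fun ω (i : ℤ) => X (i + (m + 1 : ℕ)) ω) =
        (fun (z : ℤ → A) (i : ℤ) => z (i + 1)) ∘ fun ω (i : ℤ) => X (i + m) ω := by
      funext ω i
      simp only [Function.comp]
      congr 1
      push_cast
      ring
    rw [h1, ← Measure.map_map hs (measurable_pi_iff.2 fun i => hX _), ih,
      Measure.map_map hs (measurable_pi_iff.2 fun i => hX _)]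
    exact h

theorem HasShiftInvariantLaw.measure_preimage_add (hX : ∀ i, Measurable (X i))
    (h : HasShiftInvariantLaw P X) (m : ℕ) {S : Set (ℤ → A)} (hS : MeasurableSet S) :
    P {ω | (fun i : ℤ => X (i + m) ω) ∈ S} = P {ω | (fun i : ℤ => X i ω) ∈ S} := by
  have := congrArg (fun ν => ν S) (h.map_add hX m)
  rwa [Measure.map_apply (measurable_pi_iff.2 fun i => hX _) hS,
    Measure.map_apply (measurable_pi_iff.2 fun i => hX _) hS] at this

@[simp] theorem length_sample (n : ℕ) (ω : Ω) : (sample X n ω).length = n := by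
  simp [sample]

theorem sample_succ (n : ℕ) (ω : Ω) : sample X (n + 1) ω = sample X n ω ++ [X (n + 1) ω] := by
  unfold sample
  rw [List.ofFn_succ_last]
  simp

/-- The shift by `n + 1` moves the times `1, …, n` to `-n, …, -1`. The sample becomes the end of the
past and the next letter sits at time zero. -/
theorem lastWord_past_add (n : ℕ) (ω : Ω) :
    lastWord (past (fun i => X (i + (n + 1 : ℕ))) ω) n = sample X n ω := by
  apply List.ext_getElem
  · simp
  · intro i h1 h2
    simp only [length_sample] at h2
    simp only [lastWord, past, sample, List.getElem_reverse, List.length_map, List.length_range,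
      List.getElem_map, List.getElem_range, List.getElem_ofFn]
    congr 1
    omega

variable [Fintype A] [MeasurableSingletonClass A]

theorem measurableSet_sample (hX : ∀ i, Measurable (X i)) (n : ℕ) (S : Set (List A)) :
    MeasurableSet {ω | sample X n ω ∈ S} := by
  have h : Measurable fun ω (i : Fin n) => X ((i : ℤ) + 1) ω := measurable_pi_iff.2 fun i => hX _
  exact h (Set.toFinite {z : Fin n → A | List.ofFn z ∈ S}).measurableSet

theorem sum_measureReal_inter_preimage [IsFiniteMeasure P] {Y : Ω → A} (hY : Measurable Y)
    {S : Set Ω} (hS : MeasurableSet S) : ∑ a, P.real (S ∩ Y ⁻¹' {a}) = P.real S := by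
  rw [← measureReal_biUnion_finset]
  · congr 1
    ext ω
    simp
  · intro a _ b _ hab
    rw [Function.onFun, Set.disjoint_left]
    rintro ω ⟨_, h1⟩ ⟨_, h2⟩
    exact hab (h1.symm.trans h2)
  · exact fun a _ => hS.inter (hY (measurableSet_singleton a))

/-- The probability that the sample of size `|u|` is `u`. -/
noncomputable def wordProb (P : Measure Ω) (X : ℤ → Ω → A) (u : List A) : ℝ :=
  P.real {ω | sample X u.length ω = u}

theorem wordProb_nonneg (u : List A) : 0 ≤ wordProb P X u := measureReal_nonneg

theorem wordProb_nil [IsProbabilityMeasure P] : wordProb P X ([] : List A) = 1 := by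
  simp [wordProb, sample]

theorem setOf_sample_eq_snoc (u : List A) (a : A) :
    {ω | sample X (u ++ [a]).length ω = u ++ [a]} =
      {ω | sample X u.length ω = u} ∩ X (u.length + 1) ⁻¹' {a} := by
  ext ω
  rw [List.length_append, List.length_singleton]
  simp only [Set.mem_ofPred_eq, Set.mem_inter_iff, Set.mem_preimage, Set.mem_singleton_iff]
  rw [sample_succ, List.append_eq_append_iff_of_size_eq_left (by simp)]
  simp

theorem sum_wordProb_snoc [IsFiniteMeasure P] (hX : ∀ i, Measurable (X i)) (u : List A) :
    ∑ a, wordProb P X (u ++ [a]) = wordProb P X u := by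
  unfold wordProb
  simp_rw [setOf_sample_eq_snoc]
  exact sum_measureReal_inter_preimage (hX _) (measurableSet_sample hX _ {u})

-- Turns probabilities of sample events into sums over words, where the union bound was proved. The
-- induction splits on the next letter.
open Classical in
theorem measureReal_sample_mem [IsFiniteMeasure P] (hX : ∀ i, Measurable (X i)) (S : Set (List A))
    (n : ℕ) (u : List A) :
    P.real {ω | sample X u.length ω = u ∧ sample X (u.length + n) ω ∈ S} =
      extSum n (fun v => wordProb P X v * if v ∈ S then 1 else 0) u := by
  induction n generalizing u with
  | zero =>
    simp only [extSum, Nat.add_zero, wordProb]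
    split_ifs with h
    · rw [mul_one]
      congr 1
      ext ω
      refine ⟨fun h1 => h1.1, fun h1 => ⟨h1, ?_⟩⟩
      rw [Set.mem_ofPred_eq] at h1
      rwa [h1]
    · rw [mul_zero]
      have : {ω | sample X u.length ω = u ∧ sample X u.length ω ∈ S} = ∅ := by
        ext ω
        simp only [Set.mem_ofPred_eq, Set.mem_empty_iff_false, iff_false, not_and]
        intro h1
        rwa [h1]
      rw [this, measureReal_empty]
  | succ n ih =>
    simp only [extSum, ← ih]
    have hm : MeasurableSet {ω | sample X u.length ω = u ∧ sample X (u.length + (n + 1)) ω ∈ S} :=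
      (measurableSet_sample hX _ {u}).inter (measurableSet_sample hX _ S)
    rw [← sum_measureReal_inter_preimage (hX (u.length + 1)) hm]
    refine Finset.sum_congr rfl fun a _ => ?_
    congr 1
    have h1 := setOf_sample_eq_snoc (X := X) u a
    ext ω
    have h2 := Set.ext_iff.1 h1 ω
    simp only [Set.mem_ofPred_eq, Set.mem_inter_iff, Set.mem_preimage, Set.mem_singleton_iff] at h2 ⊢
    rw [h2]
    have h3 : (u ++ [a]).length + n = u.length + (n + 1) := by
      simp
      omega
    rw [h3]
    tauto

variable [Nonempty A] [IsProbabilityMeasure P] {p : A → Past A → ℝ}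

/-- By stationarity, `a` follows the sample `u` with conditional probability at least the minorant
at `u`. -/
theorem IsVersion.minorant_mul_wordProb_le (hX : ∀ i, Measurable (X i))
    (hs : HasShiftInvariantLaw P X) (hp : IsVersion P X p) (a : A) (u : List A) :
    minorant P X a u * wordProb P X u ≤ wordProb P X (u ++ [a]) := by
  have hpm : Measurable fun (z : ℤ → A) (j : ℕ) => z (-1 - (j : ℤ)) :=
    measurable_pi_iff.2 fun j => measurable_pi_apply _
  have hS : MeasurableSet {z : ℤ → A | EndsWith (fun j : ℕ => z (-1 - (j : ℤ))) u} :=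
    hpm (measurableSet_endsWith u)
  have hS' : MeasurableSet ({z : ℤ → A | EndsWith (fun j : ℕ => z (-1 - (j : ℤ))) u} ∩
      (fun z : ℤ → A => z 0) ⁻¹' {a}) :=
    hS.inter (measurable_pi_apply 0 (measurableSet_singleton a))
  have e : ∀ ω, EndsWith (fun j : ℕ => X (-1 - (j : ℤ) + (u.length + 1 : ℕ)) ω) u ↔
      sample X u.length ω = u := by
    intro ω
    have := lastWord_past_add (X := X) u.length ω
    unfold EndsWith
    rw [← this]
    rfl
  have h1 : wordProb P X u = P.real (pastCylinder X u) := by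
    have h := hs.measure_preimage_add hX (u.length + 1) hS
    unfold wordProb Measure.real
    congr 1
    rw [← show _ = P (pastCylinder X u) from rfl]
    refine Eq.trans (congrArg P ?_) h
    ext ω
    exact (e ω).symm
  have h2 : wordProb P X (u ++ [a]) = P.real (pastCylinder X u ∩ X 0 ⁻¹' {a}) := by
    have h := hs.measure_preimage_add hX (u.length + 1) hS'
    unfold wordProb Measure.real
    rw [setOf_sample_eq_snoc]
    congr 1
    refine Eq.trans (congrArg P ?_) h
    ext ω
    refine and_congr (e ω).symm ?_
    simp
  have hcomap : MeasurableSpace.comap (past X) inferInstance ≤ (inferInstance : MeasurableSpace Ω) :=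
    (measurable_past hX).comap_le
  have hmeas : MeasurableSet[MeasurableSpace.comap (past X) inferInstance] (pastCylinder X u) :=
    ⟨_, measurableSet_endsWith u, rfl⟩
  have hXa : MeasurableSet (X 0 ⁻¹' {a}) := hX 0 (measurableSet_singleton a)
  -- The cylinder belongs to the σ-algebra of the past, so the conditional expectation integrates
  -- over it to the joint probability.
  have h3 : ∫ ω in pastCylinder X u, condProb P X a ω ∂P =
      P.real (pastCylinder X u ∩ X 0 ⁻¹' {a}) := by
    unfold condProb
    rw [setIntegral_condExp hcomap ((integrable_const 1).indicator hXa) hmeas,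
      setIntegral_indicator hXa]
    simp
  have h4 : ∫ _ω in pastCylinder X u, minorant P X a u ∂P ≤
      ∫ ω in pastCylinder X u, condProb P X a ω ∂P := by
    refine setIntegral_mono_ae_restrict (integrable_const _) integrable_condExp.integrableOn ?_
    refine (ae_restrict_iff' (measurableSet_pastCylinder hX u)).2 ?_
    filter_upwards [hp.ae_minorant_le hX a u] with ω h hω
    exact h (pastCylinder_antitone (positiveSuffix_suffix u) hω)
  rw [setIntegral_const, smul_eq_mul, mul_comm] at h4
  rw [h1, h2, ← h3]
  exact h4

theorem IsVersion.measure_confidenceFails_le (hX : ∀ i, Measurable (X i))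
    (hs : HasShiftInvariantLaw P X) (hp : IsVersion P X p) {n : ℕ} {δ : ℝ} (hn : 1 ≤ n)
    (h0 : 0 < δ) (h1 : δ < 1) :
    P {ω | ConfidenceFails (minorant P X) δ (sample X n ω)} ≤ ENNReal.ofReal δ := by
  classical
  have h := measureReal_sample_mem (P := P) hX {s | ConfidenceFails (minorant P X) δ s} n []
  have h2 : {ω | sample X ([] : List A).length ω = [] ∧ sample X (([] : List A).length + n) ω ∈
      {s | ConfidenceFails (minorant P X) δ s}} =
      {ω | ConfidenceFails (minorant P X) δ (sample X n ω)} := by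
    ext ω
    simp [sample]
  rw [h2] at h
  have h3 := extSum_confidenceFails_le (δ := δ) (wordProb_nonneg (P := P) (X := X)) wordProb_nil
    (sum_wordProb_snoc hX) (fun a w w' => hp.minorant_mono hX a)
    (hp.minorant_mul_wordProb_le hX hs) (hp.minorant_le_one hX) hn h0 h1
  refine (ENNReal.le_ofReal_iff_toReal_le (measure_ne_top _ _) h0.le).2 ?_
  exact h.trans_le h3

/-- The oracle inequality. -/
theorem IsVersion.ofReal_le_measure_oracle (hX : ∀ i, Measurable (X i))
    (hs : HasShiftInvariantLaw P X) (hp : IsVersion P X p) {n : ℕ} {δ : ℝ} (hn : 1 ≤ n)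
    (h0 : 0 < δ) (h1 : δ < 1) :
    ENNReal.ofReal (1 - δ) ≤
      P {ω | ∀ x : Past A, Dominates P X p x →
        ∀ L : ℕ, 0 < occPred (sample X n ω) (lastWord x L) →
          dTV (fun a => p a x) (fun a => estimator (sample X n ω) δ a x) ≤
            1 - ∑ a, minorant P X a (lastWord x L)
              + (4 + 4 * √2) * √(tParam n δ (Fintype.card A) /
                  occPred (sample X n ω) (lastWord x L))
              + (6 + 4 * √2) * (tParam n δ (Fintype.card A) /
                  occPred (sample X n ω) (lastWord x L))} := by
  have hm : MeasurableSet {ω | ConfidenceFails (minorant P X) δ (sample X n ω)} :=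
    measurableSet_sample hX n {s | ConfidenceFails (minorant P X) δ s}
  calc ENNReal.ofReal (1 - δ) = 1 - ENNReal.ofReal δ := by
        rw [ENNReal.ofReal_sub _ h0.le, ENNReal.ofReal_one]
    _ ≤ 1 - P {ω | ConfidenceFails (minorant P X) δ (sample X n ω)} :=
        tsub_le_tsub_left (hp.measure_confidenceFails_le hX hs hn h0 h1) 1
    _ = P {ω | ConfidenceFails (minorant P X) δ (sample X n ω)}ᶜ :=
        (prob_compl_eq_one_sub hm).symm
    _ ≤ _ := by
        -- The good event involves neither `x` nor `L`, so the inequality holds for all of them at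
        -- once. Its inclusion in the target event suffices, whether or not the latter is
        -- measurable.
        refine measure_mono fun ω hω x hx L hL => ?_
        have hne : sample X n ω ≠ [] := by
          apply List.ne_nil_of_length_pos
          rw [length_sample]
          omega
        have hgood : ∀ a w, 0 < occPred (sample X n ω) w → minorant P X a w ≤
            empP (sample X n ω) a w + conf (sample X n ω) δ a w := by
          intro a w hw
          by_contra hc
          exact hω ⟨a, w, hw, not_le.1 hc⟩
        have := dTV_estimator_le hne h0 h1 (hp.minorant_le_one hX)
          (fun a w w' => hp.minorant_mono hX a) hgood
          (hp.isTransitionProbability.sum_eq_one x) (fun k a => hx k a) hL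
        rwa [length_sample] at this

end SampleLaw

/-! ### Program logic with costs for the machine. -/

namespace Machine

variable {W : Finset Cell} {c d : Program} {σ τ : State} {T U : ℕ} {Q R : State → Prop}

/-- The numbers of the arrays of natural numbers that a program may change. -/
def Program.natWrites : Program → Finset ℕ
  | .skip => ∅
  | .nset b _ _ _ => {b}
  | .rset _ _ _ _ => ∅
  | .seq c d => c.natWrites ∪ d.natWrites
  | .ite _ c d => c.natWrites ∪ d.natWrites
  | .loop _ c => c.natWrites

/-- The numbers of the arrays of real numbers that a program may change. -/
def Program.realWrites : Program → Finset ℕ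
  | .skip => ∅
  | .nset _ _ _ _ => ∅
  | .rset b _ _ _ => {b}
  | .seq c d => c.realWrites ∪ d.realWrites
  | .ite _ c d => c.realWrites ∪ d.realWrites
  | .loop _ c => c.realWrites

/-- The states `σ` and `τ` agree on all arrays that `c` does not write. -/
def Unchanged (c : Program) (σ τ : State) : Prop :=
  (∀ b ∉ c.natWrites, τ.nat b = σ.nat b) ∧ ∀ b ∉ c.realWrites, τ.real b = σ.real b

theorem Unchanged.refl (c : Program) (σ : State) : Unchanged c σ σ :=
  ⟨fun _ _ => rfl, fun _ _ => rfl⟩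

theorem Unchanged.trans {υ : State} (h : Unchanged c σ τ) (h' : Unchanged c τ υ) :
    Unchanged c σ υ :=
  ⟨fun b hb => (h'.1 b hb).trans (h.1 b hb), fun b hb => (h'.2 b hb).trans (h.2 b hb)⟩

theorem Unchanged.mono (h : Unchanged c σ τ) (hn : c.natWrites ⊆ d.natWrites)
    (hr : c.realWrites ⊆ d.realWrites) : Unchanged d σ τ :=
  ⟨fun b hb => h.1 b fun h' => hb (hn h'), fun b hb => h.2 b fun h' => hb (hr h')⟩

/-- A frame rule read off from the program text. Postconditions then need to mention only what is
new. -/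
theorem Exec.unchanged (h : Exec W c σ T τ) : Unchanged c σ τ := by
  induction h with
  | skip σ => exact .refl _ _
  | nset b i j e σ h =>
    refine ⟨fun b' hb => ?_, fun _ _ => rfl⟩
    have : b' ≠ b := by simpa [Program.natWrites] using hb
    funext i' j'
    simp [State.setNat, this]
  | rset b i j e σ h =>
    refine ⟨fun _ _ => rfl, fun b' hb => ?_⟩
    have : b' ≠ b := by simpa [Program.realWrites] using hb
    funext i' j'
    simp [State.setReal, this]
  | seq c d σ τ υ T U hc hd ihc ihd =>
    exact (ihc.mono Finset.subset_union_left Finset.subset_union_left).trans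
      (ihd.mono Finset.subset_union_right Finset.subset_union_right)
  | ite_true b c d σ τ T hb hc ih =>
    exact ih.mono Finset.subset_union_left Finset.subset_union_left
  | ite_false b c d σ τ T hb hc ih =>
    exact ih.mono Finset.subset_union_right Finset.subset_union_right
  | loop_true b c σ τ υ T U hb hc hl ihc ihl => exact Unchanged.trans ihc ihl
  | loop_false b c σ hb => exact .refl _ _

/-- Started in `σ`, the program `c` halts after at most `T` steps in a state that satisfies `Q`, and
it writes only to cells in `W`. -/
def Runs (W : Finset Cell) (c : Program) (σ : State) (T : ℕ) (Q : State → Prop) : Prop :=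
  ∃ T' τ, Exec W c σ T' τ ∧ T' ≤ T ∧ Q τ

theorem Runs.mono (h : Runs W c σ T Q) (hT : T ≤ U) (hQ : ∀ τ, Q τ → R τ) : Runs W c σ U R := by
  obtain ⟨T', τ, h1, h2, h3⟩ := h
  exact ⟨T', τ, h1, h2.trans hT, hQ τ h3⟩

theorem Runs.skip (h : Q σ) (hT : 1 ≤ T) : Runs W .skip σ T Q := ⟨1, σ, .skip σ, hT, h⟩

theorem Runs.nset {b : ℕ} {i j e : NExpr} (hW : Sum.inl (b, i.eval σ, j.eval σ) ∈ W)
    (hT : i.cost + j.cost + e.cost + 1 ≤ T)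
    (h : Q (σ.setNat b (i.eval σ) (j.eval σ) (e.eval σ))) : Runs W (.nset b i j e) σ T Q :=
  ⟨_, _, .nset b i j e σ hW, hT, h⟩

theorem Runs.rset {b : ℕ} {i j : NExpr} {e : RExpr} (hW : Sum.inr (b, i.eval σ, j.eval σ) ∈ W)
    (hT : i.cost + j.cost + e.cost + 1 ≤ T)
    (h : Q (σ.setReal b (i.eval σ) (j.eval σ) (e.eval σ))) : Runs W (.rset b i j e) σ T Q :=
  ⟨_, _, .rset b i j e σ hW, hT, h⟩

theorem Runs.seq (hc : Runs W c σ T R) (hd : ∀ τ, Unchanged c σ τ → R τ → Runs W d τ U Q) :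
    Runs W (.seq c d) σ (T + U) Q := by
  obtain ⟨T', τ, h1, h2, h3⟩ := hc
  obtain ⟨U', υ, h4, h5, h6⟩ := hd τ h1.unchanged h3
  exact ⟨_, υ, .seq c d σ τ υ T' U' h1 h4, Nat.add_le_add h2 h5, h6⟩

theorem Runs.ite {b : Test} (hc : b.holds σ → Runs W c σ T Q) (hd : ¬ b.holds σ → Runs W d σ T Q) :
    Runs W (.ite b c d) σ (b.cost + T) Q := by
  by_cases hb : b.holds σ
  · obtain ⟨T', τ, h1, h2, h3⟩ := hc hb
    exact ⟨_, τ, .ite_true b c d σ τ T' hb h1, Nat.add_le_add_left h2 _, h3⟩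
  · obtain ⟨T', τ, h1, h2, h3⟩ := hd hb
    exact ⟨_, τ, .ite_false b c d σ τ T' hb h1, Nat.add_le_add_left h2 _, h3⟩

/-- The cell `(0, 0)` of an array of natural numbers, used as a variable. -/
abbrev nvar (b : ℕ) : NExpr := .get b (.const 0) (.const 0)

/-- The cell `(0, 0)` of an array of real numbers, used as a variable. -/
abbrev rvar (b : ℕ) : RExpr := .get b (.const 0) (.const 0)

/-- Run `c` for the values `0, 1, …, e - 1` of the variable `v`. -/
def forLoop (v : ℕ) (e : NExpr) (c : Program) : Program :=
  .seq (.nset v (.const 0) (.const 0) (.const 0))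
    (.loop (.neg (.nle e (nvar v)))
      (.seq c (.nset v (.const 0) (.const 0) (.add (nvar v) (.const 1)))))

theorem natWrites_forLoop (v : ℕ) (e : NExpr) (c : Program) :
    (forLoop v e c).natWrites = insert v c.natWrites := by
  ext b
  simp [forLoop, Program.natWrites]

theorem realWrites_forLoop (v : ℕ) (e : NExpr) (c : Program) :
    (forLoop v e c).realWrites = c.realWrites := by
  simp [forLoop, Program.realWrites]

theorem unchanged_setNat {v i j k : ℕ} (h : v ∈ c.natWrites) :
    Unchanged c σ (σ.setNat v i j k) := by
  refine ⟨fun b hb => ?_, fun _ _ => rfl⟩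
  have : b ≠ v := fun h' => hb (h' ▸ h)
  funext i' j'
  simp [State.setNat, this]

/-- Induction on the number of remaining rounds. A round costs `K` for the body, `e.cost + 5` for
the test and `8` for the increment; the initial assignment costs `4` and the failing test again
`e.cost + 5`. By `hI` the invariant ignores the loop variable, so the updates of that variable
preserve it. -/
theorem Runs.forLoop {v : ℕ} {e : NExpr} {I : ℕ → State → Prop} {N K : ℕ}
    (hW : Sum.inl (v, 0, 0) ∈ W) (hv : v ∉ c.natWrites)
    (hI : ∀ k τ j, I k τ → I k (τ.setNat v 0 0 j)) (h0 : I 0 σ)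
    (he : ∀ τ, Unchanged (forLoop v e c) σ τ → e.eval τ = N)
    (hc : ∀ k < N, ∀ τ, Unchanged (forLoop v e c) σ τ → τ.nat v 0 0 = k → I k τ →
      Runs W c τ K (I (k + 1))) :
    Runs W (forLoop v e c) σ (N * (K + e.cost + 13) + e.cost + 9) (I N) := by
  have key : ∀ m k, k + m = N → ∀ τ, Unchanged (Machine.forLoop v e c) σ τ → τ.nat v 0 0 = k →
      I k τ → Runs W (.loop (.neg (.nle e (nvar v)))
        (.seq c (.nset v (.const 0) (.const 0) (.add (nvar v) (.const 1))))) τ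
        (m * (K + e.cost + 13) + e.cost + 5) (I N) := by
    intro m
    induction m with
    | zero =>
      intro k hk τ hu hvk hIk
      obtain rfl : k = N := by omega
      refine ⟨_, τ, .loop_false _ _ τ ?_, ?_, hIk⟩
      · simp [Test.holds, NExpr.eval, he τ hu, hvk]
      · simp [Test.cost, NExpr.cost]
    | succ m ih =>
      intro k hk τ hu hvk hIk
      obtain ⟨T1, τ1, h1, h2, h3⟩ := hc k (by omega) τ hu hvk hIk
      have hu1 : Unchanged (Machine.forLoop v e c) σ τ1 :=
        hu.trans (h1.unchanged.mono (by rw [natWrites_forLoop]; exact Finset.subset_insert _ _)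
          (by rw [realWrites_forLoop]))
      have hv1 : τ1.nat v 0 0 = k := by rw [h1.unchanged.1 v hv, hvk]
      obtain ⟨T2, τ2, h4, h5, h6⟩ := ih (k + 1) (by omega) (τ1.setNat v 0 0 (k + 1))
        (hu1.trans (unchanged_setNat (by rw [natWrites_forLoop]; exact Finset.mem_insert_self _ _)))
        (by simp [State.setNat]) (hI _ _ _ h3)
      have h7 : Exec W (.nset v (.const 0) (.const 0) (.add (nvar v) (.const 1))) τ1 8
          (τ1.setNat v 0 0 (k + 1)) := by
        have := Exec.nset (W := W) v (.const 0) (.const 0) (.add (nvar v) (.const 1)) τ1 hW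
        simpa [NExpr.eval, NExpr.cost, hv1] using this
      refine ⟨_, τ2, .loop_true _ _ τ _ τ2 _ T2 ?_ (.seq _ _ _ _ _ _ _ h1 h7) h4, ?_, h6⟩
      · simp only [Test.holds, NExpr.eval, he τ hu, hvk]
        omega
      · simp only [Test.cost, NExpr.cost]
        rw [Nat.succ_mul]
        omega
  obtain ⟨T2, τ2, h4, h5, h6⟩ := key N 0 (by omega) (σ.setNat v 0 0 0)
    (unchanged_setNat (by rw [natWrites_forLoop]; exact Finset.mem_insert_self _ _))
    (by simp [State.setNat]) (hI _ _ _ h0)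
  refine ⟨_, τ2, .seq _ _ _ _ _ _ _ (.nset v (.const 0) (.const 0) (.const 0) σ hW) h4, ?_, h6⟩
  simp only [NExpr.cost]
  omega

/-- Lower a real cell to the value of `e` if it is larger. -/
def lower (b : ℕ) (i j : NExpr) (e : RExpr) : Program :=
  .ite (.rle (.get b i j) e) .skip (.rset b i j e)

theorem setReal_self (σ : State) (b i j : ℕ) : σ.setReal b i j (σ.real b i j) = σ := by
  unfold State.setReal
  congr 1
  funext b' i' j'
  split_ifs with h
  · rw [h.1, h.2.1, h.2.2]
  · rfl

/-- Both branches amount to storing the minimum, because rewriting a cell with its own value changes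
nothing. -/
theorem Runs.lower {b : ℕ} {i j : NExpr} {e : RExpr} (hW : Sum.inr (b, i.eval σ, j.eval σ) ∈ W)
    (hT : 2 * (i.cost + j.cost + e.cost + 2) ≤ T)
    (h : Q (σ.setReal b (i.eval σ) (j.eval σ) (min (σ.real b (i.eval σ) (j.eval σ)) (e.eval σ)))) :
    Runs W (lower b i j e) σ T Q := by
  refine (Runs.ite (T := i.cost + j.cost + e.cost + 1) (Q := Q) (fun hb => ?_) fun hb => ?_).mono ?_
    fun _ h => h
  · refine Runs.skip ?_ (by omega)
    have hb' : σ.real b (i.eval σ) (j.eval σ) ≤ e.eval σ := hb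
    rw [min_eq_left hb', setReal_self] at h
    exact h
  · refine Runs.rset hW le_rfl ?_
    have hb' : ¬ σ.real b (i.eval σ) (j.eval σ) ≤ e.eval σ := hb
    rw [min_eq_right (not_le.1 hb').le] at h
    exact h
  · simp only [Test.cost, RExpr.cost]
    omega

end Machine

/-! ### Common suffixes and numbers of followers. -/

section CommonSuffix

variable {A : Type*}

open Classical in
/-- The length of the longest common suffix of `s.take i` and `s.take j`. -/
noncomputable def lcs (s : List A) : ℕ → ℕ → ℕ
  | 0, _ => 0
  | _ + 1, 0 => 0
  | i + 1, j + 1 => if s[i]? = s[j]? then lcs s i j + 1 else 0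

open Classical in
theorem lcs_succ_succ (s : List A) (i j : ℕ) :
    lcs s (i + 1) (j + 1) = if s[i]? = s[j]? then lcs s i j + 1 else 0 := by
  rw [lcs]

theorem lcs_le_left (s : List A) (i j : ℕ) : lcs s i j ≤ i := by
  induction i generalizing j with
  | zero => simp [lcs]
  | succ i ih =>
    cases j with
    | zero => simp [lcs]
    | succ j =>
      rw [lcs_succ_succ]
      split_ifs
      · exact Nat.succ_le_succ (ih j)
      · exact Nat.zero_le _

/-- The word of length `k` that ends at time `i`. -/
def wordAt (s : List A) (i k : ℕ) : List A := (s.take i).drop (i - k)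

theorem length_wordAt {s : List A} {i k : ℕ} (hk : k ≤ i) (hi : i ≤ s.length) :
    (wordAt s i k).length = k := by
  simp [wordAt]
  omega

theorem wordAt_suffix (s : List A) (i k : ℕ) : wordAt s i k <:+ s.take i := List.drop_suffix _ _

theorem eq_wordAt {s w : List A} {i : ℕ} (hi : i ≤ s.length) (h : w <:+ s.take i) :
    w = wordAt s i w.length := by
  have h4 := List.suffix_iff_eq_drop.1 h
  rw [List.length_take, min_eq_left hi] at h4
  exact h4

/-- Peel off the last letters. A single number thus decides, for all lengths `k` at once, whether
the word that ends at time `i` also ends at time `j`. -/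
theorem le_lcs_iff {s : List A} {i j k : ℕ} (hi : i ≤ s.length) (hj : j ≤ s.length) (hk : k ≤ i) :
    k ≤ lcs s i j ↔ wordAt s i k <:+ s.take j := by
  induction i generalizing j k with
  | zero =>
    obtain rfl : k = 0 := by omega
    simp [wordAt]
  | succ i ih =>
    cases k with
    | zero =>
      have : wordAt s (i + 1) 0 = [] := by
        rw [← List.length_eq_zero_iff, length_wordAt hk hi]
      simp [this]
    | succ k =>
      have hw : wordAt s (i + 1) (k + 1) = wordAt s i k ++ [s[i]] := by
        unfold wordAt
        rw [take_succ_eq_snoc s (by omega), Nat.add_sub_add_right,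
          List.drop_append_of_le_length (by simp; omega)]
      cases j with
      | zero => simp [lcs, hw]
      | succ j =>
        rw [hw, take_succ_eq_snoc s (by omega : j < s.length), snoc_suffix_snoc,
          ← ih (by omega) (by omega) (by omega)]
        have hij : s[i]? = s[j]? ↔ s[i] = s[j] := by
          rw [List.getElem?_eq_getElem (by omega), List.getElem?_eq_getElem (by omega),
            Option.some.injEq]
        rw [lcs_succ_succ, ← hij]
        split_ifs with h <;> simp [h]

/-- The number of occurrences of the word of length `k` that ends at time `i` that are followed by
the letter `a`. -/
noncomputable def followers (s : List A) (i k : ℕ) (a : A) : ℕ := by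
  classical exact
    ((Finset.range s.length).filter (fun j => k ≤ lcs s i j ∧ s[j]? = some a)).card

theorem occ_wordAt_snoc {s : List A} {i k : ℕ} (hi : i < s.length) (hk : k ≤ i) (a : A) :
    occ s s.length (wordAt s i k ++ [a]) = followers s i k a := by
  classical
  rw [occ_snoc_eq_card, followers]
  congr 1
  refine Finset.filter_congr fun j hj => ?_
  rw [le_lcs_iff hi.le (Finset.mem_range.1 hj).le hk]

theorem followers_of_lt {s : List A} {i k : ℕ} (h : i < k) (a : A) : followers s i k a = 0 := by
  classical
  rw [followers, Finset.card_eq_zero, Finset.filter_eq_empty_iff]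
  intro j _ h'
  have := lcs_le_left s i j
  omega

/-- The number of `j < m` such that the longest common suffix of `s.take i` and `s.take j` has
length `k` and is followed by the letter `a` after time `j`. -/
noncomputable def exactFollowers (s : List A) (i m k : ℕ) (a : A) : ℕ := by
  classical exact
    ((Finset.range m).filter (fun j => lcs s i j = k ∧ s[j]? = some a)).card

theorem exactFollowers_zero (s : List A) (i k : ℕ) (a : A) : exactFollowers s i 0 k a = 0 := by
  simp [exactFollowers]

open Classical in
theorem exactFollowers_succ (s : List A) (i m k : ℕ) (a : A) :
    exactFollowers s i (m + 1) k a =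
      exactFollowers s i m k a + if lcs s i m = k ∧ s[m]? = some a then 1 else 0 := by
  unfold exactFollowers
  rw [Finset.range_add_one, Finset.filter_insert]
  split_ifs
  · rw [Finset.card_insert_of_notMem (by simp)]
  · rfl

/-- Splits `k ≤ lcs` into strict inequality and equality. Counts for all lengths then accumulate
from long words to short ones, with one addition per letter and length. -/
theorem followers_eq_add (s : List A) (i k : ℕ) (a : A) :
    followers s i k a = followers s i (k + 1) a + exactFollowers s i s.length k a := by
  classical
  unfold followers exactFollowers
  rw [← Finset.card_union_of_disjoint]
  · congr 1
    ext j
    simp only [Finset.mem_filter, Finset.mem_union]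
    constructor
    · rintro ⟨h1, h2, h3⟩
      rcases h2.eq_or_lt with h | h
      · exact Or.inr ⟨h1, h.symm, h3⟩
      · exact Or.inl ⟨h1, h, h3⟩
    · rintro (⟨h1, h2, h3⟩ | ⟨h1, h2, h3⟩)
      · exact ⟨h1, by omega, h3⟩
      · exact ⟨h1, h2.ge, h3⟩
  · rw [Finset.disjoint_left]
    intro j h1 h2
    have h3 := (Finset.mem_filter.1 h1).2.1
    have h4 := (Finset.mem_filter.1 h2).2.1
    omega

theorem cons_suffix_iff {a : A} {u v : List A} (h : u.length < v.length) :
    a :: u <:+ v ↔ u <:+ v ∧ v[v.length - 1 - u.length]? = some a := by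
  constructor
  · rintro ⟨t, rfl⟩
    refine ⟨⟨t ++ [a], by simp⟩, ?_⟩
    have : (t ++ a :: u).length - 1 - u.length = t.length := by
      simp
    rw [this]
    simp
  · rintro ⟨⟨t, rfl⟩, h2⟩
    rcases List.eq_nil_or_concat' t with rfl | ⟨t', b, rfl⟩
    · simp at h
    · have h3 : (t' ++ [b] ++ u).length - 1 - u.length = t'.length := by
        simp
      rw [h3] at h2
      simp at h2
      exact ⟨t', by simp [h2]⟩

/-- The past is matched backwards in time: its letter number `k` meets the letter `k` places before
the last letter of `X₁ … Xᵢ`. -/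
theorem lastWord_succ_suffix_take {s : List A} {x : Past A} {i k : ℕ} (hi : i ≤ s.length)
    (hk : k < i) :
    lastWord x (k + 1) <:+ s.take i ↔ lastWord x k <:+ s.take i ∧ s[i - 1 - k]? = some (x k) := by
  have hl : (s.take i).length = i := by simp [hi]
  rw [lastWord_succ, cons_suffix_iff (by simp; omega), hl, length_lastWord, List.getElem?_take,
    if_pos (by omega)]

end CommonSuffix

/-! ### Empirical minorants as finite minima. -/

section EmpiricalMinorant

variable {A : Type*} [Fintype A] [Nonempty A] {s : List A} {δ : ℝ}

theorem sum_followers {i k : ℕ} (hi : i < s.length) (hk : k ≤ i) :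
    ∑ a, followers s i k a = occPred s (wordAt s i k) := by
  rw [← sum_occ_snoc (List.ne_nil_of_length_pos (by omega))]
  exact Finset.sum_congr rfl fun a _ => (occ_wordAt_snoc hi hk a).symm

theorem occPred_wordAt_pos {i k : ℕ} (hi : i < s.length) : 0 < occPred s (wordAt s i k) := by
  classical
  rw [occPred_eq_card (List.ne_nil_of_length_pos (by omega)), Finset.card_pos]
  exact ⟨i, Finset.mem_filter.2 ⟨Finset.mem_range.2 hi, wordAt_suffix s i k⟩⟩

/-- The upper confidence bound at the word of length `k` that ends at time `i`. -/
noncomputable def upperBound (s : List A) (δ : ℝ) (a : A) (i k : ℕ) : ℝ :=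
  empP s a (wordAt s i k) + conf s δ a (wordAt s i k)

/-- The empirical minorants are minima over the words that occur in the sample and one word that
does not. -/
theorem le_empMinorant_lastWord_iff (hs : s ≠ []) (h0 : 0 < δ) (h1 : δ < 1) {a : A} {x : Past A}
    {k : ℕ} {y : ℝ} :
    y ≤ empMinorant s δ a (lastWord x k) ↔ y ≤ 1 / Fintype.card A + 1 ∧
      ∀ i < s.length, ∀ l, k ≤ l → l ≤ i → lastWord x k <:+ s.take i →
        y ≤ upperBound s δ a i l := by
  classical
  rw [le_empMinorant_iff hs h0 h1]
  have hunseen : ∀ v, occPred s v = 0 → empP s a v + conf s δ a v = 1 / Fintype.card A + 1 := by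
    intro v hv
    simp [empP, conf, hv]
  constructor
  · intro h
    refine ⟨?_, fun i hi l hkl hli hx => h _ ?_⟩
    -- A representative of the unseen words: too long to occur, yet an extension of the last `k`
    -- letters.
    · have h2 := h (lastWord x (max k s.length)) (lastWord_suffix x (le_max_left _ _))
      rwa [hunseen _ (occPred_eq_zero_of_length_le hs (by simp))] at h2
    · exact List.suffix_of_suffix_length_le hx (wordAt_suffix s i l)
        (by rw [length_wordAt hli hi.le, length_lastWord]; exact hkl)
  · rintro ⟨h2, h3⟩ v hv
    rcases Nat.eq_zero_or_pos (occPred s v) with h | h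
    · rwa [hunseen v h]
    · rw [occPred_eq_card hs, gt_iff_lt, Finset.card_pos] at h
      obtain ⟨i, hi⟩ := h
      rw [Finset.mem_filter, Finset.mem_range] at hi
      have h4 := eq_wordAt hi.1.le hi.2
      have h5 := hi.2.length_le
      have h6 := hv.length_le
      rw [List.length_take] at h5
      rw [length_lastWord] at h6
      rw [h4]
      exact h3 i hi.1 v.length h6 (by omega) (hv.trans hi.2)

end EmpiricalMinorant

/-! ### Rules for an assignment followed by a program. -/

namespace Machine

variable {W : Finset Cell} {c d : Program} {σ τ : State} {T U : ℕ} {Q R : State → Prop}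

theorem Runs.and_unchanged (h : Runs W c σ T Q) :
    Runs W c σ T fun τ => Unchanged c σ τ ∧ Q τ := by
  obtain ⟨T', τ, h1, h2, h3⟩ := h
  exact ⟨T', τ, h1, h2, h1.unchanged, h3⟩

/-- After an assignment the new state is known exactly, so the rest can be run from it instead of
from an arbitrary state with a postcondition. -/
theorem Runs.nset_seq {b : ℕ} {i j e : NExpr} (U : ℕ)
    (hW : Sum.inl (b, i.eval σ, j.eval σ) ∈ W) (hT : i.cost + j.cost + e.cost + 1 + U ≤ T)
    (h : Runs W d (σ.setNat b (i.eval σ) (j.eval σ) (e.eval σ)) U Q) :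
    Runs W (.seq (.nset b i j e) d) σ T Q :=
  (Runs.seq (R := fun τ => τ = σ.setNat b (i.eval σ) (j.eval σ) (e.eval σ))
    (.nset hW le_rfl rfl) fun _ _ h' => h' ▸ h).mono hT fun _ h => h

theorem Runs.rset_seq {b : ℕ} {i j : NExpr} {e : RExpr} (U : ℕ)
    (hW : Sum.inr (b, i.eval σ, j.eval σ) ∈ W) (hT : i.cost + j.cost + e.cost + 1 + U ≤ T)
    (h : Runs W d (σ.setReal b (i.eval σ) (j.eval σ) (e.eval σ)) U Q) :
    Runs W (.seq (.rset b i j e) d) σ T Q :=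
  (Runs.seq (R := fun τ => τ = σ.setReal b (i.eval σ) (j.eval σ) (e.eval σ))
    (.rset hW le_rfl rfl) fun _ _ h' => h' ▸ h).mono hT fun _ h => h

theorem Runs.lower_seq {b : ℕ} {i j : NExpr} {e : RExpr} (U : ℕ)
    (hW : Sum.inr (b, i.eval σ, j.eval σ) ∈ W)
    (hT : 2 * (i.cost + j.cost + e.cost + 2) + U ≤ T)
    (h : Runs W d (σ.setReal b (i.eval σ) (j.eval σ)
      (min (σ.real b (i.eval σ) (j.eval σ)) (e.eval σ))) U Q) :
    Runs W (.seq (Machine.lower b i j e) d) σ T Q :=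
  (Runs.seq (R := fun τ => τ = σ.setReal b (i.eval σ) (j.eval σ)
      (min (σ.real b (i.eval σ) (j.eval σ)) (e.eval σ)))
    (.lower hW le_rfl rfl) fun _ _ h' => h' ▸ h).mono hT fun _ h => h

/-- The constant `k` as a real expression. -/
abbrev rconst (k : ℕ) : RExpr := .ofNat (.const k)

/-- The test `e = f`. -/
abbrev Test.neq (e f : NExpr) : Test := .conj (.nle e f) (.nle f e)

end Machine

/-! ### The program and the cells it may write. -/

namespace Estimation

open Machine

/-! The program.  The variables (arrays of natural numbers) are `4` for the end time `i` of a word,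
`5` for another end time `j`, `6` for a length `k`, `7` for a letter, `8` for the length of the
longest common suffix of the past and `X₁ … Xᵢ`, `9` for a number of occurrences, `10` for the
truncation point and `11` for `i - k`.  Array `20` holds on its diagonals the lengths of common
suffixes, arrays `21` and `22` hold numbers of followers.  Array `3` of real numbers holds the
empirical minorants of order `k` in row `k + 1`, array `4` running minima of upper bounds. -/

/-- The threshold `t_*`. -/
def setThreshold : Program :=
  .rset 2 (.const 0) (.const 0) (.log (.div (.mul (.mul (.ofNat (nvar 0))
    (.add (rconst 14) (.mul (rconst 2) (.div (.log (.ofNat (nvar 1))) (.log (rconst 2))))))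
    (.add (rconst 1) (.div (.mul (.ofNat (nvar 1)) (.sub (.ofNat (nvar 1)) (rconst 1)))
      (rconst 2)))) (rvar 0)))

/-- The upper bound at words that do not occur. -/
def unseen : RExpr := .add (.div (rconst 1) (.ofNat (nvar 0))) (rconst 1)

/-- Initialise the empirical minorants. -/
def initMinorants : Program :=
  forLoop 6 (.add (nvar 1) (.const 1))
    (forLoop 7 (nvar 0) (.rset 3 (.add (nvar 6) (.const 1)) (nvar 7) unseen))

/-- The index of the diagonal of `(i, j)`. -/
def diag : NExpr := .sub (.add (nvar 1) (nvar 5)) (nvar 4)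

/-- A letter of the sample. -/
abbrev letter (e : NExpr) : NExpr := .get 2 e (.const 0)

/-- Update the lengths of the common suffixes of `X₁ … Xᵢ` and `X₁ … Xⱼ`. -/
def updateSuffixes : Program :=
  forLoop 5 (nvar 1)
    (.ite (.conj (.conj (.neg (.nle (nvar 4) (.const 0))) (.neg (.nle (nvar 5) (.const 0))))
        (.neq (letter (.sub (nvar 4) (.const 1))) (letter (.sub (nvar 5) (.const 1)))))
      (.nset 20 diag (.const 0) (.add (.get 20 diag (.const 0)) (.const 1)))
      (.nset 20 diag (.const 0) (.const 0)))

/-- Compute the length of the longest common suffix of the past and `X₁ … Xᵢ`. -/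
def matchPast : Program :=
  .seq (.nset 8 (.const 0) (.const 0) (.const 0))
    (forLoop 6 (nvar 4)
      (.ite (.conj (.neq (nvar 8) (nvar 6))
          (.neq (letter (.sub (.sub (nvar 4) (.const 1)) (nvar 6))) (.get 3 (nvar 6) (.const 0))))
        (.nset 8 (.const 0) (.const 0) (.add (nvar 8) (.const 1)))
        .skip))

/-- Clear the numbers of followers. -/
def clearCounts : Program :=
  forLoop 6 (nvar 1) (forLoop 7 (nvar 0) (.nset 21 (nvar 6) (nvar 7) (.const 0)))

/-- Count the followers by the lengths of the common suffixes. -/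
def fillCounts : Program :=
  forLoop 5 (nvar 1) (.nset 21 (.get 20 diag (.const 0)) (letter (nvar 5))
    (.add (.get 21 (.get 20 diag (.const 0)) (letter (nvar 5))) (.const 1)))

/-- Initialise the accumulators for the words that end at time `i`. -/
def clearAccumulators : Program :=
  forLoop 7 (nvar 0) (.seq (.nset 22 (nvar 7) (.const 0) (.const 0))
    (.rset 4 (nvar 7) (.const 0) unseen))

/-- The current word length `k`. -/
abbrev len : NExpr := .sub (nvar 4) (nvar 11)

/-- The numbers of followers of the word of length `k` that ends at time `i`. -/
def accumulate : Program :=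
  .seq (.nset 9 (.const 0) (.const 0) (.const 0))
    (forLoop 7 (nvar 0)
      (.seq (.nset 22 (nvar 7) (.const 0)
          (.add (.get 22 (nvar 7) (.const 0)) (.get 21 len (nvar 7))))
        (.nset 9 (.const 0) (.const 0) (.add (nvar 9) (.get 22 (nvar 7) (.const 0))))))

/-- The confidence radius before truncation. -/
def radius : RExpr :=
  .add (.mul (.add (.mul (rconst 2) (.sqrt (rconst 2))) (rconst 2))
      (.sqrt (.div (.mul (rvar 6) (rvar 2)) (.ofNat (nvar 9)))))
    (.mul (.add (rconst 3) (.mul (rconst 2) (.sqrt (rconst 2))))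
      (.div (rvar 2) (.ofNat (nvar 9))))

/-- Lower the minima by the upper bounds at the word of length `k` that ends at time `i`. -/
def lowerMinorants : Program :=
  forLoop 7 (nvar 0)
    (.seq (.rset 6 (.const 0) (.const 0)
        (.div (.ofNat (.get 22 (nvar 7) (.const 0))) (.ofNat (nvar 9))))
      (.seq (.rset 7 (.const 0) (.const 0) radius)
        (.seq (lower 7 (.const 0) (.const 0) (rconst 1))
          (.seq (.rset 7 (.const 0) (.const 0) (.add (rvar 6) (rvar 7)))
            (.seq (lower 4 (nvar 7) (.const 0) (rvar 7))
              (.ite (.nle len (nvar 8))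
                (lower 3 (.add len (.const 1)) (nvar 7) (.get 4 (nvar 7) (.const 0)))
                .skip))))))

/-- Treat the words that end at time `i`, by decreasing length. -/
def scanWords : Program :=
  forLoop 11 (.add (nvar 4) (.const 1)) (.seq accumulate lowerMinorants)

/-- Treat all words. -/
def scanSample : Program :=
  forLoop 4 (nvar 1) (.seq updateSuffixes (.seq matchPast (.seq clearCounts
    (.seq fillCounts (.seq clearAccumulators scanWords)))))

/-- Set the row of the empirical minorants of order `-1` to zero. -/
def clearFirstRow : Program :=
  forLoop 7 (nvar 0) (.rset 3 (.const 0) (nvar 7) (rconst 0))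

/-- Compute the truncation point. -/
def findTruncation : Program :=
  .seq (.nset 10 (.const 0) (.const 0) (.const 0))
    (forLoop 6 (nvar 1)
      (.seq (.rset 5 (.const 0) (.const 0) (rconst 0))
        (.seq (forLoop 7 (nvar 0) (.rset 5 (.const 0) (.const 0)
            (.add (rvar 5) (.get 3 (.add (nvar 6) (.const 1)) (nvar 7)))))
          (.ite (.rle (rconst 1) (rvar 5)) .skip
            (.nset 10 (.const 0) (.const 0) (.add (nvar 6) (.const 1)))))))

/-- The last two empirical minorants. -/
abbrev prevM : RExpr := .get 3 (nvar 10) (nvar 7)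

/-- The increment between the last two empirical minorants. -/
abbrev increment : RExpr := .sub (.get 3 (.add (nvar 10) (.const 1)) (nvar 7)) prevM

/-- Compute the estimator from the last two empirical minorants. -/
def writeOutput : Program :=
  .seq (.rset 5 (.const 0) (.const 0) (rconst 0))
    (.seq (.rset 7 (.const 0) (.const 0) (rconst 0))
      (.seq (forLoop 7 (nvar 0)
          (.seq (.rset 5 (.const 0) (.const 0) (.add (rvar 5) prevM))
            (.rset 7 (.const 0) (.const 0) (.add (rvar 7) increment))))
        (forLoop 7 (nvar 0) (.rset 1 (nvar 7) (.const 0)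
          (.add prevM (.mul (.sub (rconst 1) (rvar 5)) (.div increment (rvar 7))))))))

/-- The program that computes the estimator. -/
def estimate : Program :=
  .seq setThreshold (.seq initMinorants (.seq scanSample (.seq clearFirstRow
    (.seq findTruncation writeOutput))))

/-- The memory cells that the program uses. -/
def cells (d n : ℕ) : Finset Cell :=
  (((Finset.range 12 ×ˢ ({0} ×ˢ {0})) ∪ ({20} ×ˢ (Finset.range (2 * n) ×ˢ {0}))) ∪
    (({21} ×ˢ (Finset.range n ×ˢ Finset.range d)) ∪ ({22} ×ˢ (Finset.range d ×ˢ {0})))).disjSum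
  (((Finset.range 12 ×ˢ ({0} ×ˢ {0})) ∪ ({1} ×ˢ (Finset.range d ×ˢ {0}))) ∪
    (({3} ×ˢ (Finset.range (n + 2) ×ˢ Finset.range d)) ∪ ({4} ×ˢ (Finset.range d ×ˢ {0}))))

variable {d n : ℕ}

/-- The arrays add up to `24 + 2n + 2dn + 5d` cells. The suffix lengths take only `2n` of these,
because one value per diagonal is kept. -/
theorem card_cells_le (hd : 1 ≤ d) (hn : 1 ≤ n) : (cells d n).card ≤ 40 * d * n := by
  unfold cells
  rw [Finset.card_disjSum]
  have key : ∀ s t u v : Finset (ℕ × ℕ × ℕ),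
      ((s ∪ t) ∪ (u ∪ v)).card ≤ s.card + t.card + (u.card + v.card) := fun s t u v =>
    (Finset.card_union_le _ _).trans
      (Nat.add_le_add (Finset.card_union_le _ _) (Finset.card_union_le _ _))
  refine (Nat.add_le_add (key _ _ _ _) (key _ _ _ _)).trans ?_
  simp only [Finset.card_product, Finset.card_range, Finset.card_singleton]
  nlinarith [Nat.mul_le_mul hd hn, Nat.mul_le_mul_left d hn, Nat.mul_le_mul_right n hd]

theorem mem_nvar {b : ℕ} (hb : b < 12) : Sum.inl (b, 0, 0) ∈ cells d n := by
  simp [cells, hb]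

theorem mem_rvar {b : ℕ} (hb : b < 12) : Sum.inr (b, 0, 0) ∈ cells d n := by
  simp [cells, hb]

theorem mem_diag {j : ℕ} (hj : j < 2 * n) : Sum.inl (20, j, 0) ∈ cells d n := by
  simp [cells, hj]

theorem mem_count {k a : ℕ} (hk : k < n) (ha : a < d) : Sum.inl (21, k, a) ∈ cells d n := by
  simp [cells, hk, ha]

theorem mem_acc {a : ℕ} (ha : a < d) : Sum.inl (22, a, 0) ∈ cells d n := by
  simp [cells, ha]

theorem mem_out {a : ℕ} (ha : a < d) : Sum.inr (1, a, 0) ∈ cells d n := by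
  simp [cells, ha]

theorem mem_minorant {k a : ℕ} (hk : k < n + 2) (ha : a < d) : Sum.inr (3, k, a) ∈ cells d n := by
  simp [cells, hk, ha]

theorem mem_minimum {a : ℕ} (ha : a < d) : Sum.inr (4, a, 0) ∈ cells d n := by
  simp [cells, ha]

end Estimation

-- The recursion in the form in which the program tests it, with truncated predecessors.
open Classical in
theorem lcs_eq_ite {A : Type*} (s : List A) (i j : ℕ) :
    lcs s i j =
      if (0 < i ∧ 0 < j) ∧ s[i - 1]? = s[j - 1]? then lcs s (i - 1) (j - 1) + 1 else 0 := by
  cases i with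
  | zero => simp [lcs]
  | succ i =>
    cases j with
    | zero => simp [lcs]
    | succ j => simp [lcs_succ_succ]

/-! ### Correctness of the tables for one end time. -/

namespace Estimation

open Machine

variable {A : Type*} [Fintype A]

/-- The state holds the input of the estimation problem. -/
structure HoldsInput (e : A ≃ Fin (Fintype.card A)) (s : List A) (δ : ℝ) (x : Past A)
    (σ : State) : Prop where
  card : σ.nat 0 0 0 = Fintype.card A
  size : σ.nat 1 0 0 = s.length
  sample : ∀ j a, s[j]? = some a → σ.nat 2 j 0 = e a
  past : ∀ k < s.length, σ.nat 3 k 0 = e (x k)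
  level : σ.real 0 0 0 = δ

variable {e : A ≃ Fin (Fintype.card A)} {s : List A} {δ : ℝ} {x : Past A} {σ τ : State}

theorem HoldsInput.of_unchanged {c : Program} (h : HoldsInput e s δ x σ) (hu : Unchanged c σ τ)
    (hn : ∀ b < 4, b ∉ c.natWrites) (hr : 0 ∉ c.realWrites) : HoldsInput e s δ x τ where
  card := by rw [hu.1 0 (hn 0 (by norm_num)), h.card]
  size := by rw [hu.1 1 (hn 1 (by norm_num)), h.size]
  sample j a hj := by rw [hu.1 2 (hn 2 (by norm_num)), h.sample j a hj]
  past k hk := by rw [hu.1 3 (hn 3 (by norm_num)), h.past k hk]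
  level := by rw [hu.2 0 hr, h.level]

theorem HoldsInput.sample_eq_iff (h : HoldsInput e s δ x σ) {j k : ℕ} (hj : j < s.length)
    (hk : k < s.length) : σ.nat 2 j 0 = σ.nat 2 k 0 ↔ s[j]? = s[k]? := by
  rw [h.sample j _ (List.getElem?_eq_getElem hj), h.sample k _ (List.getElem?_eq_getElem hk),
    List.getElem?_eq_getElem hj, List.getElem?_eq_getElem hk]
  simp [Fin.val_inj]

theorem HoldsInput.sample_eq_past_iff (h : HoldsInput e s δ x σ) {j k : ℕ} (hj : j < s.length)
    (hk : k < s.length) : σ.nat 2 j 0 = σ.nat 3 k 0 ↔ s[j]? = some (x k) := by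
  rw [h.sample j _ (List.getElem?_eq_getElem hj), h.past k hk, List.getElem?_eq_getElem hj]
  simp [Fin.val_inj]

/-- The cell of the diagonal `n + j - i` holds the value for `(i - 1, j - 1)` until the value for
`(i, j)` replaces it. Different `j` use different cells, so the update works in place. -/
theorem runs_updateSuffixes {i : ℕ} (h : HoldsInput e s δ x σ) (hi : σ.nat 4 0 0 = i)
    (hin : i < s.length)
    (hD : ∀ j, 0 < i → 0 < j → j < s.length →
      σ.nat 20 (s.length + j - i) 0 = lcs s (i - 1) (j - 1)) :
    Runs (cells (Fintype.card A) s.length) updateSuffixes σ (300 * s.length)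
      fun τ => ∀ j < s.length, τ.nat 20 (s.length + j - i) 0 = lcs s i j := by
  classical
  refine (Runs.forLoop (N := s.length) (K := 200)
    (I := fun m τ => (∀ j < m, τ.nat 20 (s.length + j - i) 0 = lcs s i j) ∧
      ∀ j, m ≤ j → 0 < i → 0 < j → j < s.length →
        τ.nat 20 (s.length + j - i) 0 = lcs s (i - 1) (j - 1))
    (mem_nvar (by norm_num)) (by decide) ?_ ?_ ?_ ?_).mono ?_ ?_
  · intro k τ j hI
    simpa [State.setNat] using hI
  · exact ⟨fun j hj => absurd hj (Nat.not_lt_zero j), fun j _ => hD j⟩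
  · intro τ hu
    simp [NExpr.eval, hu.1 1 (by decide), h.size]
  · intro j hj τ hu hjv ⟨h1, h2⟩
    have h' := h.of_unchanged hu (by decide) (by decide)
    have hi' : τ.nat 4 0 0 = i := by rw [hu.1 4 (by decide), hi]
    have hd : diag.eval τ = s.length + j - i := by
      simp [diag, NExpr.eval, h'.size, hjv, hi']
    have hW : Sum.inl (20, diag.eval τ, (NExpr.const 0).eval τ) ∈
        cells (Fintype.card A) s.length := by
      simp only [hd, NExpr.eval]
      exact mem_diag (by omega)
    have key : ∀ v, v = lcs s i j →
        (∀ j' < j + 1, (τ.setNat 20 (diag.eval τ) 0 v).nat 20 (s.length + j' - i) 0 = lcs s i j') ∧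
        ∀ j', j + 1 ≤ j' → 0 < i → 0 < j' → j' < s.length →
          (τ.setNat 20 (diag.eval τ) 0 v).nat 20 (s.length + j' - i) 0 =
            lcs s (i - 1) (j' - 1) := by
      rintro v rfl
      simp only [hd, State.setNat, true_and, and_true]
      constructor
      · intro j' hj'
        split_ifs with h3
        · rw [show j' = j by omega]
        · exact h1 j' (by omega)
      · intro j' h3 h4 h5 h6
        rw [if_neg (by omega)]
        exact h2 j' (by omega) h4 h5 h6
    have htest : ∀ t : Test, t = .conj (.conj (.neg (.nle (nvar 4) (.const 0)))
        (.neg (.nle (nvar 5) (.const 0)))) (.neq (letter (.sub (nvar 4) (.const 1)))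
          (letter (.sub (nvar 5) (.const 1)))) →
        (t.holds τ ↔ (0 < i ∧ 0 < j) ∧ s[i - 1]? = s[j - 1]?) := by
      rintro t rfl
      rw [← h'.sample_eq_iff (by omega) (by omega)]
      simp only [Test.holds, NExpr.eval, hi', hjv]
      omega
    refine (Runs.ite (T := 100) (fun hb => Runs.nset hW (by decide) ?_)
      (fun hb => Runs.nset hW (by decide) ?_)).mono (by decide) fun _ h => h
    · rw [htest _ rfl] at hb
      refine key _ ?_
      rw [lcs_eq_ite, if_pos hb, ← h2 j le_rfl hb.1.1 hb.1.2 hj]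
      simp [NExpr.eval, hd]
    · rw [htest _ rfl] at hb
      refine key _ ?_
      rw [lcs_eq_ite, if_neg hb]
      rfl
  · simp only [NExpr.cost]
    omega
  · exact fun τ hI => hI.1

/-- The counter keeps up with the loop variable while all letters match. At the first mismatch it
falls behind and never grows again. -/
theorem runs_matchPast {i : ℕ} (h : HoldsInput e s δ x σ) (hi : σ.nat 4 0 0 = i)
    (hin : i < s.length) :
    Runs (cells (Fintype.card A) s.length) matchPast σ (300 * s.length)
      fun τ => ∀ k ≤ i, k ≤ τ.nat 8 0 0 ↔ lastWord x k <:+ s.take i := by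
  refine Runs.nset_seq (290 * s.length) (mem_nvar (by norm_num)) ?_ ?_
  · simp only [NExpr.cost]
    omega
  simp only [NExpr.eval]
  refine (Runs.forLoop (N := i) (K := 200)
    (I := fun m τ => τ.nat 8 0 0 ≤ m ∧ ∀ k ≤ m, k ≤ τ.nat 8 0 0 ↔ lastWord x k <:+ s.take i)
    (mem_nvar (by norm_num)) (by decide) ?_ ?_ ?_ ?_).mono ?_ ?_
  · intro k τ j hI
    simpa [State.setNat] using hI
  · simp [State.setNat]
  · intro τ hu
    simp [NExpr.eval, hu.1 4 (by decide), State.setNat, hi]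
  · intro k hk τ hu hkv ⟨h1, h2⟩
    have h' : HoldsInput e s δ x τ := by
      refine HoldsInput.of_unchanged (c := matchPast) h ?_ (by decide) (by decide)
      exact (unchanged_setNat (by decide)).trans (hu.mono (by decide) (by decide))
    have hi' : τ.nat 4 0 0 = i := by simp [hu.1 4 (by decide), State.setNat, hi]
    have hstep := lastWord_succ_suffix_take (x := x) hin.le hk
    have hlet := h'.sample_eq_past_iff (j := i - 1 - k) (k := k) (by omega) (by omega)
    have htest : ∀ t : Test, t = .conj (.neq (nvar 8) (nvar 6))
          (.neq (letter (.sub (.sub (nvar 4) (.const 1)) (nvar 6)))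
            (.get 3 (nvar 6) (.const 0))) →
        (t.holds τ ↔ τ.nat 8 0 0 = k ∧ s[i - 1 - k]? = some (x k)) := by
      rintro t rfl
      rw [← hlet]
      simp only [Test.holds, NExpr.eval, hi', hkv]
      omega
    have h3 := h2 k le_rfl
    refine (Runs.ite (T := 100) (fun hb => Runs.nset (mem_nvar (by norm_num)) (by decide) ?_)
      (fun hb => Runs.skip ?_ (by decide))).mono (by decide) fun _ h => h
    · rw [htest _ rfl] at hb
      simp only [NExpr.eval, State.setNat, and_self, if_true, hb.1]
      refine ⟨le_rfl, fun k' hk' => ⟨fun _ => ?_, fun _ => hk'⟩⟩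
      have h4 : lastWord x (k + 1) <:+ s.take i := hstep.2 ⟨h3.1 hb.1.ge, hb.2⟩
      exact (lastWord_suffix x hk').trans h4
    · rw [htest _ rfl] at hb
      refine ⟨by omega, fun k' hk' => ?_⟩
      rcases Nat.lt_or_ge k k' with h4 | h4
      · obtain rfl : k' = k + 1 := by omega
        refine iff_of_false (by omega) fun h5 => ?_
        rw [hstep, ← h3] at h5
        exact hb ⟨by omega, h5.2⟩
      · exact h2 k' h4
  · simp only [NExpr.cost]
    omega
  · exact fun τ hI => hI.2

theorem runs_clearCounts (h : HoldsInput e s δ x σ) (hn : 0 < s.length) :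
    Runs (cells (Fintype.card A) s.length) clearCounts σ
      (100 * (s.length * (Fintype.card A + 1)))
      fun τ => ∀ k < s.length, ∀ a : A, τ.nat 21 k (e a) = 0 := by
  refine (Runs.forLoop (N := s.length) (K := 36 * Fintype.card A + 12)
    (I := fun m τ => ∀ k < m, ∀ a : A, τ.nat 21 k (e a) = 0)
    (mem_nvar (by norm_num)) (by decide) ?_ ?_ ?_ ?_).mono ?_ fun _ h => h
  · intro k τ j hI
    simpa [State.setNat] using hI
  · simp
  · intro τ hu
    simp [NExpr.eval, hu.1 1 (by decide), h.size]
  · intro k hk τ hu hkv hI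
    have h' := h.of_unchanged hu (by decide) (by decide)
    refine (Runs.forLoop (N := Fintype.card A) (K := 20)
      (I := fun m τ => (∀ k' < k, ∀ a : A, τ.nat 21 k' (e a) = 0) ∧
        ∀ a : A, (e a : ℕ) < m → τ.nat 21 k (e a) = 0)
      (mem_nvar (by norm_num)) (by decide) ?_ ?_ ?_ ?_).mono ?_ ?_
    · intro k τ j hI
      simpa [State.setNat] using hI
    · exact ⟨hI, by simp⟩
    · intro τ' hu'
      simp [NExpr.eval, hu'.1 0 (by decide), h'.card]
    · intro m hm τ' hu' hmv ⟨h1, h2⟩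
      have hk' : τ'.nat 6 0 0 = k := by rw [hu'.1 6 (by decide), hkv]
      refine Runs.nset ?_ (by decide) ?_
      · simp only [NExpr.eval, hk', hmv]
        exact mem_count hk hm
      · simp only [NExpr.eval, hk', hmv, State.setNat, true_and]
        refine ⟨fun k' hk' a => ?_, fun a ha => ?_⟩
        · rw [if_neg (by omega)]
          exact h1 k' hk' a
        · split_ifs with h3
          · rfl
          · exact h2 a (by omega)
    · simp only [NExpr.cost]
      omega
    · intro τ' ⟨h1, h2⟩ k' hk' a
      rcases Nat.lt_or_ge k' k with h3 | h3
      · exact h1 k' h3 a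
      · obtain rfl : k' = k := by omega
        exact h2 a (e a).2
  · simp only [NExpr.cost]
    nlinarith

/-- Each time `j` increments one cell, addressed by its common suffix length and its next letter.
That length is at most `i < n`, so the address stays inside the table. -/
theorem runs_fillCounts {i : ℕ} (h : HoldsInput e s δ x σ) (hi : σ.nat 4 0 0 = i)
    (hin : i < s.length) (hD : ∀ j < s.length, σ.nat 20 (s.length + j - i) 0 = lcs s i j)
    (hC : ∀ k < s.length, ∀ a : A, σ.nat 21 k (e a) = 0) :
    Runs (cells (Fintype.card A) s.length) fillCounts σ (200 * s.length)
      fun τ => ∀ k < s.length, ∀ a : A, τ.nat 21 k (e a) = exactFollowers s i s.length k a := by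
  classical
  refine (Runs.forLoop (N := s.length) (K := 100)
    (I := fun m τ => ∀ k < s.length, ∀ a : A, τ.nat 21 k (e a) = exactFollowers s i m k a)
    (mem_nvar (by norm_num)) (by decide) ?_ ?_ ?_ ?_).mono ?_ fun _ h => h
  · intro k τ j hI
    simpa [State.setNat] using hI
  · intro k hk a
    rw [hC k hk a, exactFollowers_zero]
  · intro τ hu
    simp [NExpr.eval, hu.1 1 (by decide), h.size]
  · intro j hj τ hu hjv hI
    have h' := h.of_unchanged hu (by decide) (by decide)
    have hi' : τ.nat 4 0 0 = i := by rw [hu.1 4 (by decide), hi]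
    have hd : diag.eval τ = s.length + j - i := by
      simp [diag, NExpr.eval, h'.size, hjv, hi']
    have hD' : τ.nat 20 (s.length + j - i) 0 = lcs s i j := by rw [hu.1 20 (by decide), hD j hj]
    have hL := h'.sample j _ (List.getElem?_eq_getElem hj)
    have hlt := lcs_le_left s i j
    refine Runs.nset ?_ (by decide) ?_
    · simp only [NExpr.eval, hd, hD', hjv, hL]
      exact mem_count (by omega) (e _).2
    · intro k hk a
      simp only [NExpr.eval, hd, hD', hjv, hL, State.setNat, true_and]
      rw [exactFollowers_succ, List.getElem?_eq_getElem hj]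
      have hiff : (k = lcs s i j ∧ (e a : ℕ) = e s[j]) ↔ lcs s i j = k ∧ some s[j] = some a := by
        rw [Fin.val_inj, e.injective.eq_iff, Option.some.injEq, eq_comm, eq_comm (a := a)]
      by_cases hc : k = lcs s i j ∧ (e a : ℕ) = e s[j]
      · rw [if_pos hc, if_pos (hiff.1 hc), ← hc.1, ← hc.2, hI k hk a]
      · rw [if_neg hc, if_neg (mt hiff.2 hc), hI k hk a]
        rfl
  · simp only [NExpr.cost]
    omega

end Estimation

/-! ### Accumulated counts and running minima for one end time. -/

namespace Estimation

open Machine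

section PartialSum

variable {A M : Type*} [Fintype A] [AddCommMonoid M]

/-- The sum over the letters with a number less than `m`. -/
def partialSum (e : A ≃ Fin (Fintype.card A)) (f : A → M) (m : ℕ) : M :=
  ∑ a with (e a : ℕ) < m, f a

theorem partialSum_zero (e : A ≃ Fin (Fintype.card A)) (f : A → M) : partialSum e f 0 = 0 := by
  simp [partialSum]

theorem partialSum_succ (e : A ≃ Fin (Fintype.card A)) (f : A → M) (a : A) :
    partialSum e f (e a + 1) = partialSum e f (e a) + f a := by
  classical
  unfold partialSum
  have : Finset.univ.filter (fun b => (e b : ℕ) < e a + 1) =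
      insert a (Finset.univ.filter fun b => (e b : ℕ) < e a) := by
    ext b
    simp only [Finset.mem_filter, Finset.mem_univ, true_and, Finset.mem_insert]
    rw [Nat.lt_succ_iff_lt_or_eq, Fin.val_inj, e.injective.eq_iff, or_comm]
  rw [this, Finset.sum_insert (by simp), add_comm]

theorem partialSum_card (e : A ≃ Fin (Fintype.card A)) (f : A → M) :
    partialSum e f (Fintype.card A) = ∑ a, f a := by
  simp [partialSum]

theorem exists_letter (e : A ≃ Fin (Fintype.card A)) {m : ℕ} (hm : m < Fintype.card A) :
    ∃ a, (e a : ℕ) = m := ⟨e.symm ⟨m, hm⟩, by simp⟩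

end PartialSum

variable {A : Type*} [Fintype A]
  {e : A ≃ Fin (Fintype.card A)} {s : List A} {δ : ℝ} {x : Past A} {σ τ : State}

theorem runs_clearAccumulators (h : HoldsInput e s δ x σ) (hd : 0 < Fintype.card A) :
    Runs (cells (Fintype.card A) s.length) clearAccumulators σ (100 * Fintype.card A)
      fun τ => ∀ a : A, τ.nat 22 (e a) 0 = 0 ∧
        τ.real 4 (e a) 0 = 1 / (Fintype.card A : ℝ) + 1 := by
  refine (Runs.forLoop (N := Fintype.card A) (K := 40)
    (I := fun m τ => ∀ a : A, (e a : ℕ) < m → τ.nat 22 (e a) 0 = 0 ∧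
        τ.real 4 (e a) 0 = 1 / (Fintype.card A : ℝ) + 1)
    (mem_nvar (by norm_num)) (by decide) ?_ ?_ ?_ ?_).mono ?_ fun τ hI a => hI a (e a).2
  · intro k τ j hI
    simpa [State.setNat] using hI
  · simp
  · intro τ hu
    simp [NExpr.eval, hu.1 0 (by decide), h.card]
  · intro m hm τ hu hmv hI
    have h' := h.of_unchanged hu (by decide) (by decide)
    refine Runs.nset_seq 25 ?_ (by decide) (Runs.rset ?_ (by decide) ?_)
    · simp only [NExpr.eval, hmv]
      exact mem_acc hm
    · simp only [NExpr.eval, hmv, State.setNat]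
      exact mem_minimum hm
    · intro a ha
      rcases Nat.lt_or_ge (e a : ℕ) m with h3 | h3
      · simpa [NExpr.eval, State.setNat, State.setReal, hmv, h3.ne] using hI a h3
      · obtain h4 : (e a : ℕ) = m := by omega
        simp [NExpr.eval, RExpr.eval, State.setNat, State.setReal, hmv, h4, unseen, h'.card]
  · simp only [NExpr.cost]
    omega

/-- By `followers_eq_add` the counters pass from the next greater length to the current one. Their
total is the occurrence number, as every counted occurrence has a next letter. -/
theorem runs_accumulate {i m : ℕ} (h : HoldsInput e s δ x σ) (hi : σ.nat 4 0 0 = i)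
    (hm : σ.nat 11 0 0 = m) (hd : 0 < Fintype.card A)
    (hC : ∀ a : A, σ.nat 21 (i - m) (e a) = exactFollowers s i s.length (i - m) a)
    (hF : ∀ a : A, σ.nat 22 (e a) 0 = followers s i (i - m + 1) a) :
    Runs (cells (Fintype.card A) s.length) accumulate σ (100 * Fintype.card A)
      fun τ => (∀ a : A, τ.nat 22 (e a) 0 = followers s i (i - m) a) ∧
        τ.nat 9 0 0 = ∑ a, followers s i (i - m) a := by
  refine Runs.nset_seq (90 * Fintype.card A) (mem_nvar (by norm_num)) ?_ ?_
  · simp only [NExpr.cost]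
    omega
  simp only [NExpr.eval]
  refine (Runs.forLoop (N := Fintype.card A) (K := 50)
    (I := fun b τ => (∀ a : A, τ.nat 22 (e a) 0 =
        if (e a : ℕ) < b then followers s i (i - m) a else followers s i (i - m + 1) a) ∧
      τ.nat 9 0 0 = partialSum e (followers s i (i - m)) b)
    (mem_nvar (by norm_num)) (by decide) ?_ ?_ ?_ ?_).mono ?_ fun τ hI => ?_
  · intro k τ j hI
    simpa [State.setNat] using hI
  · simpa [State.setNat, partialSum_zero] using hF
  · intro τ hu
    simp [NExpr.eval, hu.1 0 (by decide), State.setNat, h.card]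
  · intro b hb τ hu hbv ⟨h1, h2⟩
    obtain ⟨a, rfl⟩ := exists_letter e hb
    have hi' : τ.nat 4 0 0 = i := by simp [hu.1 4 (by decide), State.setNat, hi]
    have hm' : τ.nat 11 0 0 = m := by simp [hu.1 11 (by decide), State.setNat, hm]
    have hC' : τ.nat 21 (i - m) (e a) = exactFollowers s i s.length (i - m) a := by
      simp [hu.1 21 (by decide), State.setNat, hC]
    have h1a : τ.nat 22 (e a) 0 = followers s i (i - m + 1) a := by simpa using h1 a
    refine Runs.nset_seq 20 ?_ (by decide) (Runs.nset ?_ (by decide) ?_)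
    · simp only [NExpr.eval, hbv]
      exact mem_acc hb
    · exact mem_nvar (by norm_num)
    · simp only [NExpr.eval, State.setNat, hbv, hi', hm', hC', h1a, h2, and_true, true_and,
        ← followers_eq_add]
      refine ⟨fun a' => ?_, ?_⟩
      · by_cases h4 : a' = a
        · simp [h4]
        · have h5 : (e a' : ℕ) ≠ e a := by rwa [Ne, Fin.val_inj, e.injective.eq_iff]
          have h6 : (e a' : ℕ) < e a + 1 ↔ (e a' : ℕ) < e a := by omega
          simp [h5, h6, h1 a']
      · simp [partialSum_succ]
  · simp only [NExpr.cost]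
    omega
  · refine ⟨fun a => ?_, ?_⟩
    · rw [hI.1 a, if_pos (e a).2]
    · rw [hI.2, partialSum_card]

/-- The lower bounds of the upper bounds for `a` at the words of length at least `k` that end at
time `i`. -/
def IsBelowMinimum (s : List A) (δ : ℝ) (i k : ℕ) (a : A) (y : ℝ) : Prop :=
  y ≤ 1 / (Fintype.card A : ℝ) + 1 ∧ ∀ l, k ≤ l → l ≤ i → y ≤ upperBound s δ a i l

/-- The lower bounds of the upper bounds for `a` at the words that end before time `i` and that
extend the last `k` letters of the past. -/
def IsBelowMinorant (s : List A) (δ : ℝ) (x : Past A) (i k : ℕ) (a : A) (y : ℝ) : Prop :=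
  y ≤ 1 / (Fintype.card A : ℝ) + 1 ∧ ∀ i' < i, ∀ l, k ≤ l → l ≤ i' →
    lastWord x k <:+ s.take i' → y ≤ upperBound s δ a i' l

/-- As `IsBelowMinorant`, where for `κ ≤ k` the words that end at time `i` are included. -/
def IsBelowPartial (s : List A) (δ : ℝ) (x : Past A) (i κ k : ℕ) (a : A) (y : ℝ) : Prop :=
  IsBelowMinorant s δ x i k a y ∧
    (κ ≤ k → lastWord x k <:+ s.take i → ∀ l, k ≤ l → l ≤ i → y ≤ upperBound s δ a i l)

/-- The situation before the words of time `i` are treated: none of them is longer than `i`, so the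
second clause is void. -/
theorem isBelowPartial_succ_self {i k : ℕ} {a : A} {y : ℝ} :
    IsBelowPartial s δ x i (i + 1) k a y ↔ IsBelowMinorant s δ x i k a y :=
  ⟨fun h => h.1, fun h => ⟨h, fun h1 _ l h2 h3 => by omega⟩⟩

theorem isBelowPartial_zero {i k : ℕ} {a : A} {y : ℝ} :
    IsBelowPartial s δ x i 0 k a y ↔ IsBelowMinorant s δ x (i + 1) k a y := by
  constructor
  · rintro ⟨⟨h1, h2⟩, h3⟩
    refine ⟨h1, fun i' hi' l hl hli hx => ?_⟩
    rcases Nat.lt_succ_iff_lt_or_eq.1 hi' with h | rfl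
    · exact h2 i' h l hl hli hx
    · exact h3 (Nat.zero_le _) hx l hl hli
  · rintro ⟨h1, h2⟩
    exact ⟨⟨h1, fun i' hi' => h2 i' (by omega)⟩, fun _ hx l hl hli => h2 i (by omega) l hl hli hx⟩

theorem isBelowMinimum_succ {i k : ℕ} (hk : k ≤ i) {a : A} {y : ℝ} :
    IsBelowMinimum s δ i k a y ↔
      IsBelowMinimum s δ i (k + 1) a y ∧ y ≤ upperBound s δ a i k := by
  constructor
  · rintro ⟨h1, h2⟩
    exact ⟨⟨h1, fun l hl => h2 l (by omega)⟩, h2 k le_rfl hk⟩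
  · rintro ⟨⟨h1, h2⟩, h3⟩
    refine ⟨h1, fun l hl hli => ?_⟩
    rcases hl.eq_or_lt with rfl | h
    · exact h3
    · exact h2 l h hli

/-- Treating length `k` affects order `k` alone. There the minimum over all lengths from `k` to `i`
enters at once, since each of these words extends the last `k` letters. -/
theorem isBelowPartial_of_suffix {i k : ℕ} (hx : lastWord x k <:+ s.take i) {a : A} {y : ℝ} :
    IsBelowPartial s δ x i k k a y ↔
      IsBelowPartial s δ x i (k + 1) k a y ∧ IsBelowMinimum s δ i k a y := by
  constructor
  · rintro ⟨h1, h2⟩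
    exact ⟨⟨h1, fun h => by omega⟩, h1.1, h2 le_rfl hx⟩
  · rintro ⟨⟨h1, _⟩, h3⟩
    exact ⟨h1, fun _ _ => h3.2⟩

theorem isBelowPartial_of_not_suffix {i k : ℕ} (hx : ¬ lastWord x k <:+ s.take i) {a : A} {y : ℝ} :
    IsBelowPartial s δ x i k k a y ↔ IsBelowPartial s δ x i (k + 1) k a y :=
  ⟨fun h => ⟨h.1, fun h' => by omega⟩, fun h => ⟨h.1, fun _ h' => absurd h' hx⟩⟩

theorem isBelowPartial_of_ne {i k k' : ℕ} (hk : k' ≠ k) {a : A} {y : ℝ} :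
    IsBelowPartial s δ x i k k' a y ↔ IsBelowPartial s δ x i (k + 1) k' a y := by
  have : k ≤ k' ↔ k + 1 ≤ k' := by omega
  unfold IsBelowPartial
  rw [this]

/-- The word occurs, so the default branches are ruled out and only the counts held by the program
appear. -/
theorem upperBound_eq {i k : ℕ} (hi : i < s.length) (hk : k ≤ i) (a : A) :
    upperBound s δ a i k =
      (followers s i k a : ℝ) / ((∑ b, followers s i k b : ℕ) : ℝ) +
      min ((2 * √2 + 2) * √((followers s i k a : ℝ) / ((∑ b, followers s i k b : ℕ) : ℝ) *
          tStar s.length δ (Fintype.card A) / ((∑ b, followers s i k b : ℕ) : ℝ)) +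
        (3 + 2 * √2) * (tStar s.length δ (Fintype.card A) /
          ((∑ b, followers s i k b : ℕ) : ℝ))) 1 := by
  have : Nonempty A := ⟨a⟩
  have hp := (occPred_wordAt_pos (k := k) hi).ne'
  unfold upperBound conf empP
  rw [if_neg hp, if_neg hp, occ_wordAt_snoc hi hk, sum_followers hi hk]

/-- Cells are specified by their lower bounds, so taking a minimum becomes a conjunction. During the
loop, letters already visited are at length `i - m` and the others still at `i - m + 1`. -/
theorem runs_lowerMinorants {i m : ℕ} (h : HoldsInput e s δ x σ) (hi : σ.nat 4 0 0 = i)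
    (hin : i < s.length) (hm : σ.nat 11 0 0 = m) (hmi : m ≤ i) (hd : 0 < Fintype.card A)
    (ht : σ.real 2 0 0 = tStar s.length δ (Fintype.card A))
    (hell : ∀ k ≤ i, k ≤ σ.nat 8 0 0 ↔ lastWord x k <:+ s.take i)
    (hF : ∀ a : A, σ.nat 22 (e a) 0 = followers s i (i - m) a)
    (hN : σ.nat 9 0 0 = ∑ a, followers s i (i - m) a)
    (hr : ∀ (a : A) y, y ≤ σ.real 4 (e a) 0 ↔ IsBelowMinimum s δ i (i - m + 1) a y)
    (hG : ∀ k ≤ s.length, ∀ (a : A) y,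
      y ≤ σ.real 3 (k + 1) (e a) ↔ IsBelowPartial s δ x i (i - m + 1) k a y) :
    Runs (cells (Fintype.card A) s.length) lowerMinorants σ (300 * Fintype.card A)
      fun τ => (∀ (a : A) y, y ≤ τ.real 4 (e a) 0 ↔ IsBelowMinimum s δ i (i - m) a y) ∧
        ∀ k ≤ s.length, ∀ (a : A) y,
          y ≤ τ.real 3 (k + 1) (e a) ↔ IsBelowPartial s δ x i (i - m) k a y := by
  classical
  refine (Runs.forLoop (N := Fintype.card A) (K := 250)
    (I := fun b τ => (∀ (a : A) y, y ≤ τ.real 4 (e a) 0 ↔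
        IsBelowMinimum s δ i (if (e a : ℕ) < b then i - m else i - m + 1) a y) ∧
      ∀ k ≤ s.length, ∀ (a : A) y, y ≤ τ.real 3 (k + 1) (e a) ↔
        IsBelowPartial s δ x i (if (e a : ℕ) < b then i - m else i - m + 1) k a y)
    (mem_nvar (by norm_num)) (by decide) ?_ ?_ ?_ ?_).mono ?_ fun τ hI => ?_
  · intro k τ j hI
    simpa [State.setNat] using hI
  · simpa using ⟨hr, hG⟩
  · intro τ hu
    simp [NExpr.eval, hu.1 0 (by decide), h.card]
  · intro b hb τ hu hbv ⟨h1, h2⟩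
    obtain ⟨a, rfl⟩ := exists_letter e hb
    have hi' : τ.nat 4 0 0 = i := by rw [hu.1 4 (by decide), hi]
    have hm' : τ.nat 11 0 0 = m := by rw [hu.1 11 (by decide), hm]
    have ht' : τ.real 2 0 0 = tStar s.length δ (Fintype.card A) := by rw [hu.2 2 (by decide), ht]
    have hF' : τ.nat 22 (e a) 0 = followers s i (i - m) a := by rw [hu.1 22 (by decide), hF]
    have hN' : τ.nat 9 0 0 = ∑ a, followers s i (i - m) a := by rw [hu.1 9 (by decide), hN]
    have hell' := hell (i - m) (by omega)
    rw [← hu.1 8 (by decide)] at hell'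
    have hra : ∀ y, y ≤ min (τ.real 4 (e a) 0) (upperBound s δ a i (i - m)) ↔
        IsBelowMinimum s δ i (i - m) a y := by
      intro y
      have := h1 a y
      rw [if_neg (by omega)] at this
      rw [le_min_iff, this, isBelowMinimum_succ (Nat.sub_le i m)]
    have hub := upperBound_eq (δ := δ) hin (Nat.sub_le i m) a
    have hne : ∀ a', a' ≠ a → (e a' : ℕ) ≠ e a := fun a' h' => by
      rwa [Ne, Fin.val_inj, e.injective.eq_iff]
    have hlt : ∀ a', a' ≠ a → ((e a' : ℕ) < e a + 1 ↔ (e a' : ℕ) < e a) := fun a' h' => by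
      have := hne a' h'
      omega
    -- Separates the straight-line computation of the upper bound from the conditional update of the
    -- minorants; the scratch cells no longer matter after it.
    suffices hs : ∀ υ : State, υ.nat = τ.nat → υ.real 3 = τ.real 3 →
        (∀ j, υ.real 4 j 0 =
          if j = e a then min (τ.real 4 (e a) 0) (upperBound s δ a i (i - m)) else τ.real 4 j 0) →
        Runs (cells (Fintype.card A) s.length) (.ite (.nle len (nvar 8))
          (lower 3 (.add len (.const 1)) (nvar 7) (.get 4 (nvar 7) (.const 0))) .skip) υ 70
          fun τ => (∀ (a' : A) y, y ≤ τ.real 4 (e a') 0 ↔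
            IsBelowMinimum s δ i (if (e a' : ℕ) < e a + 1 then i - m else i - m + 1) a' y) ∧
          ∀ k ≤ s.length, ∀ (a' : A) y, y ≤ τ.real 3 (k + 1) (e a') ↔
            IsBelowPartial s δ x i (if (e a' : ℕ) < e a + 1 then i - m else i - m + 1) k a' y by
      refine Runs.rset_seq 230 (mem_rvar (by norm_num)) (by decide) ?_
      refine Runs.rset_seq 160 (mem_rvar (by norm_num)) (by decide) ?_
      refine Runs.lower_seq 140 (mem_rvar (by norm_num)) (by decide) ?_
      refine Runs.rset_seq 100 (mem_rvar (by norm_num)) (by decide) ?_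
      refine Runs.lower_seq 70 ?_ (by decide) (hs _ rfl ?_ fun j => ?_)
      · simp only [NExpr.eval, State.setReal, hbv]
        exact mem_minimum hb
      · funext k j
        simp [State.setReal]
      · rw [hub]
        simp [NExpr.eval, RExpr.eval, radius, State.setReal, hbv, hF', hN', ht']
    intro υ hn h3 h4r
    have h4e : ∀ a', υ.real 4 (e a') 0 =
        if a' = a then min (τ.real 4 (e a) 0) (upperBound s δ a i (i - m))
        else τ.real 4 (e a') 0 := fun a' => by
      rw [h4r]
      simp [Fin.val_inj]
    rw [← hn] at hi' hm' hbv hell'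
    rw [← h3] at h2
    have h1' : ∀ (a' : A) y, y ≤ υ.real 4 (e a') 0 ↔
        IsBelowMinimum s δ i (if (e a' : ℕ) < e a + 1 then i - m else i - m + 1) a' y := by
      intro a' y
      rw [h4e]
      by_cases h4 : a' = a
      · subst h4
        simpa using hra y
      · simpa [h4, hlt a' h4] using h1 a' y
    refine (Runs.ite (T := 50) (fun hc => Runs.lower ?_ (by decide) ?_) fun hc =>
      Runs.skip ⟨h1', fun k hk a' y => ?_⟩ (by decide)).mono (by decide) fun _ h => h
    · simp only [NExpr.eval, hbv, hi', hm']
      exact mem_minorant (by omega) hb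
    · have hx : lastWord x (i - m) <:+ s.take i := by
        rw [← hell']
        simpa [Test.holds, NExpr.eval, hi', hm'] using hc
      refine ⟨fun a' y => ?_, fun k hk a' y => ?_⟩
      · simpa [State.setReal] using h1' a' y
      · by_cases h4 : a' = a
        · subst h4
          have h5 := h2 k hk a' y
          rw [if_neg (by omega)] at h5
          by_cases h6 : k = i - m
          · subst h6
            have h7 := hra y
            rw [le_min_iff] at h7
            simp [NExpr.eval, RExpr.eval, State.setReal, hbv, hi', hm',
              isBelowPartial_of_suffix hx, h5, h7, h4e]
          · simpa [NExpr.eval, RExpr.eval, State.setReal, hbv, hi', hm', h6,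
              isBelowPartial_of_ne h6] using h5
        · simpa [NExpr.eval, RExpr.eval, State.setReal, hbv, hi', hm', hne a' h4, hlt a' h4]
            using h2 k hk a' y
    · have hx : ¬ lastWord x (i - m) <:+ s.take i := by
        rw [← hell']
        simpa [Test.holds, NExpr.eval, hi', hm'] using hc
      by_cases h4 : a' = a
      · subst h4
        have h5 := h2 k hk a' y
        rw [if_neg (by omega)] at h5
        by_cases h6 : k = i - m
        · subst h6
          simp [isBelowPartial_of_not_suffix hx, h5]
        · simpa [isBelowPartial_of_ne h6] using h5
      · simpa [hlt a' h4] using h2 k hk a' y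
  · simp only [NExpr.cost]
    omega
  · refine ⟨fun a y => ?_, fun k hk a y => ?_⟩
    · rw [hI.1 a y, if_pos (e a).2]
    · rw [hI.2 k hk a y, if_pos (e a).2]

end Estimation

/-! ### The full scan, the truncation point and the output. -/

namespace Estimation

open Machine

variable {A : Type*} [Fintype A]
  {e : A ≃ Fin (Fintype.card A)} {s : List A} {δ : ℝ} {x : Past A} {σ τ : State}

/-- The loop variable increases, so the length `i - m` decreases from `i` to `0`, the order that
`followers_eq_add` needs. Initially the counts stand for length `i + 1`, where all are zero. -/
theorem runs_scanWords {i : ℕ} (h : HoldsInput e s δ x σ) (hi : σ.nat 4 0 0 = i)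
    (hin : i < s.length) (hd : 0 < Fintype.card A)
    (ht : σ.real 2 0 0 = tStar s.length δ (Fintype.card A))
    (hell : ∀ k ≤ i, k ≤ σ.nat 8 0 0 ↔ lastWord x k <:+ s.take i)
    (hC : ∀ k < s.length, ∀ a : A, σ.nat 21 k (e a) = exactFollowers s i s.length k a)
    (hA : ∀ a : A, σ.nat 22 (e a) 0 = 0 ∧ σ.real 4 (e a) 0 = 1 / (Fintype.card A : ℝ) + 1)
    (hG : ∀ k ≤ s.length, ∀ (a : A) y,
      y ≤ σ.real 3 (k + 1) (e a) ↔ IsBelowMinorant s δ x i k a y) :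
    Runs (cells (Fintype.card A) s.length) scanWords σ (500 * (s.length * Fintype.card A))
      fun τ => ∀ k ≤ s.length, ∀ (a : A) y,
        y ≤ τ.real 3 (k + 1) (e a) ↔ IsBelowMinorant s δ x (i + 1) k a y := by
  refine (Runs.forLoop (N := i + 1) (K := 400 * Fintype.card A)
    (I := fun m τ => (∀ a : A, τ.nat 22 (e a) 0 = followers s i (i + 1 - m) a) ∧
      (∀ (a : A) y, y ≤ τ.real 4 (e a) 0 ↔ IsBelowMinimum s δ i (i + 1 - m) a y) ∧
      ∀ k ≤ s.length, ∀ (a : A) y,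
        y ≤ τ.real 3 (k + 1) (e a) ↔ IsBelowPartial s δ x i (i + 1 - m) k a y)
    (mem_nvar (by norm_num)) (by decide) ?_ ?_ ?_ ?_).mono ?_ fun τ hI => ?_
  · intro k τ j hI
    simpa [State.setNat] using hI
  · refine ⟨fun a => ?_, fun a y => ?_, fun k hk a y => ?_⟩
    · rw [(hA a).1, followers_of_lt (by omega)]
    · rw [(hA a).2]
      exact ⟨fun h => ⟨h, fun l h1 h2 => by omega⟩, fun h => h.1⟩
    · rw [hG k hk a y]
      exact isBelowPartial_succ_self.symm
  · intro τ hu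
    simp [NExpr.eval, hu.1 4 (by decide), hi]
  · intro m hm τ hu hmv ⟨h1, h2, h3⟩
    have e1 : i + 1 - m = i - m + 1 := by omega
    have e2 : i + 1 - (m + 1) = i - m := by omega
    rw [e1] at h1 h2 h3
    rw [e2]
    have h' := h.of_unchanged hu (by decide) (by decide)
    have hi' : τ.nat 4 0 0 = i := by rw [hu.1 4 (by decide), hi]
    have hT : 400 * Fintype.card A = 100 * Fintype.card A + 300 * Fintype.card A := by ring
    rw [hT]
    refine Runs.seq (runs_accumulate h' hi' hmv hd (fun a => ?_) h1) fun υ hυ ⟨h4, h5⟩ => ?_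
    · rw [hu.1 21 (by decide)]
      exact hC _ (by omega) a
    · refine (runs_lowerMinorants (h'.of_unchanged hυ (by decide) (by decide))
        ((congrFun₂ (hυ.1 4 (by decide)) 0 0).trans hi') hin
        ((congrFun₂ (hυ.1 11 (by decide)) 0 0).trans hmv) (by omega) hd ?_ ?_ h4 h5 ?_
        ?_).and_unchanged.mono le_rfl fun τ h => ⟨?_, h.2⟩
      · rw [hυ.2 2 (by decide), hu.2 2 (by decide), ht]
      · rw [hυ.1 8 (by decide), hu.1 8 (by decide)]
        exact hell
      · rw [hυ.2 4 (by decide)]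
        exact h2
      · rw [hυ.2 3 (by decide)]
        exact h3
      · rw [h.1.1 22 (by decide)]
        exact h4
  · simp only [NExpr.cost]
    nlinarith [Nat.mul_le_mul_right (Fintype.card A) (Nat.succ_le_of_lt hin),
      Nat.mul_le_mul_left s.length hd]
  · intro k hk a y
    rw [hI.2.2 k hk a y, Nat.sub_self]
    exact isBelowPartial_zero

/-- Only the minorants and the suffix lengths carry over from one end time to the next. The work per
end time is of order `n |A|`. -/
theorem runs_scanSample (h : HoldsInput e s δ x σ) (hd : 0 < Fintype.card A)
    (hn : 0 < s.length) (ht : σ.real 2 0 0 = tStar s.length δ (Fintype.card A))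
    (hG : ∀ k ≤ s.length, ∀ a : A, σ.real 3 (k + 1) (e a) = 1 / (Fintype.card A : ℝ) + 1) :
    Runs (cells (Fintype.card A) s.length) scanSample σ
      (2000 * (s.length * (s.length * Fintype.card A)))
      fun τ => ∀ k ≤ s.length, ∀ (a : A) y,
        y ≤ τ.real 3 (k + 1) (e a) ↔ IsBelowMinorant s δ x s.length k a y := by
  refine (Runs.forLoop (N := s.length) (K := 300 * s.length + (300 * s.length +
      (100 * (s.length * (Fintype.card A + 1)) + (200 * s.length + (100 * Fintype.card A +
        500 * (s.length * Fintype.card A))))))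
    (I := fun i τ => (∀ j, 0 < i → 0 < j → j < s.length →
        τ.nat 20 (s.length + j - i) 0 = lcs s (i - 1) (j - 1)) ∧
      ∀ k ≤ s.length, ∀ (a : A) y,
        y ≤ τ.real 3 (k + 1) (e a) ↔ IsBelowMinorant s δ x i k a y)
    (mem_nvar (by norm_num)) (by decide) ?_ ?_ ?_ ?_).mono ?_ fun τ hI => hI.2
  · intro k τ j hI
    simpa [State.setNat] using hI
  · refine ⟨fun j hj => absurd hj (lt_irrefl 0), fun k hk a y => ?_⟩
    rw [hG k hk a]
    exact ⟨fun h => ⟨h, fun i' hi' => absurd hi' (Nat.not_lt_zero _)⟩, fun h => h.1⟩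
  · intro τ hu
    simp [NExpr.eval, hu.1 1 (by decide), h.size]
  · intro i hin τ hu hi ⟨h1, h2⟩
    have g := h.of_unchanged hu (by decide) (by decide)
    have ht0 : τ.real 2 0 0 = tStar s.length δ (Fintype.card A) := by rw [hu.2 2 (by decide), ht]
    refine Runs.seq (runs_updateSuffixes g hi hin h1) fun τ1 u1 hD => ?_
    have g1 := g.of_unchanged u1 (by decide) (by decide)
    have hi1 : τ1.nat 4 0 0 = i := by rw [u1.1 4 (by decide), hi]
    refine Runs.seq (runs_matchPast g1 hi1 hin) fun τ2 u2 hell => ?_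
    have g2 := g1.of_unchanged u2 (by decide) (by decide)
    have hi2 : τ2.nat 4 0 0 = i := by rw [u2.1 4 (by decide), hi1]
    refine Runs.seq (runs_clearCounts g2 hn) fun τ3 u3 hC => ?_
    have g3 := g2.of_unchanged u3 (by decide) (by decide)
    have hi3 : τ3.nat 4 0 0 = i := by rw [u3.1 4 (by decide), hi2]
    have hD3 : τ3.nat 20 = τ1.nat 20 := by rw [u3.1 20 (by decide), u2.1 20 (by decide)]
    refine Runs.seq (runs_fillCounts g3 hi3 hin (by rw [hD3]; exact hD) hC) fun τ4 u4 hF => ?_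
    have g4 := g3.of_unchanged u4 (by decide) (by decide)
    have hi4 : τ4.nat 4 0 0 = i := by rw [u4.1 4 (by decide), hi3]
    refine Runs.seq (runs_clearAccumulators g4 hd) fun τ5 u5 hA => ?_
    have g5 := g4.of_unchanged u5 (by decide) (by decide)
    have hi5 : τ5.nat 4 0 0 = i := by rw [u5.1 4 (by decide), hi4]
    have hell5 : τ5.nat 8 = τ2.nat 8 := by
      rw [u5.1 8 (by decide), u4.1 8 (by decide), u3.1 8 (by decide)]
    have ht5 : τ5.real 2 = τ.real 2 := by
      rw [u5.2 2 (by decide), u4.2 2 (by decide), u3.2 2 (by decide), u2.2 2 (by decide),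
        u1.2 2 (by decide)]
    have hG5 : τ5.real 3 = τ.real 3 := by
      rw [u5.2 3 (by decide), u4.2 3 (by decide), u3.2 3 (by decide), u2.2 3 (by decide),
        u1.2 3 (by decide)]
    have hD5 : τ5.nat 20 = τ1.nat 20 := by rw [u5.1 20 (by decide), u4.1 20 (by decide), hD3]
    refine (runs_scanWords g5 hi5 hin hd (by rw [ht5]; exact ht0) (by rw [hell5]; exact hell)
      (by rw [u5.1 21 (by decide)]; exact hF) hA (by rw [hG5]; exact h2)).and_unchanged.mono le_rfl
      fun υ hυ => ⟨fun j _ hj hjn => ?_, hυ.2⟩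
    -- The pairs `(i + 1, j)` and `(i, j - 1)` share a diagonal, so the values needed at the next
    -- end time are already in place.
    rw [hυ.1.1 20 (by decide), hD5, Nat.add_sub_cancel, ← hD (j - 1) (by omega)]
    congr 1
    omega
  · simp only [NExpr.cost]
    have hl := Nat.mul_le_mul_left s.length (Nat.mul_le_mul hn hd)
    have h2 := Nat.mul_le_mul_left s.length (Nat.mul_le_mul_left s.length hd)
    have h3 := Nat.mul_le_mul_left s.length (Nat.mul_le_mul_right (Fintype.card A) hn)
    have h4 := Nat.mul_le_mul hn (Nat.mul_le_mul hn hd)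
    nlinarith

theorem runs_setThreshold (h : HoldsInput e s δ x σ) :
    Runs (cells (Fintype.card A) s.length) setThreshold σ 100
      fun τ => τ.real 2 0 0 = tStar s.length δ (Fintype.card A) := by
  refine Runs.rset (mem_rvar (by norm_num)) (by decide) ?_
  simp [NExpr.eval, RExpr.eval, State.setReal, h.card, h.size, h.level, tStar, Real.logb]

theorem runs_initMinorants (h : HoldsInput e s δ x σ) (hd : 0 < Fintype.card A)
    (hn : 0 < s.length) :
    Runs (cells (Fintype.card A) s.length) initMinorants σ
      (300 * (s.length * Fintype.card A))
      fun τ => ∀ k ≤ s.length, ∀ a : A,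
        τ.real 3 (k + 1) (e a) = 1 / (Fintype.card A : ℝ) + 1 := by
  refine (Runs.forLoop (N := s.length + 1) (K := 56 * Fintype.card A + 12)
    (I := fun m τ => ∀ k < m, ∀ a : A,
      τ.real 3 (k + 1) (e a) = 1 / (Fintype.card A : ℝ) + 1)
    (mem_nvar (by norm_num)) (by decide) ?_ ?_ ?_ ?_).mono ?_
    fun τ h k hk => h k (by omega)
  · intro k τ j hI
    simpa [State.setNat] using hI
  · simp
  · intro τ hu
    simp [NExpr.eval, hu.1 1 (by decide), h.size]
  · intro k hk τ hu hkv hI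
    have h' := h.of_unchanged hu (by decide) (by decide)
    refine (Runs.forLoop (N := Fintype.card A) (K := 40)
      (I := fun m τ => (∀ k' < k, ∀ a : A,
          τ.real 3 (k' + 1) (e a) = 1 / (Fintype.card A : ℝ) + 1) ∧
        ∀ a : A, (e a : ℕ) < m → τ.real 3 (k + 1) (e a) = 1 / (Fintype.card A : ℝ) + 1)
      (mem_nvar (by norm_num)) (by decide) ?_ ?_ ?_ ?_).mono ?_ ?_
    · intro k τ j hI
      simpa [State.setNat] using hI
    · exact ⟨hI, by simp⟩
    · intro τ' hu'
      simp [NExpr.eval, hu'.1 0 (by decide), h'.card]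
    · intro m hm τ' hu' hmv ⟨h1, h2⟩
      have hk' : τ'.nat 6 0 0 = k := by rw [hu'.1 6 (by decide), hkv]
      have hc : τ'.nat 0 0 0 = Fintype.card A := by rw [hu'.1 0 (by decide), h'.card]
      refine Runs.rset ?_ (by decide) ?_
      · simp only [NExpr.eval, hk', hmv]
        exact mem_minorant (by omega) hm
      · simp only [NExpr.eval, RExpr.eval, unseen, hk', hmv, hc, State.setReal, true_and,
          Nat.cast_one]
        refine ⟨fun k' hk' a => ?_, fun a ha => ?_⟩
        · rw [if_neg (by omega)]
          exact h1 k' hk' a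
        · split_ifs with h3
          · rfl
          · exact h2 a (by omega)
    · simp only [NExpr.cost]
      omega
    · intro τ' ⟨h1, h2⟩ k' hk' a
      rcases Nat.lt_or_ge k' k with h3 | h3
      · exact h1 k' h3 a
      · obtain rfl : k' = k := by omega
        exact h2 a (e a).2
  · simp only [NExpr.cost]
    have hl := Nat.mul_le_mul hn hd
    have h2 := Nat.mul_le_mul_left s.length hd
    have h3 := Nat.mul_le_mul_right (Fintype.card A) hn
    nlinarith

theorem runs_clearFirstRow (h : HoldsInput e s δ x σ) (hd : 0 < Fintype.card A) :
    Runs (cells (Fintype.card A) s.length) clearFirstRow σ (100 * Fintype.card A)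
      fun τ => (∀ a : A, τ.real 3 0 (e a) = 0) ∧
        ∀ k j, τ.real 3 (k + 1) j = σ.real 3 (k + 1) j := by
  refine (Runs.forLoop (N := Fintype.card A) (K := 40)
    (I := fun m τ => (∀ a : A, (e a : ℕ) < m → τ.real 3 0 (e a) = 0) ∧
      ∀ k j, τ.real 3 (k + 1) j = σ.real 3 (k + 1) j)
    (mem_nvar (by norm_num)) (by decide) ?_ ?_ ?_ ?_).mono ?_
    fun τ hI => ⟨fun a => hI.1 a (e a).2, hI.2⟩
  · intro k τ j hI
    simpa [State.setNat] using hI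
  · simp
  · intro τ hu
    simp [NExpr.eval, hu.1 0 (by decide), h.card]
  · intro m hm τ hu hmv ⟨h1, h2⟩
    refine Runs.rset ?_ (by decide) ?_
    · simp only [NExpr.eval, hmv]
      exact mem_minorant (by omega) hm
    · simp only [NExpr.eval, RExpr.eval, hmv, State.setReal, true_and, Nat.cast_zero]
      refine ⟨fun a ha => ?_, fun k j => ?_⟩
      · split_ifs with h3
        · rfl
        · exact h1 a (by omega)
      · rw [if_neg (by omega)]
        exact h2 k j
  · simp only [NExpr.cost]
    omega

variable [Nonempty A]

/-- By `one_le_sum_iff` the order `k` fails the test exactly below the truncation point, so after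
`m` orders the counter is the minimum of `m` and that point. As the point is at most `n`, testing
`n` orders is enough. -/
theorem runs_findTruncation (h : HoldsInput e s δ x σ) (hs : s ≠ []) (h0 : 0 < δ) (h1 : δ < 1)
    (hM : ∀ k ≤ s.length + 1, ∀ a : A, σ.real 3 k (e a) = prevMinorant s δ a x k) :
    Runs (cells (Fintype.card A) s.length) findTruncation σ
      (300 * (s.length * Fintype.card A))
      fun τ => τ.nat 10 0 0 = truncPoint s δ x := by
  have hn : 0 < s.length := List.length_pos_iff.2 hs
  have hd : 0 < Fintype.card A := Fintype.card_pos
  have hl := Nat.mul_le_mul hn hd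
  have hl2 := Nat.mul_le_mul_left s.length hd
  refine Runs.nset_seq (290 * (s.length * Fintype.card A)) (mem_nvar (by norm_num)) ?_ ?_
  · simp only [NExpr.cost]
    nlinarith
  simp only [NExpr.eval]
  refine (Runs.forLoop (N := s.length) (K := 20 + (56 * Fintype.card A + 12 + 40))
    (I := fun m τ => τ.nat 10 0 0 = min m (truncPoint s δ x))
    (mem_nvar (by norm_num)) (by decide) ?_ ?_ ?_ ?_).mono ?_ fun τ hI => ?_
  · intro k τ j hI
    simpa [State.setNat] using hI
  · simp [State.setNat]
  · intro τ hu
    simp [NExpr.eval, hu.1 1 (by decide), State.setNat, h.size]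
  · intro k hk τ hu hkv hI
    have hM' : ∀ a : A, τ.real 3 (k + 1) (e a) = empMinorant s δ a (lastWord x k) := fun a => by
      rw [hu.2 3 (by decide)]
      exact hM (k + 1) (by omega) a
    have hc : τ.nat 0 0 0 = Fintype.card A := by
      rw [hu.1 0 (by decide)]
      simp [State.setNat, h.card]
    refine Runs.rset_seq (56 * Fintype.card A + 12 + 40) (mem_rvar (by norm_num)) ?_ ?_
    · simp only [NExpr.cost, RExpr.cost]
      omega
    have hloop : Runs (cells (Fintype.card A) s.length) (forLoop 7 (nvar 0)
        (.rset 5 (.const 0) (.const 0)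
            (.add (rvar 5) (.get 3 (.add (nvar 6) (.const 1)) (nvar 7)))))
        (τ.setReal 5 0 0 0) (56 * Fintype.card A + 12)
        fun υ => υ.real 5 0 0 = ∑ a, empMinorant s δ a (lastWord x k) := by
      refine (Runs.forLoop (N := Fintype.card A) (K := 40)
        (I := fun m υ => υ.real 5 0 0 =
          partialSum e (fun a => empMinorant s δ a (lastWord x k)) m)
        (mem_nvar (by norm_num)) (by decide) ?_ ?_ ?_ ?_).mono ?_ fun υ hI => ?_
      · intro k τ j hI
        simpa [State.setNat] using hI
      · simp [State.setReal, partialSum_zero]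
      · intro υ hυ
        simp [NExpr.eval, hυ.1 0 (by decide), State.setReal, hc]
      · intro m hm υ hυ hmv hI
        obtain ⟨a, rfl⟩ := exists_letter e hm
        have hk6 : υ.nat 6 0 0 = k := by
          rw [hυ.1 6 (by decide)]
          exact hkv
        have hMa : υ.real 3 (k + 1) (e a) = empMinorant s δ a (lastWord x k) := by
          rw [hυ.2 3 (by decide)]
          simpa [State.setReal] using hM' a
        refine Runs.rset (mem_rvar (by norm_num)) (by decide) ?_
        simp [NExpr.eval, RExpr.eval, State.setReal, hmv, hk6, hMa, hI, partialSum_succ]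
      · simp only [NExpr.cost]
        omega
      · rw [hI, partialSum_card]
    have hz : (τ.setReal 5 ((NExpr.const 0).eval τ) ((NExpr.const 0).eval τ)
        ((rconst 0).eval τ)) = τ.setReal 5 0 0 0 := by
      simp [NExpr.eval, RExpr.eval]
    rw [hz]
    refine Runs.seq hloop fun υ hυ hS => ?_
    have hk6 : υ.nat 6 0 0 = k := by
      rw [hυ.1 6 (by decide)]
      exact hkv
    have hI' : υ.nat 10 0 0 = min k (truncPoint s δ x) := by
      rw [hυ.1 10 (by decide)]
      exact hI
    have htest : (Test.rle (rconst 1) (rvar 5)).holds υ ↔ truncPoint s δ x ≤ k := by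
      rw [← one_le_sum_iff hs h0 h1 x k, ← hS]
      simp [Test.holds, NExpr.eval, RExpr.eval]
    refine (Runs.ite (T := 20) (fun hb => Runs.skip ?_ (by decide))
      (fun hb => Runs.nset (mem_nvar (by norm_num)) (by decide) ?_)).mono (by decide) fun _ h => h
    · rw [htest] at hb
      omega
    · rw [htest] at hb
      simp only [NExpr.eval, State.setNat, hk6, and_self, if_true]
      omega
  · simp only [NExpr.cost]
    nlinarith
  · rw [hI, min_eq_right (truncPoint_le hs h0 h1 x)]

/-- Thanks to `estimator_eq` no sum over orders is formed: rows `t` and `t + 1` of the table hold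
the last two minorants, row `0` being the zero row. -/
theorem runs_writeOutput (h : HoldsInput e s δ x σ) (hs : s ≠ []) (h0 : 0 < δ) (h1 : δ < 1)
    (ht : σ.nat 10 0 0 = truncPoint s δ x)
    (hM : ∀ k ≤ s.length + 1, ∀ a : A, σ.real 3 k (e a) = prevMinorant s δ a x k) :
    Runs (cells (Fintype.card A) s.length) writeOutput σ (300 * Fintype.card A)
      fun τ => ∀ a : A, τ.real 1 (e a) 0 = estimator s δ a x := by
  have hd : 0 < Fintype.card A := Fintype.card_pos
  have htn := truncPoint_le hs h0 h1 x
  set t := truncPoint s δ x with ht'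
  have hprev : ∀ a, σ.real 3 t (e a) = prevMinorant s δ a x t := hM t (by omega)
  have hlast : ∀ a, σ.real 3 (t + 1) (e a) = empMinorant s δ a (lastWord x t) := fun a =>
    hM (t + 1) (by omega) a
  refine Runs.rset_seq (280 * Fintype.card A) (mem_rvar (by norm_num)) ?_ ?_
  · simp only [NExpr.cost, RExpr.cost]
    omega
  refine Runs.rset_seq (260 * Fintype.card A) (mem_rvar (by norm_num)) ?_ ?_
  · simp only [NExpr.cost, RExpr.cost]
    omega
  simp only [NExpr.eval, RExpr.eval, Nat.cast_zero]
  have hT : 260 * Fintype.card A = 120 * Fintype.card A + 140 * Fintype.card A := by ring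
  rw [hT]
  set ρ := (σ.setReal 5 0 0 0).setReal 7 0 0 0 with hρ
  have hρn : ρ.nat = σ.nat := rfl
  have hρ3 : ρ.real 3 = σ.real 3 := by
    funext k j
    simp [hρ, State.setReal]
  refine Runs.seq (R := fun τ =>
    τ.real 5 0 0 = ∑ a, prevMinorant s δ a x t ∧
    τ.real 7 0 0 = ∑ a, (empMinorant s δ a (lastWord x t) - prevMinorant s δ a x t)) ?_
    fun υ hυ ⟨hP, hQ⟩ => ?_
  · refine (Runs.forLoop (N := Fintype.card A) (K := 80)
      (I := fun m τ => τ.real 5 0 0 = partialSum e (fun a => prevMinorant s δ a x t) m ∧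
        τ.real 7 0 0 = partialSum e (fun a => empMinorant s δ a (lastWord x t) -
          prevMinorant s δ a x t) m)
      (mem_nvar (by norm_num)) (by decide) ?_ ?_ ?_ ?_).mono ?_ fun υ hI => ?_
    · intro k τ j hI
      simpa [State.setNat] using hI
    · simp [hρ, State.setReal, partialSum_zero]
    · intro υ hυ
      simp [NExpr.eval, hυ.1 0 (by decide), hρn, h.card]
    · intro m hm υ hυ hmv ⟨hI1, hI2⟩
      obtain ⟨a, rfl⟩ := exists_letter e hm
      have ht10 : υ.nat 10 0 0 = t := by rw [hυ.1 10 (by decide), hρn, ht]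
      have e1 : υ.real 3 t (e a) = prevMinorant s δ a x t := by
        rw [hυ.2 3 (by decide), hρ3, hprev]
      have e2 : υ.real 3 (t + 1) (e a) = empMinorant s δ a (lastWord x t) := by
        rw [hυ.2 3 (by decide), hρ3, hlast]
      refine Runs.rset_seq 50 (mem_rvar (by norm_num)) (by decide)
        (Runs.rset (mem_rvar (by norm_num)) (by decide) ?_)
      simp [NExpr.eval, RExpr.eval, State.setReal, hmv, ht10, e1, e2, hI1, hI2, partialSum_succ]
    · simp only [NExpr.cost]
      omega
    · rw [hI.1, hI.2, partialSum_card, partialSum_card]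
      exact ⟨rfl, rfl⟩
  · refine (Runs.forLoop (N := Fintype.card A) (K := 80)
      (I := fun m τ => ∀ a : A, (e a : ℕ) < m → τ.real 1 (e a) 0 = estimator s δ a x)
      (mem_nvar (by norm_num)) (by decide) ?_ ?_ ?_ ?_).mono ?_ fun τ hI a => hI a (e a).2
    · intro k τ j hI
      simpa [State.setNat] using hI
    · simp
    · intro τ hτ
      simp [NExpr.eval, hτ.1 0 (by decide), hυ.1 0 (by decide), hρn, h.card]
    · intro m hm τ hτ hmv hI
      obtain ⟨a, rfl⟩ := exists_letter e hm
      have ht10 : τ.nat 10 0 0 = t := by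
        rw [hτ.1 10 (by decide), hυ.1 10 (by decide), hρn, ht]
      have e1 : τ.real 3 t (e a) = prevMinorant s δ a x t := by
        rw [hτ.2 3 (by decide), hυ.2 3 (by decide), hρ3, hprev]
      have e2 : τ.real 3 (t + 1) (e a) = empMinorant s δ a (lastWord x t) := by
        rw [hτ.2 3 (by decide), hυ.2 3 (by decide), hρ3, hlast]
      have e3 : τ.real 5 0 0 = ∑ a, prevMinorant s δ a x t := by rw [hτ.2 5 (by decide), hP]
      have e4 : τ.real 7 0 0 =
          ∑ a, (empMinorant s δ a (lastWord x t) - prevMinorant s δ a x t) := by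
        rw [hτ.2 7 (by decide), hQ]
      refine Runs.rset ?_ (by decide) ?_
      · simp only [NExpr.eval, hmv]
        exact mem_out hm
      · intro a' ha'
        simp only [NExpr.eval, RExpr.eval, State.setReal, hmv, ht10, e1, e2, e3, e4, true_and,
          and_true, Nat.cast_one]
        split_ifs with h3
        · obtain rfl : a' = a := e.injective (Fin.ext h3)
          exact (estimator_eq hs h0 h1 a' x).symm
        · exact hI a' (by omega)
    · simp only [NExpr.cost]
      omega

theorem holdsInput_inputState (e : A ≃ Fin (Fintype.card A)) (s : List A) (δ : ℝ) (x : Past A) :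
    HoldsInput e s δ x (inputState e s δ x) where
  card := by simp [inputState]
  size := by simp [inputState]
  sample j a hj := by
    obtain ⟨h1, rfl⟩ := List.getElem?_eq_some_iff.1 hj
    simp [inputState, h1]
  past k hk := by simp [inputState, hk]
  level := by simp [inputState]

theorem runs_estimate (e : A ≃ Fin (Fintype.card A)) (hs : s ≠ []) (h0 : 0 < δ) (h1 : δ < 1)
    (x : Past A) :
    Runs (cells (Fintype.card A) s.length) estimate (inputState e s δ x)
      (4000 * (s.length * (s.length * Fintype.card A)))
      fun τ => ∀ a : A, τ.real 1 (e a) 0 = estimator s δ a x := by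
  have hn : 0 < s.length := List.length_pos_iff.2 hs
  have hd : 0 < Fintype.card A := Fintype.card_pos
  have g := holdsInput_inputState e s δ x
  refine (Runs.seq (runs_setThreshold g) fun τ1 u1 ht => ?_).mono (T := 100 +
    (300 * (s.length * Fintype.card A) + (2000 * (s.length * (s.length * Fintype.card A)) +
      (100 * Fintype.card A + (300 * (s.length * Fintype.card A) + 300 * Fintype.card A)))))
      ?_ fun _ h => h
  · have g1 := g.of_unchanged u1 (by decide) (by decide)
    refine Runs.seq (runs_initMinorants g1 hd hn) fun τ2 u2 hG => ?_
    have g2 := g1.of_unchanged u2 (by decide) (by decide)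
    refine Runs.seq (runs_scanSample g2 hd hn (by rw [u2.2 2 (by decide), ht]) hG)
      fun τ3 u3 hM => ?_
    have g3 := g2.of_unchanged u3 (by decide) (by decide)
    refine Runs.seq (runs_clearFirstRow g3 hd) fun τ4 u4 ⟨hz, hrow⟩ => ?_
    have g4 := g3.of_unchanged u4 (by decide) (by decide)
    have hM4 : ∀ k ≤ s.length + 1, ∀ a : A, τ4.real 3 k (e a) = prevMinorant s δ a x k := by
      intro k hk a
      cases k with
      | zero => exact hz a
      | succ k =>
        rw [hrow]
        -- The table was specified by lower bounds; a real number is determined by these.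
        refine eq_of_forall_le_iff fun y => ?_
        rw [hM k (by omega) a y]
        exact (le_empMinorant_lastWord_iff hs h0 h1).symm
    refine Runs.seq (runs_findTruncation g4 hs h0 h1 hM4) fun τ5 u5 ht5 => ?_
    refine runs_writeOutput (g4.of_unchanged u5 (by decide) (by decide)) hs h0 h1 ht5 ?_
    rw [u5.2 3 (by decide)]
    exact hM4
  · have hl := Nat.mul_le_mul_left s.length (Nat.mul_le_mul hn hd)
    have h2 := Nat.mul_le_mul_right (Fintype.card A) hn
    have h3 := Nat.mul_le_mul_left s.length (Nat.mul_le_mul_right (Fintype.card A) hn)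
    have h4 := Nat.mul_le_mul hn (Nat.mul_le_mul hn hd)
    nlinarith

/-- The program `estimate` computes the estimator in time `O(|A|² n²)` and space `O(|A| n)`. -/
theorem computesEstimator_estimate : ComputesEstimator.{u} estimate 4000 := by
  intro A _ _ e s δ x hs h0 h1
  have hn : 0 < s.length := List.length_pos_iff.2 hs
  have hd : 0 < Fintype.card A := Fintype.card_pos
  obtain ⟨T, τ, hex, hT, hout⟩ := runs_estimate e hs h0 h1 x
  refine ⟨cells (Fintype.card A) s.length, T, τ, hex, hT.trans ?_, (card_cells_le hd hn).trans ?_,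
    hout⟩
  -- The step count obtained is linear in `|A|`; the second factor `|A|` is slack.
  · have h2 := Nat.mul_le_mul_left (s.length ^ 2 * Fintype.card A) hd
    nlinarith
  · gcongr
    norm_num

end Estimation

end RandomContext

theorem theorem3 :
    -- the estimator is computed by one program, in time `O(|A|² n²)` and space `O(|A| n)`
    (∃ (c : Machine.Program) (C : ℕ), ComputesEstimator.{u} c C) ∧
    -- the estimator consists of transition probabilities
    (∀ (A : Type u) [Fintype A] [Nonempty A] [MeasurableSpace A] [MeasurableSingletonClass A]
      (s : List A) (δ : ℝ), s ≠ [] → 0 < δ → δ < 1 →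
        IsTransitionProbability (estimator s δ)) ∧
    -- the oracle inequality
    (∀ (A : Type u) [Fintype A] [Nonempty A] [MeasurableSpace A] [MeasurableSingletonClass A]
      (Ω : Type v) [MeasurableSpace Ω] (P : Measure Ω) [IsProbabilityMeasure P]
      (X : ℤ → Ω → A), (∀ i, Measurable (X i)) → HasShiftInvariantLaw P X → IsASContinuous P X →
      -- the canonical version dominates the minorants at every past, any version at almost every one
      (IsVersion P X (canonicalVersion P X) ∧ ∀ x, Dominates P X (canonicalVersion P X) x) ∧
      ∀ p : A → Past A → ℝ, IsVersion P X p →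
        (∀ᵐ ω ∂P, Dominates P X p (past X ω)) ∧
        ∀ (n : ℕ) (δ : ℝ), 1 ≤ n → 0 < δ → δ < 1 →
          ENNReal.ofReal (1 - δ) ≤
            P {ω | ∀ x : Past A, Dominates P X p x →
              ∀ L : ℕ, 0 < occPred (sample X n ω) (lastWord x L) →
                dTV (fun a => p a x) (fun a => estimator (sample X n ω) δ a x) ≤
                  1 - ∑ a, minorant P X a (lastWord x L)
                    + (4 + 4 * √2) * √(tParam n δ (Fintype.card A) /
                        occPred (sample X n ω) (lastWord x L))
                    + (6 + 4 * √2) * (tParam n δ (Fintype.card A) /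
                        occPred (sample X n ω) (lastWord x L))}) := by
  refine ⟨⟨_, _, Estimation.computesEstimator_estimate⟩,
    fun A _ _ _ _ s δ hs h0 h1 => isTransitionProbability_estimator hs h0 h1, ?_⟩
  rintro A _ _ _ _ Ω _ P _ X hX hst ⟨q, hq, hc⟩
  refine ⟨⟨hq.isVersion_canonicalVersion hX hc, hq.dominates_canonicalVersion hX⟩, ?_⟩
  exact fun p hp => ⟨hp.ae_dominates hX, fun n δ hn h0 h1 =>
    hp.ofReal_le_measure_oracle hX hst hn h0 h1⟩
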